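/- **Setting.** Let $G_{eqt}$ be the infinite regular triangular grid graph. An *amoebot structure* is a finite, nonempty set $X$ of $n$ nodes of $G_{eqt}$ inducing a connected subgraph; each node of $X$ is occupied by one amoebot. The amoebots are anonymous identical randomized finite state machines (one fair coin per amoebot and round) working in synchronous rounds. Every edge incident to an amoebot carries $k\ge 2$ linearly ordered pins ($k$ constant), and neighboring amoebots share the pins of their common edge. Each amoebot has a private chirality (a sense of rotation, clockwise or counterclockwise) and a private compass direction, and labels its edges and the pins on them consecutively according to these. In each round an amoebot learns which incident edges lead to an amoebot and on which of its pins it receives a beep, updates its memory, connects its pins by wires arbitrarily, and beeps on some pins. The *circuits* are the connected components of the graph formed by all pins and wires; a beep on a circuit is received at the beginning of the next round on all pins of that circuit. A *shape* $\mathcal S$ is a finite set of triangular faces of $G_{eqt}$; it is *connected* if it is nonempty and induces a connected subgraph of the dual graph. A *transformation* $T$ is a rotation by a multiple of $60^\circ$, followed by a scaling by an integer $\sigma\ge 1$ and a translation by a grid vector; $V(T(\mathcal S))$ is the set of all grid nodes lying on a vertex, on an edge, or inside of a triangle of $T(\mathcal S)$, and the sets $V(T(\mathcal S))$ are the *representations*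 of $\mathcal S$. The shape $\mathcal S$ is *minimal* if $|\mathcal S|\le|\mathcal S'|$ for every shape $\mathcal S'$ such that every representation of $\mathcal S$ is also a representation of $\mathcal S'$. Let $\overline{\mathcal S}$ be the mirror image of $\mathcal S$ under a reflection of the grid. **Theorem.** Let $\mathcal S$ be a connected, minimal shape and let $k\ge 2$. 1. (Common chirality.) There are an algorithm and a constant $R$, depending only on $\mathcal S$ and $k$, such that on every amoebot structure $X$ whose amoebots share a common chirality, for all compass directions and all coin tosses, all amoebots terminate within $R$ rounds, each with the correct answer to the question whether $X$ is a representation of $\mathcal S$. Here $\mathcal S$ is read in the common chirality of the amoebots: the question concerns $\mathcal S$ if this chirality is counterclockwise, and $\overline{\mathcal S}$ if it is clockwise. 2. (Arbitrary chiralities.) There is an algorithm, depending only on $\mathcal S$ and $k$, that decides whether $X$ is a representation of $\mathcal S$ up to reflection, i.e. a representation of $\mathcal S$ or of $\overline{\mathcal S}$, in $O(\log n)$ rounds w.h.p.: for all amoebot structures $X$, all chiralities and compass directions, and all coin tosses, no amoebot ever terminates with a wrong answer; and for every $c\in\mathbb N$ there is a constant $C$ such that on every amoebot structure of $n$ amoebots,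 with all chiralities and compass directions, all amoebots terminate within $C\log n$ rounds with probability at least $1-n^{-c}$. In particular, if $\overline{\mathcal S}$ has the same representations as $\mathcal S$, this decides whether $X$ is a representation of $\mathcal S$. -/

import Mathlib

open MeasureTheory ProbabilityTheory

namespace Amoebot

/-! ## The triangular grid -/

/-- Nodes of the infinite regular triangular grid in axial coordinates: `(x, y)` stands for the
point `x + y * exp (i * π / 3)` of the complex plane. -/
abbrev Node : Type := ℤ × ℤ

/-- Counterclockwise rotation by 60 degrees about the origin. -/
def rot60 (p : Node) : Node := (-p.2, p.1 + p.2)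

/-- The six unit vectors of the grid, in counterclockwise order. -/
def dirVec (d : ZMod 6) : Node := rot60^[d.val] (1, 0)

/-- The infinite regular triangular grid graph. -/
def triGrid : SimpleGraph Node where
  Adj u v := ∃ d : ZMod 6, v = u + dirVec d
  symm := ⟨by
    rintro u v ⟨d, rfl⟩
    refine ⟨d + 3, ?_⟩
    have h : ∀ d : ZMod 6, dirVec d + dirVec (d + 3) = 0 := by decide
    rw [add_assoc, h, add_zero]⟩
  loopless := ⟨by
    rintro u ⟨d, hd⟩
    have h : ∀ d : ZMod 6, dirVec d ≠ 0 := by decide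
    exact h d (by simpa using hd.symm)⟩

/-! ## Shapes and their representations -/

/-- A triangular face of the grid. The face with corner `p` is the triangle
`p, p + (1, 0), p + (0, 1)` if `up = true`, and the triangle
`p + (1, 0), p + (0, 1), p + (1, 1)` if `up = false`. -/
structure Face where
  corner : Node
  up : Bool
deriving DecidableEq

/-- The three vertices of a face. -/
def Face.vertices (F : Face) : Finset Node :=
  if F.up then {F.corner, F.corner + (1, 0), F.corner + (0, 1)}
  else {F.corner + (1, 0), F.corner + (0, 1), F.corner + (1, 1)}

/-- The dual graph of the grid: two faces are adjacent if they share an edge. -/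
def dualGrid : SimpleGraph Face where
  Adj F G := F ≠ G ∧ (F.vertices ∩ G.vertices).card = 2
  symm := ⟨fun F G h => ⟨h.1.symm, by rw [Finset.inter_comm]; exact h.2⟩⟩
  loopless := ⟨fun _ h => h.1 rfl⟩

/-- A shape is a finite set of faces of the grid. -/
abbrev Shape : Type := Finset Face

/-- A shape is connected if it induces a connected subgraph of the dual graph
(in particular it is nonempty). -/
def Shape.IsConnected (S : Shape) : Prop := (dualGrid.induce (S : Set Face)).Connected

/-- A rotation (by a multiple of 60 degrees), followed by an isotropic scaling (by a positive
integer) and a translation; these are the orientation-preserving similarities that map the nodes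
of the grid to nodes and the edges of the grid into grid lines. -/
structure Transformation where
  turns : ℕ
  scale : ℕ
  scale_pos : 0 < scale
  shift : Node

/-- The image of a grid node under a transformation. -/
def Transformation.apply (T : Transformation) (p : Node) : Node :=
  T.shift + T.scale • rot60^[T.turns] p

/-- A grid node as a point of the plane, in (affine) axial coordinates. -/
def toPlane (p : Node) : ℝ × ℝ := ((p.1 : ℝ), (p.2 : ℝ))

/-- `V(T(S))`: all grid nodes that lie on a vertex, on an edge, or inside of one of the
triangles of the transformed shape `T(S)`. -/
def Shape.nodes (S : Shape) (T : Transformation) : Set Node :=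
  {p | ∃ F ∈ S, toPlane p ∈ convexHull ℝ ((fun v => toPlane (T.apply v)) '' (F.vertices : Set Node))}

/-- `X` is a representation of `S`: it equals `V(T(S))` for some transformation `T`. -/
def Shape.IsRepresentation (S : Shape) (X : Set Node) : Prop :=
  ∃ T : Transformation, X = S.nodes T

/-- A shape is minimal if no shape with fewer faces has all representations of `S` among its
representations. -/
def Shape.IsMinimal (S : Shape) : Prop :=
  ∀ S' : Shape, (∀ T : Transformation, ∃ T' : Transformation, S.nodes T = S'.nodes T') →
    S.card ≤ S'.card

/-- The mirror image of a shape, under the reflection `(x, y) ↦ (y, x)` of the grid. -/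
def Shape.mirror (S : Shape) : Shape := S.image fun F => ⟨F.corner.swap, F.up⟩

/-! ## Amoebot structures -/

/-- A connected (in particular nonempty) amoebot structure, given by the set of occupied nodes,
together with the private orientation of every amoebot: `chirality u` is `true` if `u` takes
counterclockwise as its positive sense of rotation and `false` if it takes clockwise, and
`compass u` is the direction of the edge that `u` labels `0`. -/
structure System where
  occupied : Finset Node
  connected : (triGrid.induce (occupied : Set Node)).Connected
  chirality : {u // u ∈ occupied} → Bool
  compass : {u // u ∈ occupied} → ZMod 6

/-- The amoebots of a system. -/
abbrev System.Bot (X : System) : Type := {u // u ∈ X.occupied}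

/-- The number of amoebots. -/
def System.size (X : System) : ℕ := X.occupied.card

/-- The global direction of the edge with local label `l`: amoebots label their six incident
edges consecutively, starting at their compass direction, in their positive sense of rotation. -/
def System.globalDir (X : System) (u : X.Bot) (l : ZMod 6) : ZMod 6 :=
  if X.chirality u then X.compass u + l else X.compass u - l

/-- The position, counted counterclockwise around `u`, of the pin of an edge that has local
number `i`: amoebots number the `k` pins of an edge in their positive sense of rotation. -/
def System.globalIdx (X : System) {k : ℕ} (u : X.Bot) (i : Fin k) : Fin k :=
  if X.chirality u then i else i.rev

/-- The local labels of the edges of `u` that lead to an occupied node. -/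
def System.bonds (X : System) (u : X.Bot) : Set (ZMod 6) :=
  {l | u.1 + dirVec (X.globalDir u l) ∈ X.occupied}

/-- A pin as labelled by an amoebot: the local label of the edge, and the number on that edge. -/
abbrev LocalPin (k : ℕ) : Type := ZMod 6 × Fin k

/-! ## Algorithms: synchronous randomized finite state machines with reconfigurable circuits -/

/-- An amoebot algorithm for `k` pins per edge. In each round an amoebot looks (which of
its edges are bonds; on which of its pins it receives a beep), tosses a fair coin, updates its
memory, and then acts as told by the new content of its memory: it connects its pins by
wires and beeps on some of them. `output s = some b` means that an amoebot in state `s`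
has terminated with answer `b`. -/
structure Algorithm (k : ℕ) where
  State : Type
  finite_state : Finite State
  init : State
  step : State → (bonds : Set (ZMod 6)) → (heard : Set (LocalPin k)) → (coin : Bool) → State
  wires : State → LocalPin k → LocalPin k → Prop
  beeps : State → Set (LocalPin k)
  output : State → Option Bool

section Execution

variable {k : ℕ}

/-- Two labelled pins are the same physical pin of a bond: they belong to the same edge, seen from
its two ends, and counterclockwise around one end is the reverse of counterclockwise around the
other end. -/
def System.SamePin (X : System) (a b : X.Bot × LocalPin k) : Prop :=
  b.1.1 = a.1.1 + dirVec (X.globalDir a.1 a.2.1) ∧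
  a.1.1 = b.1.1 + dirVec (X.globalDir b.1 b.2.1) ∧
  X.globalIdx b.1 b.2.2 = (X.globalIdx a.1 a.2.2).rev

/-- Two pins belong to the same circuit: the circuits are the connected components of the graph on
all pins whose edges are the wires inside the amoebots, after identification of the pins shared by
neighbors. -/
def Algorithm.SameCircuit (A : Algorithm k) (X : System) (state : X.Bot → A.State) :
    X.Bot × LocalPin k → X.Bot × LocalPin k → Prop :=
  Relation.EqvGen fun a b =>
    (a.1 = b.1 ∧ A.wires (state a.1) a.2 b.2) ∨ X.SamePin a b

/-- The pins on which `u` receives a beep, when all amoebots act according to `state`. -/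
def Algorithm.received (A : Algorithm k) (X : System) (state : X.Bot → A.State) (u : X.Bot) :
    Set (LocalPin k) :=
  {q | ∃ v : X.Bot, ∃ r ∈ A.beeps (state v), A.SameCircuit X state (v, r) (u, q)}

/-- The memory of all amoebots, and the beeps that wait to be received, after `t` rounds, where
`coin (t, u)` is the coin tossed by `u` in round `t`. -/
def Algorithm.run (A : Algorithm k) (X : System) (coin : ℕ × X.Bot → Bool) :
    ℕ → (X.Bot → A.State) × (X.Bot → Set (LocalPin k))
  | 0 => (fun _ => A.init, fun _ => ∅)
  | t + 1 =>
    let c := A.run X coin t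
    let state := fun u => A.step (c.1 u) (X.bonds u) (c.2 u) (coin (t, u))
    (state, A.received X state)

/-- The answer of `u` after `t` rounds (`none` if `u` has not terminated). -/
def Algorithm.answer (A : Algorithm k) (X : System) (coin : ℕ × X.Bot → Bool) (t : ℕ)
    (u : X.Bot) : Option Bool :=
  A.output ((A.run X coin t).1 u)

/-- No amoebot ever terminates with an answer different from the truth value of `P`. -/
def Algorithm.IsSound (A : Algorithm k) (X : System) (coin : ℕ × X.Bot → Bool) (P : Prop) : Prop :=
  ∀ t u b, A.answer X coin t u = some b → (b = true ↔ P)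

/-- After `R` rounds all amoebots have terminated (for good). -/
def Algorithm.HaltsWithin (A : Algorithm k) (X : System) (coin : ℕ × X.Bot → Bool) (R : ℕ) : Prop :=
  ∀ t, R ≤ t → ∀ u, (A.answer X coin t u).isSome

end Execution

/-- The law of independent fair coins, one for each round and each amoebot. -/
noncomputable def System.coinLaw (X : System) : Measure (ℕ × X.Bot → Bool) :=
  Measure.infinitePi fun _ => uniformOn (Set.univ : Set Bool)

end Amoebot

/-!
A deterministic algorithm with a constant number of rounds decides both questions; the coins are not
needed, and the bound `C * log n` leaves room for any constant number of rounds as soon as `n ≥ 2`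
(for `n = 1` the required probability is `0`).

*What the amoebots compute.* A triangle of the grid whose vertices are occupied is called a cell,
unless it is the tip of a gap between two triangles (`Tip`, `Cell`). If the structure is
`V(T(S))` and `T` scales by `s ≥ 4`, then the cells are exactly the faces that lie in `T(S)`
(`Shape.cellAt_scaled`). A node is *special* if the cells around it form neither a disc nor a
half-disc nor nothing, and, inductively, if two lines of edges through special nodes cross there
(`spec`). After a fixed number of steps, the special nodes of `V(T(S))` are the images of
all vertices of `S`. This is where minimality enters (`Shape.special_of_isMinimal`): the special
nodes always cut a connected set of faces into equilateral triangles of one side length `a`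
(`GoodCorner`, `Settled.mem_right`, `Settled.mem_left`), so for `a ≥ 2` these triangles would form a
smaller shape with the same representations.

*How the structure is compared with `S`.* Special nodes exchange information with the next special
nodes on their lines. Each of them maintains the statement that it plays the role of a given
vertex of `S` in a given frame (direction and sense of rotation), as far as can be seen within `t`
steps (`Lab`). If a node keeps this role for sufficiently many steps, then the special nodes
around it span a scaled copy of `S` (`Shape.IsConnected.exists_match`), and the structure
is this copy (`Settled.mem_iff`), provided that no node has seen a crossing of special lines that is
not special, or a bond that is not linked to the cells (`Regular`). The scales `1`, `2`, `3`
are compared with fixed templates (`exists_known_template`).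

*Why constantly many rounds suffice without a common chirality.* A circuit along a line
transmits one bit per round, and the two outermost of the `k ≥ 2` pins of an edge give two such
tracks, to the left and to the right of the line. A bit sent on the left track is a statement
about a frame that turns to the left, and both ends of the line agree on which track that is, even if
they do not agree on what to call it (`Recv`, `Known.recv`). So predicates of frames can be
evaluated by all amoebots (`Known`), each in its private orientation, and frames with both senses
of rotation are always treated alike. An amoebot that considers only frames with its private
chirality decides the first question, and one that considers all frames decides the second.
-/

namespace Amoebot

/-! ### Quantities that all amoebots can compute in constantly many rounds -/

/-- The pins on which `u` receives a beep if the amoebots connect their pins according to `w` and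
beep on the pins `b`. -/
def heardWith {k : ℕ} (X : System) (w : X.Bot → LocalPin k → LocalPin k → Prop)
    (b : X.Bot → Set (LocalPin k)) (u : X.Bot) : Set (LocalPin k) :=
  {q | ∃ v : X.Bot, ∃ r ∈ b v, Relation.EqvGen (fun x y : X.Bot × LocalPin k =>
    (x.1 = y.1 ∧ w x.1 x.2 y.2) ∨ X.SamePin x y) (v, r) (u, q)}

/-- A full-information protocol: what an amoebot does (wires and beeps) as a function of its bonds
and of all it has heard so far, the latest round first. The length of the list is the time. -/
abbrev Proto (k : ℕ) : Type :=
  Set (ZMod 6) → List (Set (LocalPin k)) → (LocalPin k → LocalPin k → Prop) × Set (LocalPin k)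

variable {k : ℕ}

/-- Everything heard within the first `t` rounds of a protocol. -/
def Proto.hist (Q : Proto k) (X : System) : ℕ → X.Bot → List (Set (LocalPin k))
  | 0 => fun _ => []
  | t + 1 => fun u =>
    heardWith X (fun v => (Q (X.bonds v) (Q.hist X t v)).1)
      (fun v => (Q (X.bonds v) (Q.hist X t v)).2) u :: Q.hist X t u

lemma Proto.length_hist (Q : Proto k) (X : System) (t : ℕ) (u : X.Bot) :
    (Q.hist X t u).length = t := by
  induction t with
  | zero => rfl
  | succ t ih => simp [Proto.hist, ih]

lemma Proto.hist_congr {Q Q' : Proto k} {T : ℕ} (h : ∀ b l, l.length < T → Q' b l = Q b l)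
    (X : System) (t : ℕ) (ht : t ≤ T) : Q'.hist X t = Q.hist X t := by
  induction t with
  | zero => rfl
  | succ t ih =>
    have ih' := ih (by omega)
    funext u
    have key : ∀ v, Q' (X.bonds v) (Q.hist X t v) = Q (X.bonds v) (Q.hist X t v) :=
      fun v => h _ _ (by rw [Proto.length_hist]; omega)
    simp only [Proto.hist, ih', key]

/-- A quantity `φ`, which may depend on the amoebot and its private orientation, is knowable if
every protocol can be prolonged so that after constantly many rounds every amoebot of every system
can read off its value of `φ` from its bonds and from what it has heard. Demanding this for every
protocol makes it immediate to compute several quantities one after the other. -/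
def Knowable (k : ℕ) {α : Type} (φ : ∀ X : System, X.Bot → α) : Prop :=
  ∀ (Q : Proto k) (t : ℕ), ∃ (Q' : Proto k) (t' : ℕ), t ≤ t' ∧
    (∀ b l, l.length < t → Q' b l = Q b l) ∧
    ∃ g : Set (ZMod 6) → List (Set (LocalPin k)) → α,
      ∀ (X : System) (u : X.Bot), φ X u = g (X.bonds u) (Q'.hist X t' u)

namespace Knowable

variable {α β γ : Type}

lemma bonds : Knowable k fun X u => X.bonds u := fun Q t =>
  ⟨Q, t, le_rfl, fun _ _ _ => rfl, fun b _ => b, fun _ _ => rfl⟩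

lemma const (a : α) : Knowable k fun _ _ => a := fun Q t =>
  ⟨Q, t, le_rfl, fun _ _ _ => rfl, fun _ _ => a, fun _ _ => rfl⟩

lemma map {φ : ∀ X : System, X.Bot → α} (f : α → β) (h : Knowable k φ) :
    Knowable k fun X u => f (φ X u) := fun Q t => by
  obtain ⟨Q', t', ht, hQ, g, hg⟩ := h Q t
  exact ⟨Q', t', ht, hQ, fun b l => f (g b l), fun X u => congrArg f (hg X u)⟩

lemma congr {φ ψ : ∀ X : System, X.Bot → α} (h : Knowable k φ) (e : ∀ X u, ψ X u = φ X u) :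
    Knowable k ψ := by
  have : ψ = φ := by funext X u; exact e X u
  rwa [this]

/-- What is known stays known: the history at a later time contains the one at an earlier time. -/
lemma hist_drop (Q : Proto k) (X : System) (u : X.Bot) {s t : ℕ} (h : s ≤ t) :
    (Q.hist X t u).drop (t - s) = Q.hist X s u := by
  induction t with
  | zero => obtain rfl : s = 0 := by omega
            rfl
  | succ t ih =>
    rcases Nat.lt_or_ge t s with h' | h'
    · obtain rfl : s = t + 1 := by omega
      simp
    · rw [show t + 1 - s = (t - s) + 1 by omega]
      simpa [Proto.hist] using ih h'

lemma pair {φ : ∀ X : System, X.Bot → α} {ψ : ∀ X : System, X.Bot → β}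
    (hφ : Knowable k φ) (hψ : Knowable k ψ) : Knowable k fun X u => (φ X u, ψ X u) := fun Q t => by
  obtain ⟨Q₁, t₁, ht₁, hQ₁, g₁, hg₁⟩ := hφ Q t
  obtain ⟨Q₂, t₂, ht₂, hQ₂, g₂, hg₂⟩ := hψ Q₁ t₁
  refine ⟨Q₂, t₂, ht₁.trans ht₂, fun b l hl => ?_,
    fun b l => (g₁ b (l.drop (t₂ - t₁)), g₂ b l), fun X u => ?_⟩
  · rw [hQ₂ b l (by omega), hQ₁ b l hl]
  · simp only [hist_drop _ _ _ ht₂]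
    rw [Proto.hist_congr hQ₂ X t₁ le_rfl, ← hg₁, ← hg₂]

lemma map₂ {φ : ∀ X : System, X.Bot → α} {ψ : ∀ X : System, X.Bot → β} (f : α → β → γ)
    (hφ : Knowable k φ) (hψ : Knowable k ψ) : Knowable k fun X u => f (φ X u) (ψ X u) :=
  (hφ.pair hψ).map fun p => f p.1 p.2

lemma pi {ι : Type} [Finite ι] {φ : ι → ∀ X : System, X.Bot → α} (h : ∀ i, Knowable k (φ i)) :
    Knowable k fun X u i => φ i X u := by
  classical
  cases nonempty_fintype ι
  rcases isEmpty_or_nonempty α with hα | ⟨⟨a⟩⟩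
  · rcases isEmpty_or_nonempty ι with hι | ⟨⟨i⟩⟩
    · exact (const (fun i : ι => isEmptyElim i)).congr fun X u => funext fun i => isEmptyElim i
    · exact ((h i).map fun x => (isEmptyElim x : ι → α)).congr fun X u => isEmptyElim (φ i X u)
  · have key : ∀ s : Finset ι, Knowable k fun X u i => if i ∈ s then φ i X u else a := by
      intro s
      induction s using Finset.induction_on with
      | empty => simpa using const (k := k) (fun _ : ι => a)
      | insert j s hj ih =>
        refine (map₂ (fun x f i => if i = j then x else f i) (h j) ih).congr fun X u => ?_
        funext i
        by_cases hi : i = j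
        · subst hi; simp
        · simp [hi]
    simpa using key Finset.univ

/-- One further round: if the wires and beeps of every amoebot are knowable, then so is what it
hears. -/
lemma heard {w : ∀ X : System, X.Bot → LocalPin k → LocalPin k → Prop}
    {b : ∀ X : System, X.Bot → Set (LocalPin k)} (hw : Knowable k w) (hb : Knowable k b) :
    Knowable k fun X u => heardWith X (w X) (b X) u := fun Q t => by
  obtain ⟨Q', t', ht, hQ, g, hg⟩ := (hw.pair hb) Q t
  have h' : ∀ c l, l.length < t' →
      (fun c l => if l.length = t' then g c l else Q' c l : Proto k) c l = Q' c l :=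
    fun c l hl => if_neg (by omega)
  refine ⟨fun c l => if l.length = t' then g c l else Q' c l, t' + 1, by omega,
    fun c l hl => ?_, fun _ l => l.headD ∅, fun X u => ?_⟩
  · rw [← hQ c l hl]; exact h' c l (by omega)
  · simp only [Proto.hist, List.headD_cons, Proto.hist_congr h' X t' le_rfl, Proto.length_hist,
      if_true, ← hg]

/-- A single beep on the circuit formed by all pins tells all amoebots whether one of them
satisfies `p`. -/
lemma exists_bot (hk : 0 < k) {p : ∀ X : System, X.Bot → Prop} (hp : Knowable k p) :
    Knowable k fun X (_ : X.Bot) => ∃ v, p X v := by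
  have h1 := heard (k := k) (w := fun _ _ _ _ => True) (b := fun X u => {_r | p X u})
    (const _) (hp.map fun x => {_r | x})
  refine (h1.map fun s => s.Nonempty).congr fun X u => propext ⟨?_, ?_⟩
  · rintro ⟨v, hv⟩
    let i0 : Fin k := ⟨0, hk⟩
    refine ⟨(0, i0), v, (0, i0), hv, ?_⟩
    set R : X.Bot × LocalPin k → X.Bot × LocalPin k → Prop :=
      fun x y => (x.1 = y.1 ∧ True) ∨ X.SamePin x y with hR
    have wire : ∀ (x : X.Bot) (a b : LocalPin k), Relation.EqvGen R (x, a) (x, b) :=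
      fun x a b => .rel _ _ (Or.inl ⟨rfl, trivial⟩)
    have loc : ∀ (x : X.Bot) (d : ZMod 6), ∃ l, X.globalDir x l = d := by
      intro x d
      unfold System.globalDir
      cases X.chirality x
      · exact ⟨X.compass x - d, by simp⟩
      · exact ⟨d - X.compass x, by simp⟩
    have idx : ∀ (x : X.Bot) (d : Fin k), ∃ l, X.globalIdx x l = d := by
      intro x d
      unfold System.globalIdx
      cases X.chirality x
      · exact ⟨d.rev, by simp⟩
      · exact ⟨d, by simp⟩
    have step : ∀ x y : X.Bot, triGrid.Adj x.1 y.1 →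
        Relation.EqvGen R (x, (0, i0)) (y, (0, i0)) := by
      rintro x y ⟨d, hd⟩
      obtain ⟨l, hl⟩ := loc x d
      obtain ⟨l', hl'⟩ := loc y (d + 3)
      obtain ⟨i, hi⟩ := idx y (X.globalIdx x i0).rev
      have hz : ∀ d : ZMod 6, dirVec d + dirVec (d + 3) = 0 := by decide
      refine (wire x (0, i0) (l, i0)).trans _ _ _ (.trans _ (y, (l', i)) _ (.rel _ _ (Or.inr ?_))
        (wire y _ _))
      refine ⟨by simp [hl, hd], ?_, by simpa using hi⟩
      simp only [hl', hd, add_assoc, hz, add_zero]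
    have conn : ∀ x y : X.Bot, Relation.EqvGen R (x, (0, i0)) (y, (0, i0)) := by
      intro x y
      obtain ⟨walk⟩ := X.connected.preconnected x y
      induction walk with
      | nil => exact .refl _
      | cons h _ ih => exact (step _ _ h).trans _ _ _ ih
    exact conn v u
  · rintro ⟨q, v, r, hr, -⟩
    exact ⟨v, hr⟩

end Knowable

/-- A knowable answer on which all amoebots agree is computed by a deterministic algorithm: the
state of an amoebot is its bonds and all it has heard so far. -/
lemma Knowable.algorithm {P : System → Prop} (h : Knowable k fun X (_ : X.Bot) => P X) :
    ∃ (A : Algorithm k) (R : ℕ), ∀ (X : System) (coin : ℕ × X.Bot → Bool),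
      A.IsSound X coin (P X) ∧ A.HaltsWithin X coin R := by
  classical
  obtain ⟨Q, T, -, -, g, hg⟩ := h (fun _ _ => (fun _ _ => False, ∅)) 0
  let St : Type := Option (Set (ZMod 6) × {l : List (Set (LocalPin k)) // l.length ≤ T})
  have hfin : Finite {l : List (Set (LocalPin k)) // l.length ≤ T} :=
    (List.finite_length_le (Set (LocalPin k)) T).to_subtype
  let A : Algorithm k :=
    { State := St
      finite_state := by dsimp only [St]; infer_instance
      init := none
      step := fun s b hd _ => match s with
        | none => some (b, ⟨[], Nat.zero_le _⟩)
        | some (c, l) => if hl : l.1.length < T then some (c, ⟨hd :: l.1, hl⟩) else some (c, l)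
      wires := fun s => match s with
        | none => fun _ _ => False
        | some (c, l) => (Q c l.1).1
      beeps := fun s => match s with
        | none => ∅
        | some (c, l) => (Q c l.1).2
      output := fun s => match s with
        | none => none
        | some (c, l) => if l.1.length = T then some (decide (g c l.1)) else none }
  have run : ∀ (X : System) (coin : ℕ × X.Bot → Bool) (t : ℕ) (u : X.Bot),
      ∃ l : {l : List (Set (LocalPin k)) // l.length ≤ T}, l.1 = Q.hist X (min t T) u ∧
        (A.run X coin (t + 1)).1 u = some (X.bonds u, l) := by
    intro X coin t
    induction t with
    | zero =>
      intro u
      exact ⟨⟨[], Nat.zero_le _⟩, by simp [Proto.hist], rfl⟩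
    | succ t ih =>
      intro u
      choose l hl hrun using ih
      have hrec : (A.run X coin (t + 1)).2 = heardWith X
          (fun v => (Q (X.bonds v) (Q.hist X (min t T) v)).1)
          (fun v => (Q (X.bonds v) (Q.hist X (min t T) v)).2) := by
        change heardWith X (fun v => A.wires ((A.run X coin (t + 1)).1 v))
          (fun v => A.beeps ((A.run X coin (t + 1)).1 v)) = _
        simp only [hrun, A, hl]
      have hst : (A.run X coin (t + 1 + 1)).1 u =
          if h : (l u).1.length < T then
            some (X.bonds u, ⟨(A.run X coin (t + 1)).2 u :: (l u).1, h⟩)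
          else some (X.bonds u, l u) := by
        change A.step ((A.run X coin (t + 1)).1 u) (X.bonds u) ((A.run X coin (t + 1)).2 u)
          (coin (t + 1, u)) = _
        rw [hrun]
      have hlen : (l u).1.length = min t T := by rw [hl, Proto.length_hist]
      rcases Nat.lt_or_ge t T with htT | htT
      · rw [dif_pos (by omega)] at hst
        refine ⟨_, ?_, hst⟩
        rw [show min (t + 1) T = min t T + 1 by omega]
        change (A.run X coin (t + 1)).2 u :: (l u).1 = _
        rw [hrec, hl]
        rfl
      · rw [dif_neg (by omega)] at hst
        exact ⟨_, by rw [hl]; congr 1; omega, hst⟩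
  have ans : ∀ (X : System) (coin : ℕ × X.Bot → Bool) (t : ℕ) (u : X.Bot),
      A.answer X coin (t + 1) u = if T ≤ t then some (decide (P X)) else none := by
    intro X coin t u
    obtain ⟨l, hl, hr⟩ := run X coin t u
    have hlen : l.1.length = min t T := by rw [hl, Proto.length_hist]
    rw [Algorithm.answer, hr]
    change (if l.1.length = T then some (decide (g (X.bonds u) l.1)) else none) = _
    rcases Nat.lt_or_ge t T with h1 | h1
    · rw [if_neg (by omega), if_neg (by omega)]
    · rw [if_pos (by omega), if_pos h1, hl, min_eq_right h1, ← hg X u]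
  refine ⟨A, T + 1, fun X coin => ⟨fun t u b hb => ?_, fun t ht u => ?_⟩⟩
  · cases t with
    | zero => simp [Algorithm.answer, Algorithm.run, A] at hb
    | succ t =>
      rw [ans] at hb
      split_ifs at hb with hT
      simp only [Option.some.injEq] at hb
      rw [← hb, decide_eq_true_iff]
  · obtain ⟨s, rfl⟩ : ∃ s, t = s + 1 := ⟨t - 1, by omega⟩
    rw [ans, if_pos (by omega)]
    rfl

end Amoebot

namespace Amoebot

/-! ### Frames, lines and successors -/

/-- The sign of a sense of rotation, as a factor for directions. -/
def sgn (e : Bool) : ZMod 6 := if e then 1 else -1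

lemma dirVec_add_three (g : ZMod 6) : dirVec (g + 3) = -dirVec g := by
  revert g; decide

lemma dirVec_injective : Function.Injective dirVec := by
  intro a b; revert a b; decide

/-- One step along the edges `E` in direction `g` or in the opposite direction. -/
def Step (E : Node → ZMod 6 → Prop) (g : ZMod 6) (a b : Node) : Prop :=
  (E a g ∧ b = a + dirVec g) ∨ (E a (g + 3) ∧ b = a + dirVec (g + 3))

/-- `b` lies on the maximal line of edges through `a` with direction `g`. -/
def Line (E : Node → ZMod 6 → Prop) (g : ZMod 6) : Node → Node → Prop :=
  Relation.ReflTransGen (Step E g)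

lemma line_add_three (E : Node → ZMod 6 → Prop) (g : ZMod 6) : Line E (g + 3) = Line E g := by
  have : g + 3 + 3 = g := by revert g; decide
  have : Step E (g + 3) = Step E g := by
    funext a b
    rw [Step, Step, this, or_comm]
  rw [Line, this, Line]

/-- The line through `u` with direction `g` contains a node of `P`. -/
def Hit (E : Node → ZMod 6 → Prop) (P : Node → Prop) (u : Node) (g : ZMod 6) : Prop :=
  ∃ v, P v ∧ Line E g u v

/-- `q` is the next node of `Q` after `u` on the line of edges in direction `g`. -/
def Succ (E : Node → ZMod 6 → Prop) (Q : Node → Prop) (u : Node) (g : ZMod 6) (q : Node) : Prop :=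
  ∃ a : ℕ, 0 < a ∧ q = u + a • dirVec g ∧ Q q ∧ (∀ i < a, E (u + i • dirVec g) g) ∧
    ∀ i, 0 < i → i < a → ¬ Q (u + i • dirVec g)

lemma Succ.unique {E : Node → ZMod 6 → Prop} {Q : Node → Prop} {u q q' : Node} {g : ZMod 6}
    (h : Succ E Q u g q) (h' : Succ E Q u g q') : q = q' := by
  obtain ⟨a, ha, rfl, hq, -, hn⟩ := h
  obtain ⟨b, hb, rfl, hq', -, hn'⟩ := h'
  rcases lt_trichotomy a b with hab | rfl | hab
  · exact absurd hq (hn' a ha hab)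
  · rfl
  · exact absurd hq' (hn b hb hab)

/-- What `u` learns about its successor in direction `g` if all nodes of `Q` tell their neighbors
in `Q` the truth value of `V`. The value of `V` at the successor is taken in the frame that points
back to `u` and has the opposite sense of rotation: that frame uses the same side of the line.
Without a successor, `u` hears only itself. -/
def Recv (E : Node → ZMod 6 → Prop) (Q : Node → Prop) (V : Node → ZMod 6 → Bool → Prop)
    (u : Node) (g : ZMod 6) (e : Bool) : Prop :=
  Q u ∧ E u g ∧ ((∃ q, Succ E Q u g q ∧ V q (g + 3) (!e)) ∨
    ((¬ ∃ q, Succ E Q u g q) ∧ V u g e))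

lemma System.globalDir_add (X : System) (u : X.Bot) (l m : ZMod 6) (e : Bool) :
    X.globalDir u (l + sgn e * m) = X.globalDir u l + sgn (X.chirality u == e) * m := by
  unfold System.globalDir sgn
  cases X.chirality u <;> cases e <;> simp
  all_goals ring

lemma System.globalDir_add_three (X : System) (u : X.Bot) (l : ZMod 6) :
    X.globalDir u (l + 3) = X.globalDir u l + 3 := by
  have h3 : (-3 : ZMod 6) = 3 := by decide
  unfold System.globalDir
  cases X.chirality u
  · simp only [Bool.false_eq_true, if_false]
    rw [sub_add_eq_sub_sub, sub_eq_add_neg _ (3 : ZMod 6), h3]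
  · simp [add_assoc]

lemma System.globalDir_injective (X : System) (u : X.Bot) :
    Function.Injective (X.globalDir u) := by
  intro a b h
  unfold System.globalDir at h
  cases hc : X.chirality u <;> simpa [hc] using h

lemma System.exists_globalDir (X : System) (u : X.Bot) (d : ZMod 6) :
    ∃ l, X.globalDir u l = d := by
  unfold System.globalDir
  cases X.chirality u
  · exact ⟨X.compass u - d, by simp⟩
  · exact ⟨d - X.compass u, by simp⟩

section
variable {k : ℕ}

lemma System.globalIdx_rev (X : System) (u : X.Bot) (i : Fin k) :
    X.globalIdx u i.rev = (X.globalIdx u i).rev := by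
  unfold System.globalIdx
  cases X.chirality u <;> simp

lemma System.exists_globalIdx (X : System) (u : X.Bot) (d : Fin k) :
    ∃ i, X.globalIdx u i = d := by
  unfold System.globalIdx
  cases X.chirality u
  · exact ⟨d.rev, by simp⟩
  · exact ⟨d, by simp⟩

lemma System.SamePin.symm {X : System} {a b : X.Bot × LocalPin k} (h : X.SamePin a b) :
    X.SamePin b a := ⟨h.2.1, h.1, by rw [h.2.2, Fin.rev_rev]⟩

lemma System.SamePin.globalDir_eq {X : System} {a b : X.Bot × LocalPin k} (h : X.SamePin a b) :
    X.globalDir b.1 b.2.1 = X.globalDir a.1 a.2.1 + 3 := by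
  apply dirVec_injective
  rw [dirVec_add_three]
  have h1 := h.1
  rw [h.2.1, add_assoc, left_eq_add] at h1
  exact eq_neg_of_add_eq_zero_left h1

lemma System.samePin_of {X : System} {a b : X.Bot × LocalPin k} {g : ZMod 6} {i : Fin k}
    (h : b.1.1 = a.1.1 + dirVec g) (ha : X.globalDir a.1 a.2.1 = g)
    (hb : X.globalDir b.1 b.2.1 = g + 3) (hi : X.globalIdx a.1 a.2.2 = i)
    (hj : X.globalIdx b.1 b.2.2 = i.rev) : X.SamePin a b := by
  refine ⟨by rw [ha, h], ?_, by rw [hi, hj]⟩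
  rw [hb, h, dirVec_add_three]; abel

/-- The first (for `true`) or the last (for `false`) pin of an edge in the private numbering: the
outermost pin on the side of the line where a frame with that sense of rotation starts. For
`k ≥ 2` the two pins are different. -/
def sidePin (hk : 0 < k) (e : Bool) : Fin k := if e then ⟨0, hk⟩ else ⟨k - 1, by omega⟩

lemma sidePin_rev (hk : 0 < k) (e : Bool) : (sidePin hk e).rev = sidePin hk (!e) := by
  cases e
  all_goals ext; simp [sidePin]
  omega

lemma sidePin_injective (hk : 2 ≤ k) : Function.Injective (sidePin (k := k) (by omega)) := by
  intro a b h
  cases a <;> cases b <;> simp [sidePin, Fin.ext_iff] at h ⊢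
  all_goals omega

lemma System.globalIdx_sidePin (X : System) (hk : 0 < k) (u : X.Bot) (e : Bool) :
    X.globalIdx u (sidePin hk e) = sidePin hk (X.chirality u == e) := by
  unfold System.globalIdx
  cases X.chirality u <;> cases e <;> simp [sidePin_rev]

lemma eqvGen_invariant {α : Type*} {R : α → α → Prop} {C : α → Prop}
    (h : ∀ x y, R x y → (C x ↔ C y)) {x y : α} (hxy : Relation.EqvGen R x y) : C x ↔ C y := by
  induction hxy with
  | rel _ _ hr => exact h _ _ hr
  | refl => rfl
  | symm _ _ _ ih => exact ih.symm
  | trans _ _ _ _ _ ih1 ih2 => exact ih1.trans ih2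

/-! ### Geometric predicates that are known in all frames -/

/-- A predicate of a node `u` of `X`, a direction `g` and a sense of rotation `e`, that is, of a
frame at `u`, is known if every amoebot can compute it for all frames at its node, described in
its private orientation. -/
def Known (k : ℕ) (V : Set Node → Node → ZMod 6 → Bool → Prop) : Prop :=
  Knowable k fun X u (l : ZMod 6) (e : Bool) =>
    V X.occupied u.1 (X.globalDir u l) (X.chirality u == e)

/-- Adjacency data on amoebot structures: symmetric, and only between nodes of the structure. -/
def IsEdge (E : Set Node → Node → ZMod 6 → Prop) : Prop :=
  ∀ X u g, E X u g → u ∈ X ∧ u + dirVec g ∈ X ∧ E X (u + dirVec g) (g + 3)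

namespace Known

variable {V W : Set Node → Node → ZMod 6 → Bool → Prop}

lemma congr (h : Known k V) (e : ∀ X u g b, u ∈ X → (W X u g b ↔ V X u g b)) : Known k W :=
  Knowable.congr h fun X u => by
    funext l b
    exact propext (e _ _ _ _ u.2)

lemma map₂ (f : Prop → Prop → Prop) (hV : Known k V) (hW : Known k W) :
    Known k fun X u g e => f (V X u g e) (W X u g e) :=
  Knowable.map₂ (fun (v w : ZMod 6 → Bool → Prop) (l : ZMod 6) (e : Bool) => f (v l e) (w l e))
    hV hW

lemma and (hV : Known k V) (hW : Known k W) : Known k fun X u g e => V X u g e ∧ W X u g e :=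
  map₂ (· ∧ ·) hV hW

lemma or (hV : Known k V) (hW : Known k W) : Known k fun X u g e => V X u g e ∨ W X u g e :=
  map₂ (· ∨ ·) hV hW

lemma imp (hV : Known k V) (hW : Known k W) : Known k fun X u g e => V X u g e → W X u g e :=
  map₂ (· → ·) hV hW

lemma iff (hV : Known k V) (hW : Known k W) : Known k fun X u g e => (V X u g e ↔ W X u g e) :=
  map₂ (· ↔ ·) hV hW

lemma not (hV : Known k V) : Known k fun X u g e => ¬ V X u g e :=
  map₂ (fun v _ => ¬ v) hV hV

lemma const (p : Prop) : Known k fun _ _ _ _ => p := Knowable.const _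

lemma all {ι : Type} [Finite ι] {V : ι → Set Node → Node → ZMod 6 → Bool → Prop}
    (h : ∀ i, Known k (V i)) : Known k fun X u g e => ∀ i, V i X u g e :=
  (Knowable.pi h).map fun (f : ι → ZMod 6 → Bool → Prop) (l : ZMod 6) (e : Bool) => ∀ i, f i l e

lemma exist {ι : Type} [Finite ι] {V : ι → Set Node → Node → ZMod 6 → Bool → Prop}
    (h : ∀ i, Known k (V i)) : Known k fun X u g e => ∃ i, V i X u g e :=
  (Knowable.pi h).map fun (f : ι → ZMod 6 → Bool → Prop) (l : ZMod 6) (e : Bool) => ∃ i, f i l e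

/-- Frames may be turned, by an angle measured in their own sense of rotation. -/
lemma turn (m : ZMod 6) (h : Known k V) : Known k fun X u g e => V X u (g + sgn e * m) e :=
  (h.map fun f l e => f (l + sgn e * m) e).congr fun X u => by
    funext l e
    simp only [System.globalDir_add]

/-- Frames may be reflected. -/
lemma flip (h : Known k V) : Known k fun X u g e => V X u g (!e) :=
  (h.map fun f l e => f l (!e)).congr fun X u => by
    funext l e
    cases X.chirality u <;> cases e <;> rfl

lemma turn_three (h : Known k V) : Known k fun X u g e => V X u (g + 3) e :=
  (h.turn 3).congr fun X u g e _ => by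
    have : ∀ e, sgn e * 3 = 3 := by decide
    rw [this]

lemma bond : Known k fun X u g _ => u + dirVec g ∈ X :=
  Knowable.map (fun (s : Set (ZMod 6)) (l : ZMod 6) (_ : Bool) => l ∈ s) Knowable.bonds

/-- A statement about all directions may be checked in any frame. -/
lemma all_dir (h : Known k V) : Known k fun X u _ e => ∀ g, V X u g e :=
  (all fun m => h.turn m).congr fun X u g e _ => by
    refine ⟨fun H m => H _, fun H g' => ?_⟩
    have : ∀ (g g' : ZMod 6) e, g + sgn e * (sgn e * (g' - g)) = g' := by decide
    rw [← this g g' e]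
    exact H _

lemma exists_dir (h : Known k V) : Known k fun X u _ e => ∃ g, V X u g e :=
  (h.not.all_dir.not).congr fun X u g e _ => by push Not; rfl

/-- One beep on the lines tells every node which of its lines contain a node of `P`. -/
lemma hit (hk : 0 < k) {E : Set Node → Node → ZMod 6 → Prop} {P : Set Node → Node → Prop}
    (hE : IsEdge E) (kE : Known k fun X u g _ => E X u g) (kP : Known k fun X u _ _ => P X u) :
    Known k fun X u g _ => Hit (E X) (fun v => v ∈ X ∧ P X v) u g := by
  have hw : Knowable k fun X u (a b : LocalPin k) => (a.1 = b.1 ∨ b.1 = a.1 + 3) ∧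
      E X.occupied u.1 (X.globalDir u a.1) ∧ E X.occupied u.1 (X.globalDir u b.1) :=
    Knowable.map (fun (f : ZMod 6 → Bool → Prop) (a b : LocalPin k) =>
      (a.1 = b.1 ∨ b.1 = a.1 + 3) ∧ f a.1 true ∧ f b.1 true) kE
  have hb : Knowable k fun X u => {r : LocalPin k | P X.occupied u.1 ∧
      E X.occupied u.1 (X.globalDir u r.1)} :=
    Knowable.map (fun (f : ZMod 6 → Bool → Prop) => {r : LocalPin k | f r.1 true}) (kP.and kE)
  have key : Known k fun X u g _ => E X u g ∧ Hit (E X) (fun v => v ∈ X ∧ P X v) u g := by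
    refine (Knowable.map₂ (fun f s l _ => f l true ∧ (l, (⟨0, hk⟩ : Fin k)) ∈ s) kE
      (Knowable.heard hw hb)).congr fun X u => ?_
    funext l e
    refine propext (and_congr_right fun hEu => ?_)
    have h33 : ∀ g : ZMod 6, g + 3 + 3 = g := by decide
    have h33' : ∀ a b : ZMod 6, b = a + 3 → a = b + 3 := by decide
    set g := X.globalDir u l with hg
    set R : X.Bot × LocalPin k → X.Bot × LocalPin k → Prop := fun x y =>
      (x.1 = y.1 ∧ ((x.2.1 = y.2.1 ∨ y.2.1 = x.2.1 + 3) ∧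
      E X.occupied x.1.1 (X.globalDir x.1 x.2.1) ∧ E X.occupied x.1.1 (X.globalDir x.1 y.2.1))) ∨
      X.SamePin x y with hR
    constructor
    · rintro ⟨v, ⟨hvX, hPv⟩, hline⟩
      -- every pin on the line belongs to the circuit of the pin at `u`
      have claim : ∀ w, Line (E X.occupied) g u.1 w → ∃ hw : w ∈ X.occupied,
          (∃ l', E X.occupied w (X.globalDir ⟨w, hw⟩ l') ∧
            (X.globalDir ⟨w, hw⟩ l' = g ∨ X.globalDir ⟨w, hw⟩ l' = g + 3)) ∧
          ∀ l' i', E X.occupied w (X.globalDir ⟨w, hw⟩ l') →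
            (X.globalDir ⟨w, hw⟩ l' = g ∨ X.globalDir ⟨w, hw⟩ l' = g + 3) →
            Relation.EqvGen R (⟨w, hw⟩, (l', i')) (u, (l, ⟨0, hk⟩)) := by
        intro w hw
        -- pins of one amoebot on the same line are wired
        have wired : ∀ (x : X.Bot) l₁ l₂ i₁ i₂, E X.occupied x.1 (X.globalDir x l₁) →
            E X.occupied x.1 (X.globalDir x l₂) →
            (X.globalDir x l₁ = g ∨ X.globalDir x l₁ = g + 3) →
            (X.globalDir x l₂ = g ∨ X.globalDir x l₂ = g + 3) →
            Relation.EqvGen R (x, (l₁, i₁)) (x, (l₂, i₂)) := by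
          intro x l₁ l₂ i₁ i₂ h₁ h₂ e₁ e₂
          refine .rel _ _ (Or.inl ⟨rfl, ?_, h₁, h₂⟩)
          rcases e₁ with e₁ | e₁ <;> rcases e₂ with e₂ | e₂
          · exact Or.inl (X.globalDir_injective x (e₁.trans e₂.symm))
          · exact Or.inr (X.globalDir_injective x (by rw [X.globalDir_add_three, e₁, e₂]))
          · exact Or.inr (X.globalDir_injective x (by rw [X.globalDir_add_three, e₁, e₂, h33]))
          · exact Or.inl (X.globalDir_injective x (e₁.trans e₂.symm))
        induction hw with
        | refl => exact ⟨u.2, ⟨l, hEu, Or.inl rfl⟩, fun l' i' h1 h2 =>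
            wired u _ _ _ _ h1 hEu h2 (Or.inl rfl)⟩
        | @tail w w' _ hs ih =>
          obtain ⟨hw, -, ih⟩ := ih
          obtain ⟨h, hh, hEw, rfl⟩ : ∃ h, (h = g ∨ h = g + 3) ∧ E X.occupied w h ∧
              w' = w + dirVec h := by
            rcases hs with ⟨h1, h2⟩ | ⟨h1, h2⟩
            · exact ⟨g, Or.inl rfl, h1, h2⟩
            · exact ⟨g + 3, Or.inr rfl, h1, h2⟩
          obtain ⟨-, hw', hEw'⟩ := hE _ _ _ hEw
          have hh' : h + 3 = g ∨ h + 3 = g + 3 := by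
            rcases hh with rfl | rfl
            · exact Or.inr rfl
            · exact Or.inl (h33 _)
          obtain ⟨m, hm⟩ := X.exists_globalDir ⟨w, hw⟩ h
          obtain ⟨m', hm'⟩ := X.exists_globalDir ⟨_, hw'⟩ (h + 3)
          obtain ⟨i, hi⟩ := X.exists_globalIdx ⟨_, hw'⟩ (X.globalIdx ⟨w, hw⟩ ⟨0, hk⟩ : Fin k).rev
          refine ⟨hw', ⟨m', by rwa [hm'], by rwa [hm']⟩, fun l' i' h1 h2 => ?_⟩
          refine (wired _ l' m' i' i h1 (by rwa [hm']) h2 (by rwa [hm'])).trans _ _ _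
            (.trans _ _ _ (.symm _ _ (.rel _ _ (Or.inr ?_)))
              (ih m ⟨0, hk⟩ (by rwa [hm]) (by rwa [hm])))
          exact X.samePin_of rfl hm hm' rfl hi
      obtain ⟨hv, ⟨l', hl', hd⟩, hall⟩ := claim v hline
      exact ⟨⟨v, hv⟩, (l', ⟨0, hk⟩), ⟨hPv, hl'⟩, hall l' _ hl' hd⟩
    · rintro ⟨v, r, ⟨hPv, hEv⟩, hc⟩
      have := (eqvGen_invariant (C := fun x : X.Bot × LocalPin k =>
        Line (E X.occupied) g u.1 x.1.1 ∧ E X.occupied x.1.1 (X.globalDir x.1 x.2.1) ∧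
          (X.globalDir x.1 x.2.1 = g ∨ X.globalDir x.1 x.2.1 = g + 3)) ?_ hc).2
        ⟨.refl, hEu, Or.inl rfl⟩
      · exact ⟨v.1, ⟨v.2, hPv⟩, this.1⟩
      · have one : ∀ x y, R x y → (Line (E X.occupied) g u.1 x.1.1 ∧
            E X.occupied x.1.1 (X.globalDir x.1 x.2.1) ∧
            (X.globalDir x.1 x.2.1 = g ∨ X.globalDir x.1 x.2.1 = g + 3)) →
            (Line (E X.occupied) g u.1 y.1.1 ∧
            E X.occupied y.1.1 (X.globalDir y.1 y.2.1) ∧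
            (X.globalDir y.1 y.2.1 = g ∨ X.globalDir y.1 y.2.1 = g + 3)) := by
          rintro ⟨x, p⟩ ⟨y, q⟩ h ⟨h1, h2, h3⟩
          rcases h with ⟨hxy, h4, h5, h6⟩ | h
          · simp only at hxy h1 h2 h3 h4 h5 h6 ⊢
            subst hxy
            refine ⟨h1, h6, ?_⟩
            rcases h4 with h4 | h4
            · rw [← h4]; exact h3
            · rw [h4, X.globalDir_add_three]
              rcases h3 with h3 | h3
              · exact Or.inr (by rw [h3])
              · exact Or.inl (by rw [h3, h33])
          · have hd := h.globalDir_eq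
            have hyx := h.1
            simp only at hd hyx h1 h2 h3 ⊢
            refine ⟨h1.tail ?_, ?_, ?_⟩
            · rcases h3 with h3 | h3
              · exact Or.inl ⟨h3 ▸ h2, by rw [hyx, h3]⟩
              · exact Or.inr ⟨h3 ▸ h2, by rw [hyx, h3]⟩
            · rw [hd, hyx]; exact (hE _ _ _ h2).2.2
            · rcases h3 with h3 | h3
              · exact Or.inr (by rw [hd, h3])
              · exact Or.inl (by rw [hd, h3, h33])
        have symm : ∀ x y, R x y → R y x := by
          rintro ⟨x, p⟩ ⟨y, q⟩ h
          rcases h with ⟨hxy, h4, h5, h6⟩ | h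
          · simp only at hxy h4 h5 h6
            subst hxy
            refine Or.inl ⟨rfl, ?_, h6, h5⟩
            rcases h4 with h4 | h4
            · exact Or.inl h4.symm
            · exact Or.inr (h33' _ _ h4)
          · exact Or.inr h.symm
        exact fun x y h => ⟨one x y h, one y x (symm x y h)⟩
  refine ((kP.or key).or key.turn_three).congr fun X u g e hu => ?_
  constructor
  · rintro ⟨v, hv, hl⟩
    rcases Relation.ReflTransGen.cases_head hl with rfl | ⟨w, h, -⟩
    · exact Or.inl (Or.inl hv.2)
    · rcases h with h | h
      · exact Or.inl (Or.inr ⟨h.1, v, hv, hl⟩)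
      · exact Or.inr ⟨h.1, v, hv, by rwa [line_add_three]⟩
  · rintro ((h | ⟨-, h⟩) | ⟨-, v, hv, hl⟩)
    · exact ⟨u, ⟨hu, h⟩, .refl⟩
    · exact h
    · exact ⟨v, hv, by rwa [line_add_three] at hl⟩

/-- The circuits used to exchange information between consecutive nodes of `Q`: the other nodes
connect opposite pins straight through, on both sides of every line. -/
lemma track_spec (hk : 2 ≤ k) {E : Set Node → Node → ZMod 6 → Prop} (hE : IsEdge E)
    {Q : Set Node → Node → Prop} (W : Set Node → Node → ZMod 6 → Bool → Prop)
    (X : System) (u : X.Bot) (l : ZMod 6) (e : Bool) (hQ : Q X.occupied u.1)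
    (hEu : E X.occupied u.1 (X.globalDir u l)) :
    (l, sidePin (k := k) (by omega) e) ∈ heardWith X
      (fun x (a b : LocalPin k) => ¬ Q X.occupied x.1 ∧ (b.1 = a.1 + 3 ∧ b.2 = a.2.rev) ∧
        E X.occupied x.1 (X.globalDir x a.1) ∧ E X.occupied x.1 (X.globalDir x b.1))
      (fun x => {r | Q X.occupied x.1 ∧ E X.occupied x.1 (X.globalDir x r.1) ∧
        ∃ e', r.2 = sidePin (by omega) e' ∧
          W X.occupied x.1 (X.globalDir x r.1) (X.chirality x == e')}) u ↔
    W X.occupied u.1 (X.globalDir u l) (X.chirality u == e) ∨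
      ∃ q, Succ (E X.occupied) (fun v => v ∈ X.occupied ∧ Q X.occupied v) u.1 (X.globalDir u l) q ∧
        W X.occupied q (X.globalDir u l + 3) (!(X.chirality u == e)) := by
  have hk0 : 0 < k := by omega
  have h33 : ∀ g : ZMod 6, g + 3 + 3 = g := by decide
  have h33' : ∀ a b : ZMod 6, b = a + 3 → a = b + 3 := by decide
  set g := X.globalDir u l with hg
  set ε := (X.chirality u == e) with hε
  set R : X.Bot × LocalPin k → X.Bot × LocalPin k → Prop := fun x y =>
    (x.1 = y.1 ∧ ¬ Q X.occupied x.1.1 ∧ (y.2.1 = x.2.1 + 3 ∧ y.2.2 = x.2.2.rev) ∧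
    E X.occupied x.1.1 (X.globalDir x.1 x.2.1) ∧ E X.occupied x.1.1 (X.globalDir x.1 y.2.1)) ∨
    X.SamePin x y with hR
  have gidx : X.globalIdx u (sidePin hk0 e) = sidePin hk0 ε := X.globalIdx_sidePin hk0 u e
  constructor
  · rintro ⟨v, ⟨r, i⟩, ⟨hQv, hEv, e', hi, hW⟩, hc⟩
    simp only at hi hW hEv
    subst hi
    let chain : ℕ → Prop := fun j => ∀ i ≤ j, E X.occupied (u.1 + i • dirVec g) g ∧
      (0 < i → ¬ Q X.occupied (u.1 + i • dirVec g))
    -- the pins on the track from `u` to its successor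
    let C : X.Bot × LocalPin k → Prop := fun x => ∃ j, chain j ∧
      ((x.1.1 = u.1 + j • dirVec g ∧ X.globalDir x.1 x.2.1 = g ∧
          X.globalIdx x.1 x.2.2 = sidePin hk0 ε) ∨
        (x.1.1 = u.1 + (j + 1) • dirVec g ∧ X.globalDir x.1 x.2.1 = g + 3 ∧
          X.globalIdx x.1 x.2.2 = sidePin hk0 (!ε)))
    have one : ∀ x y, R x y → C x → C y := by
      rintro ⟨x, p⟩ ⟨y, q⟩ h ⟨j, hj, hx⟩
      rcases h with ⟨hxy, h4, ⟨h5, h5'⟩, h6, h7⟩ | h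
      · simp only at hxy hx h4 h5 h5' h6 h7
        subst hxy
        have hdq : X.globalDir x q.1 = X.globalDir x p.1 + 3 := by
          rw [h5, X.globalDir_add_three]
        have hiq : X.globalIdx x q.2 = (X.globalIdx x p.2).rev := by
          rw [h5', X.globalIdx_rev]
        rcases hx with ⟨h1, h2, h3⟩ | ⟨h1, h2, h3⟩
        · cases j with
          | zero =>
            simp only [zero_smul, add_zero] at h1
            exact absurd (h1 ▸ hQ) h4
          | succ j =>
            refine ⟨j, fun i hi => hj i (by omega), Or.inr ⟨h1, by rw [hdq, h2], ?_⟩⟩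
            rw [hiq, h3, sidePin_rev]
        · refine ⟨j + 1, fun i hi => ?_, Or.inl ⟨h1, by rw [hdq, h2, h33], ?_⟩⟩
          · rcases Nat.lt_or_ge j i with h | h
            · obtain rfl : i = j + 1 := by omega
              rw [← h1]
              refine ⟨?_, fun _ => h4⟩
              rwa [hdq, h2, h33] at h7
            · exact hj i h
          · rw [hiq, h3, sidePin_rev, Bool.not_not]
      · have hd := h.globalDir_eq
        have hyx := h.1
        have hii := h.2.2
        simp only at hd hyx hii hx
        rcases hx with ⟨h1, h2, h3⟩ | ⟨h1, h2, h3⟩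
        · refine ⟨j, hj, Or.inr ⟨?_, by rw [hd, h2], by rw [hii, h3, sidePin_rev]⟩⟩
          simp only [hyx, h2, h1]
          rw [succ_nsmul, add_assoc]
        · refine ⟨j, hj, Or.inl ⟨?_, by rw [hd, h2, h33],
            by rw [hii, h3, sidePin_rev, Bool.not_not]⟩⟩
          simp only [hyx, h2, h1, dirVec_add_three]
          rw [succ_nsmul]; abel
    have symm : ∀ x y, R x y → R y x := by
      rintro ⟨x, p⟩ ⟨y, q⟩ h
      rcases h with ⟨hxy, h4, ⟨h5, h5'⟩, h6, h7⟩ | h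
      · simp only at hxy h4 h5 h5' h6 h7
        subst hxy
        exact Or.inl ⟨rfl, h4, ⟨h33' _ _ h5, by simp [h5']⟩, h7, h6⟩
      · exact Or.inr h.symm
    obtain ⟨j, hj, hv⟩ := (eqvGen_invariant (C := C)
      (fun x y h => ⟨one x y h, one y x (symm x y h)⟩) hc).2
      ⟨0, fun i hi => by
        obtain rfl : i = 0 := by omega
        simpa using hEu, Or.inl ⟨by simp, rfl, gidx⟩⟩
    simp only [X.globalIdx_sidePin hk0 v] at hv
    rcases hv with ⟨h1, h2, h3⟩ | ⟨h1, h2, h3⟩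
    · obtain rfl : j = 0 := by
        by_contra hne
        exact (hj j le_rfl).2 (by omega) (h1 ▸ hQv)
      left
      rw [zero_smul, add_zero] at h1
      rw [h2, sidePin_injective hk h3, h1] at hW
      exact hW
    · right
      refine ⟨v.1, ⟨j + 1, by omega, h1, ⟨v.2, hQv⟩, fun i hi => (hj i (by omega)).1,
        fun i hi hi' hQi => (hj i (by omega)).2 hi hQi.2⟩, ?_⟩
      rwa [h2, sidePin_injective hk h3] at hW
  · rintro (hW | ⟨q, ⟨a, ha, rfl, ⟨hqX, hQq⟩, hedge, hnot⟩, hW⟩)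
    · exact ⟨u, (l, sidePin hk0 e), ⟨hQ, hEu, e, rfl, hW⟩, .refl _⟩
    · have claim : ∀ j < a, ∀ (x : X.Bot) (r : LocalPin k), x.1 = u.1 + (j + 1) • dirVec g →
          X.globalDir x r.1 = g + 3 → X.globalIdx x r.2 = sidePin hk0 (!ε) →
          Relation.EqvGen R (u, (l, sidePin hk0 e)) (x, r) := by
        intro j
        induction j with
        | zero =>
          intro hj x r hx hd hi
          refine .rel _ _ (Or.inr (X.samePin_of (i := sidePin hk0 ε) ?_ hg.symm hd gidx ?_))
          · simpa using hx
          · rw [hi, sidePin_rev]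
        | succ j ih =>
          intro hj x r hx hd hi
          have hEj := hedge (j + 1) hj
          obtain ⟨hyX, -, -⟩ := hE _ _ _ hEj
          have hEj' := (hE _ _ _ (hedge j (by omega))).2.2
          rw [add_assoc, ← succ_nsmul] at hEj'
          obtain ⟨m, hm⟩ := X.exists_globalDir ⟨_, hyX⟩ (g + 3)
          obtain ⟨i, hi'⟩ := X.exists_globalIdx ⟨_, hyX⟩ (sidePin hk0 (!ε))
          have hm' : X.globalDir ⟨_, hyX⟩ (m + 3) = g := by
            rw [X.globalDir_add_three, hm, h33]
          refine (ih (by omega) ⟨_, hyX⟩ (m, i) rfl hm hi').trans _ _ _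
            (.trans _ (⟨_, hyX⟩, (m + 3, i.rev)) _ (.rel _ _ (Or.inl ⟨rfl, ?_, ⟨rfl, rfl⟩, ?_, ?_⟩))
              (.rel _ _ (Or.inr (X.samePin_of (i := sidePin hk0 ε) ?_ hm' hd ?_ ?_))))
          · exact fun hQj => hnot (j + 1) (by omega) hj ⟨hyX, hQj⟩
          · simp only [hm]; exact hEj'
          · simp only [hm']; exact hEj
          · rw [hx, succ_nsmul _ (j + 1), add_assoc]
          · simp only [X.globalIdx_rev, hi', sidePin_rev, Bool.not_not]
          · rw [hi, sidePin_rev]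
      obtain ⟨b, rfl⟩ : ∃ b, a = b + 1 := ⟨a - 1, by omega⟩
      have hEq := (hE _ _ _ (hedge b (by omega))).2.2
      rw [add_assoc, ← succ_nsmul] at hEq
      obtain ⟨m, hm⟩ := X.exists_globalDir ⟨_, hqX⟩ (g + 3)
      obtain ⟨e', he'⟩ : ∃ e', (X.chirality ⟨_, hqX⟩ == e') = !ε := by
        cases X.chirality ⟨_, hqX⟩ <;> cases ε <;> simp
      refine ⟨⟨_, hqX⟩, (m, sidePin hk0 e'), ⟨hQq, by rw [hm]; exact hEq, e', rfl, ?_⟩,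
        .symm _ _ (claim b (by omega) _ _ rfl hm ?_)⟩
      · simp only [hm, he']; exact hW
      · simp only [X.globalIdx_sidePin, he']

/-- Two rounds suffice to exchange a truth value between consecutive nodes of `Q`: in the first
round, a node beeps for "true", in the second, for "false". -/
lemma recv (hk : 2 ≤ k) {E : Set Node → Node → ZMod 6 → Prop} (hE : IsEdge E)
    {Q : Set Node → Node → Prop} (kE : Known k fun X u g _ => E X u g)
    (kQ : Known k fun X u _ _ => Q X u) (hV : Known k V) :
    Known k fun X u g e => Recv (E X) (fun v => v ∈ X ∧ Q X v) (V X) u g e := by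
  have hw : Knowable k fun X u (a b : LocalPin k) => ¬ Q X.occupied u.1 ∧
      (b.1 = a.1 + 3 ∧ b.2 = a.2.rev) ∧
      E X.occupied u.1 (X.globalDir u a.1) ∧ E X.occupied u.1 (X.globalDir u b.1) :=
    Knowable.map₂ (fun (f h : ZMod 6 → Bool → Prop) (a b : LocalPin k) =>
      ¬ f 0 true ∧ (b.1 = a.1 + 3 ∧ b.2 = a.2.rev) ∧ h a.1 true ∧ h b.1 true) kQ kE
  have hb : ∀ {W : Set Node → Node → ZMod 6 → Bool → Prop}, Known k W →
      Knowable k fun X u => {r : LocalPin k | Q X.occupied u.1 ∧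
        E X.occupied u.1 (X.globalDir u r.1) ∧ ∃ e', r.2 = sidePin (by omega) e' ∧
          W X.occupied u.1 (X.globalDir u r.1) (X.chirality u == e')} := by
    intro W hW
    exact Knowable.map₂ (fun (f h : ZMod 6 → Bool → Prop) => {r : LocalPin k | f r.1 true ∧
      ∃ e', r.2 = sidePin (by omega) e' ∧ h r.1 e'}) (kQ.and kE) hW |>.congr fun X u => by
        ext r; simp only [Set.mem_ofPred_eq, and_assoc]
  have hheard : ∀ {W : Set Node → Node → ZMod 6 → Bool → Prop}, Known k W →
      Known k fun X u g e => (Q X u ∧ E X u g) ∧ (W X u g e ∨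
        ∃ q, Succ (E X) (fun v => v ∈ X ∧ Q X v) u g q ∧ W X q (g + 3) (!e)) := by
    intro W hW
    refine (Knowable.map₂ (fun (f : ZMod 6 → Bool → Prop) (s : Set (LocalPin k)) (l : ZMod 6)
      (e : Bool) => f l true ∧ (l, sidePin (by omega) e) ∈ s) (kQ.and kE)
      (Knowable.heard hw (hb hW))).congr fun X u => ?_
    funext l e
    refine propext (and_congr_right fun h => ?_)
    exact (track_spec hk hE W X u l e h.1 h.2).symm
  refine ((kQ.and kE).and ((hV.and (hheard hV.not).not).or (hV.not.and (hheard hV)))).congr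
    fun X u g e hu => ?_
  simp only [Recv]
  by_cases hQ : Q X u
  swap
  · simp [hQ]
  by_cases hEu : E X u g
  swap
  · simp [hEu]
  simp only [hu, hQ, hEu, true_and]
  by_cases hS : ∃ q, Succ (E X) (fun v => v ∈ X ∧ Q X v) u g q
  · obtain ⟨q, hq⟩ := hS
    have huniq : ∀ P : Node → Prop, (∃ q', Succ (E X) (fun v => v ∈ X ∧ Q X v) u g q' ∧ P q') ↔
        P q := fun P => ⟨fun ⟨q', h1, h2⟩ => hq.unique h1 ▸ h2, fun h => ⟨q, hq, h⟩⟩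
    rw [huniq, huniq]
    have : ∃ q, Succ (E X) (fun v => v ∈ X ∧ Q X v) u g q := ⟨q, hq⟩
    simp only [this, not_true, false_and, or_false]
    tauto
  · have h0 : ∀ P : Node → Prop,
        ¬ ∃ q', Succ (E X) (fun v => v ∈ X ∧ Q X v) u g q' ∧ P q' :=
      fun P ⟨q', h1, _⟩ => hS ⟨q', h1⟩
    simp only [hS, h0, false_or, not_false_iff, true_and, or_false]
    tauto

/-- Neighbors can tell each other what they know. -/
lemma nbr (hk : 2 ≤ k) (hV : Known k V) :
    Known k fun X u g e => u + dirVec g ∈ X ∧ V X (u + dirVec g) (g + 3) (!e) := by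
  have hE : IsEdge fun (X : Set Node) u g => u ∈ X ∧ u + dirVec g ∈ X := fun X u g h =>
    ⟨h.1, h.2, h.2, by rw [dirVec_add_three]; simpa using h.1⟩
  refine (recv hk hE (Q := fun _ _ => True) (bond.congr fun X u g e hu => by simp [hu])
    (const True) hV).congr fun X u g e hu => ?_
  simp only [Recv, hu, true_and]
  refine and_congr_right fun h => ?_
  have hs : Succ (fun u g => u ∈ X ∧ u + dirVec g ∈ X) (fun v => v ∈ X ∧ True) u g
      (u + dirVec g) :=
    ⟨1, one_pos, by simp, ⟨h, trivial⟩, fun i hi => by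
      obtain rfl : i = 0 := by omega
      simpa using ⟨hu, h⟩, fun i hi hi' => by omega⟩
  constructor
  · exact fun hv => Or.inl ⟨_, hs, hv⟩
  · rintro (⟨q, hq, hv⟩ | ⟨hn, -⟩)
    · rwa [hs.unique hq]
    · exact absurd ⟨_, hs⟩ hn

end Known
end
end Amoebot

namespace Amoebot

/-! ### Triangles cut out by the special nodes -/

lemma dirVec_add_two (g : ZMod 6) : dirVec (g + 2) = dirVec (g + 1) - dirVec g := by
  revert g; decide

lemma dirVec_ne_zero (g : ZMod 6) : dirVec g ≠ 0 := by
  revert g; decide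

lemma add_three_three (g : ZMod 6) : g + 3 + 3 = g := by revert g; decide

lemma add_five_one (g : ZMod 6) : g + 5 + 1 = g := by revert g; decide

lemma add_five_four (g : ZMod 6) : g + 5 + 4 = g + 3 := by revert g; decide

lemma add_three_five (g : ZMod 6) : g + 3 + 5 = g + 2 := by revert g; decide

lemma line_symm {E : Node → ZMod 6 → Prop} (hE : ∀ u g, E u g → E (u + dirVec g) (g + 3))
    {g : ZMod 6} {u v : Node} (h : Line E g u v) : Line E g v u := by
  have : Std.Symm (Step E g) := ⟨fun a b hab => ?_⟩
  · exact Relation.ReflTransGen.stdSymm.symm _ _ h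
  rcases hab with ⟨h1, rfl⟩ | ⟨h1, rfl⟩
  · exact Or.inr ⟨hE _ _ h1, by rw [dirVec_add_three]; abel⟩
  · refine Or.inl ⟨?_, by rw [dirVec_add_three]; abel⟩
    have := hE _ _ h1
    rwa [add_three_three] at this

lemma line_ray {E : Node → ZMod 6 → Prop} {g : ZMod 6} {u : Node} {n : ℕ}
    (h : ∀ i < n, E (u + i • dirVec g) g) : Line E g u (u + n • dirVec g) := by
  induction n with
  | zero => rw [zero_smul, add_zero]; exact .refl
  | succ n ih =>
    refine (ih fun i hi => h i (by omega)).tail (Or.inl ⟨h n (by omega), ?_⟩)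
    rw [succ_nsmul, add_assoc]

/-- A predicate of pairs `(u, g)` that depends only on the face with corner `u` between the
directions `g` and `g + 1`; it encodes a set of faces. -/
def FaceLike (F : Node → ZMod 6 → Prop) : Prop :=
  ∀ u g, F u g ↔ F (u + dirVec g) (g + 2)

/-- The edges of the faces of a set of faces. -/
def Edge (F : Node → ZMod 6 → Prop) (u : Node) (g : ZMod 6) : Prop := F u g ∨ F u (g + 5)

/-- A set of faces around a node looks like a full disc, like nothing, or like a half-disc. -/
def Flat (A : ZMod 6 → Prop) : Prop :=
  (∀ g, A g) ∨ (∀ g, ¬ A g) ∨ ∃ h, ∀ g, A g ↔ (g = h ∨ g = h + 1 ∨ g = h + 2)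

/-- `P` contains the nodes at which the set of faces is not flat, and every node at which two
different lines through nodes of `P` cross. -/
structure Settled (F : Node → ZMod 6 → Prop) (P : Node → Prop) : Prop where
  faceLike : FaceLike F
  finite : {u | ∃ g, F u g}.Finite
  of_not_flat : ∀ u, ¬ Flat (F u) → P u
  of_cross : ∀ u g g', g' ≠ g → g' ≠ g + 3 → Hit (Edge F) P u g → Hit (Edge F) P u g' → P u

variable {F : Node → ZMod 6 → Prop} {P : Node → Prop}

lemma FaceLike.next (hF : FaceLike F) (u : Node) (g : ZMod 6) :
    F u g ↔ F (u + dirVec (g + 1)) (g + 4) := by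
  rw [hF u g, hF (u + dirVec g) (g + 2), add_assoc, dirVec_add_two, add_sub_cancel, add_assoc]
  rfl

lemma FaceLike.edge_symm (hF : FaceLike F) (u : Node) (g : ZMod 6) (h : Edge F u g) :
    Edge F (u + dirVec g) (g + 3) := by
  rcases h with h | h
  · refine Or.inr ?_
    rw [add_three_five, ← hF]; exact h
  · refine Or.inl ?_
    rwa [hF.next, add_five_one, add_five_four] at h

lemma Settled.not_forall (h : Settled F P) (u : Node) (g : ZMod 6)
    (H : ∀ n : ℕ, ∃ g', F (u + n • dirVec g) g') : False := by
  refine Set.infinite_of_injective_forall_mem (f := fun n : ℕ => u + n • dirVec g) ?_ H h.finite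
  intro a b hab
  have h0 := dirVec_ne_zero g
  simp only [add_right_inj] at hab
  have h1 := congrArg Prod.fst hab
  have h2 := congrArg Prod.snd hab
  simp only [Prod.smul_fst, Prod.smul_snd] at h1 h2
  simp only [nsmul_eq_mul] at h1 h2
  by_cases h3 : (dirVec g).1 = 0
  · have h4 : (dirVec g).2 ≠ 0 := fun h4 => h0 (Prod.ext h3 h4)
    exact_mod_cast mul_right_cancel₀ h4 h2
  · exact_mod_cast mul_right_cancel₀ h3 h1

/-- The boundary line through a boundary node ends at nodes that are not flat. -/
lemma Settled.hit_boundary (h : Settled F P) {u : Node} {d : ZMod 6}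
    (hu : ∀ g, F u g ↔ (g = d ∨ g = d + 1 ∨ g = d + 2)) : Hit (Edge F) P u d := by
  by_contra hn
  have key : ∀ n : ℕ, Line (Edge F) d u (u + n • dirVec d) ∧
      ∀ g, F (u + n • dirVec d) g ↔ (g = d ∨ g = d + 1 ∨ g = d + 2) := by
    intro n
    induction n with
    | zero => rw [zero_smul, add_zero]; exact ⟨.refl, hu⟩
    | succ n ih =>
      obtain ⟨hl, hs⟩ := ih
      have a1 : F (u + n • dirVec d) d := (hs d).2 (Or.inl rfl)
      have a2 : F (u + (n + 1) • dirVec d) (d + 2) := by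
        rw [succ_nsmul, ← add_assoc, ← h.faceLike]; exact a1
      have a3 : ¬ F (u + (n + 1) • dirVec d) (d + 3) := by
        have := h.faceLike.next (u + n • dirVec d) (d + 5)
        rw [add_five_one, add_five_four, add_assoc, ← succ_nsmul] at this
        have hd : ∀ d : ZMod 6, ¬ (d + 5 = d ∨ d + 5 = d + 1 ∨ d + 5 = d + 2) := by decide
        rw [← this, hs]
        exact hd d
      have hl' : Line (Edge F) d u (u + (n + 1) • dirVec d) :=
        hl.tail (Or.inl ⟨Or.inl a1, by rw [succ_nsmul, add_assoc]⟩)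
      refine ⟨hl', ?_⟩
      by_contra hc
      have hflat : ¬ Flat (F (u + (n + 1) • dirVec d)) := by
        rintro (hf | hf | ⟨c, hf⟩)
        · exact a3 (hf _)
        · exact hf _ a2
        · apply hc
          rw [hf] at a2 a3
          have hcd : ∀ c d : ZMod 6, ¬ (d + 3 = c ∨ d + 3 = c + 1 ∨ d + 3 = c + 2) →
            (d + 2 = c ∨ d + 2 = c + 1 ∨ d + 2 = c + 2) → c = d := by decide
          obtain rfl := hcd c d a3 a2
          exact hf
      exact hn ⟨_, h.of_not_flat _ hflat, hl'⟩
  exact h.not_forall u d fun n => ⟨d, ((key n).2 d).2 (Or.inl rfl)⟩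

/-- A node outside `P` on a line through a node of `P` is an inner node or a boundary node of that
line: on each side of the line, the faces at the node are all present or all absent. -/
lemma Settled.straight (h : Settled F P) {u : Node} {g : ZMod 6} (hu : ¬ P u)
    (hg : Hit (Edge F) P u g) :
    (F u g ↔ F u (g + 1)) ∧ (F u (g + 1) ↔ F u (g + 2)) ∧ (F u (g + 3) ↔ F u (g + 4)) ∧
      (F u (g + 4) ↔ F u (g + 5)) := by
  have hflat : Flat (F u) := by
    by_contra hc
    exact hu (h.of_not_flat u hc)
  rcases hflat with hf | hf | ⟨d, hf⟩
  · simp [hf]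
  · simp [hf]
  · have : d = g ∨ d = g + 3 := by
      by_contra hc
      push Not at hc
      exact hu (h.of_cross u g d hc.1 hc.2 hg (h.hit_boundary hf))
    simp only [hf]
    rcases this with rfl | rfl
    · clear hf hg; revert d; decide
    · clear hf hg; revert g; decide

/-- The next node of `P` on the ray from `p` in direction `g` has distance `a`. -/
def NextAt (F : Node → ZMod 6 → Prop) (P : Node → Prop) (p : Node) (g : ZMod 6) (a : ℕ) : Prop :=
  0 < a ∧ P (p + a • dirVec g) ∧ (∀ i < a, Edge F (p + i • dirVec g) g) ∧
    ∀ i, 0 < i → i < a → ¬ P (p + i • dirVec g)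

lemma NextAt.unique {p : Node} {g : ZMod 6} {a b : ℕ} (h : NextAt F P p g a)
    (h' : NextAt F P p g b) : a = b := by
  obtain ⟨ha, hq, -, hn⟩ := h
  obtain ⟨hb, hq', -, hn'⟩ := h'
  rcases lt_trichotomy a b with hab | rfl | hab
  · exact absurd hq (hn' a ha hab)
  · rfl
  · exact absurd hq' (hn b hb hab)

lemma NextAt.succ {p : Node} {g : ZMod 6} {a : ℕ} (h : NextAt F P p g a) :
    Succ (Edge F) P p g (p + a • dirVec g) :=
  ⟨a, h.1, rfl, h.2.1, h.2.2.1, h.2.2.2⟩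

lemma Settled.hit_back (h : Settled F P) {p : Node} {g : ZMod 6} {n : ℕ} (hp : P p)
    (he : ∀ i < n, Edge F (p + i • dirVec g) g) : Hit (Edge F) P (p + n • dirVec g) g :=
  ⟨p, hp, line_symm h.faceLike.edge_symm (line_ray he)⟩

lemma Settled.ray_filled (h : Settled F P) {p : Node} {g : ZMod 6} (hp : P p) (hpg : F p g)
    (n : ℕ) (hn : ∀ i, 0 < i → i ≤ n → ¬ P (p + i • dirVec g)) : F (p + n • dirVec g) g := by
  induction n using Nat.strong_induction_on with
  | _ n ih =>
    cases n with
    | zero => simpa using hpg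
    | succ n =>
      have hs := h.straight (hn (n + 1) (by omega) le_rfl)
        (h.hit_back hp fun i hi => Or.inl (ih i hi fun j h1 h2 => hn j h1 (by omega)))
      rw [hs.1, hs.2.1, succ_nsmul, ← add_assoc, ← h.faceLike]
      exact ih n (by omega) fun j h1 h2 => hn j h1 (by omega)

lemma Settled.exists_nextAt (h : Settled F P) {p : Node} {g : ZMod 6} (hp : P p) (hpg : F p g) :
    ∃ a, NextAt F P p g a := by
  classical
  by_cases hex : ∃ a, 0 < a ∧ P (p + a • dirVec g)
  · have hmin : ∀ i, 0 < i → i < Nat.find hex → ¬ P (p + i • dirVec g) :=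
      fun i h1 h2 h3 => Nat.find_min hex h2 ⟨h1, h3⟩
    exact ⟨Nat.find hex, (Nat.find_spec hex).1, (Nat.find_spec hex).2, fun i hi =>
      Or.inl (h.ray_filled hp hpg i fun j h1 h2 => hmin j h1 (by omega)), hmin⟩
  · push Not at hex
    exact (h.not_forall p g fun n => ⟨g, h.ray_filled hp hpg n fun i h1 _ => hex i h1⟩).elim

/-- The node with coordinates `(i, j)` in the corner at `p` between the directions `g` and
`g + 1`. -/
def gridPt (p : Node) (g : ZMod 6) (i j : ℕ) : Node := p + i • dirVec g + j • dirVec (g + 1)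

lemma gridPt_zero_right (p : Node) (g : ZMod 6) (i : ℕ) : gridPt p g i 0 = p + i • dirVec g := by
  simp [gridPt]

lemma gridPt_zero_left (p : Node) (g : ZMod 6) (j : ℕ) :
    gridPt p g 0 j = p + j • dirVec (g + 1) := by
  simp [gridPt]

lemma gridPt_succ_left (p : Node) (g : ZMod 6) (i j : ℕ) :
    gridPt p g i j + dirVec g = gridPt p g (i + 1) j := by
  rw [gridPt, gridPt, succ_nsmul]; abel

lemma gridPt_succ_right (p : Node) (g : ZMod 6) (i j : ℕ) :
    gridPt p g i j + dirVec (g + 1) = gridPt p g i (j + 1) := by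
  rw [gridPt, gridPt, succ_nsmul]; abel

lemma gridPt_diag (p : Node) (g : ZMod 6) (i j : ℕ) :
    gridPt p g (i + 1) j + dirVec (g + 2) = gridPt p g i (j + 1) := by
  rw [gridPt, gridPt, succ_nsmul, succ_nsmul, dirVec_add_two]; abel

/-- `p` is special, the face at `p` between `g` and `g + 1` is present, and the next special node
in direction `g` has distance `a`. -/
structure GoodCorner (F : Node → ZMod 6 → Prop) (P : Node → Prop) (p : Node) (g : ZMod 6)
    (a : ℕ) : Prop where
  special : P p
  face : F p g
  next : NextAt F P p g a

section
variable {p : Node} {g : ZMod 6} {a : ℕ}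

/-- If the first rows of a corner are present, then so are their edges parallel to the second side. -/
lemma edge_right {r : ℕ} (hr : ∀ i j, i + j < r → F (gridPt p g i j) g) {i j : ℕ}
    (hij : i + j < r) : Edge F (gridPt p g i j) (g + 1) := by
  refine Or.inr ?_
  have e : g + 1 + 5 = g := by clear * -; revert g; decide
  rw [e]; exact hr i j hij

lemma line_right {r : ℕ} (hr : ∀ i j, i + j < r → F (gridPt p g i j) g) {i j : ℕ}
    (hij : i + j ≤ r) : Line (Edge F) (g + 1) (gridPt p g i 0) (gridPt p g i j) := by
  induction j with
  | zero => exact .refl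
  | succ j ih =>
    exact (ih (by omega)).tail (Or.inl ⟨edge_right hr (by omega), (gridPt_succ_right _ _ _ _).symm⟩)

lemma line_row (hF : FaceLike F) {r : ℕ} (hr : ∀ i j, i + j < r → F (gridPt p g i j) g) {i j : ℕ}
    (hij : i + j ≤ r) : Line (Edge F) (g + 2) (gridPt p g (i + j) 0) (gridPt p g i j) := by
  induction j generalizing i with
  | zero => exact .refl
  | succ j ih =>
    have := ih (i := i + 1) (by omega)
    rw [show i + 1 + j = i + (j + 1) by omega] at this
    refine this.tail (Or.inl ⟨Or.inl ?_, (gridPt_diag _ _ _ _).symm⟩)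
    rw [← gridPt_succ_left, ← hF]
    exact hr i j (by omega)

lemma Settled.not_special_inside (h : Settled F P) (hp : GoodCorner F P p g a) {r : ℕ}
    (hr : ∀ i j, i + j < r → F (gridPt p g i j) g) {i j : ℕ} (hi : 0 < i) (hia : i < a)
    (hij : i + j ≤ r) : ¬ P (gridPt p g i j) := by
  intro hP
  refine hp.next.2.2.2 i hi hia ?_
  rw [← gridPt_zero_right]
  refine h.of_cross _ g (g + 1) (by clear * -; revert g; decide) (by clear * -; revert g; decide) ?_
    ⟨_, hP, line_right hr hij⟩
  rw [gridPt_zero_right]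
  exact h.hit_back hp.special fun s hs => hp.next.2.2.1 s (by omega)

lemma Settled.not_special_side (h : Settled F P) (hp : GoodCorner F P p g a) {r : ℕ}
    (hr : ∀ i j, i + j < r → F (gridPt p g i j) g) (hr0 : 0 < r) (hra : r < a) :
    ¬ P (gridPt p g 0 r) := by
  intro hP
  refine hp.next.2.2.2 r hr0 hra ?_
  rw [← gridPt_zero_right]
  have := line_row h.faceLike hr (i := 0) (j := r) (by omega)
  rw [zero_add] at this
  refine h.of_cross _ g (g + 2) (by clear * -; revert g; decide) (by clear * -; revert g; decide) ?_ ⟨_, hP, this⟩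
  rw [gridPt_zero_right]
  exact h.hit_back hp.special fun s hs => hp.next.2.2.1 s (by omega)

lemma Settled.hit_left (h : Settled F P) (hp : P p) {r : ℕ}
    (hr : ∀ i j, i + j < r → F (gridPt p g i j) g) : Hit (Edge F) P (gridPt p g 0 r) (g + 1) := by
  rw [gridPt_zero_left]
  refine h.hit_back hp fun s hs => ?_
  rw [← gridPt_zero_left]
  exact edge_right hr (by omega)

/-- The rows of a corner are present up to the next special node: inside a row, four consecutive
faces at a flat node force the other two. -/
lemma Settled.rows_filled (h : Settled F P) (hp : GoodCorner F P p g a) {r : ℕ} (hr : r ≤ a) :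
    ∀ i j, i + j < r → F (gridPt p g i j) g ∧ (0 < i → F (gridPt p g i j) (g + 1)) := by
  induction r with
  | zero => intro i j hij; omega
  | succ r ih =>
    replace ih := ih (by omega)
    have up : ∀ i j, i + j < r → F (gridPt p g i j) g := fun i j hij => (ih i j hij).1
    have row : ∀ j ≤ r, F (gridPt p g (r - j) j) g ∧
        (0 < r - j → F (gridPt p g (r - j) j) (g + 1)) := by
      intro j
      induction j with
      | zero =>
        intro _
        rw [Nat.sub_zero, gridPt_zero_right]
        have hf : F (p + r • dirVec g) g := h.ray_filled hp.special hp.face r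
          fun i h1 h2 => hp.next.2.2.2 i h1 (by omega)
        refine ⟨hf, fun hr0 => ?_⟩
        exact (h.straight (hp.next.2.2.2 r hr0 (by omega))
          (h.hit_back hp.special fun s hs => hp.next.2.2.1 s (by omega))).1.1 hf
      | succ j ihj =>
        intro hj
        obtain ⟨i, hi⟩ : ∃ i, r - (j + 1) = i := ⟨_, rfl⟩
        have hprev := (ihj (by omega)).2 (by omega)
        rw [show r - j = i + 1 by omega] at hprev
        rw [hi]
        have e1 : g + 1 + 1 = g + 2 := by clear * -; revert g; decide
        have e2 : g + 1 + 4 = g + 5 := by clear * -; revert g; decide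
        have e3 : g + 1 + 2 = g + 3 := by clear * -; revert g; decide
        have e4 : g + 1 + 5 = g := by clear * -; revert g; decide
        have e5 : g + 1 + 3 = g + 4 := by clear * -; revert g; decide
        have h5 : F (gridPt p g i (j + 1)) (g + 5) := by
          rwa [h.faceLike.next, e1, gridPt_diag, e2] at hprev
        have h4 : F (gridPt p g i (j + 1)) (g + 4) := by
          rw [← gridPt_succ_right, ← h.faceLike.next]
          exact up i j (by omega)
        rcases Nat.eq_zero_or_pos i with rfl | hi0
        · refine ⟨?_, fun h0 => by omega⟩
          obtain rfl : r = j + 1 := by omega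
          have hs := h.straight (h.not_special_side hp up (by omega) (by omega))
            (h.hit_left hp.special up)
          rw [e2, e4] at hs
          exact hs.2.2.2.1 h5
        · have h2 : F (gridPt p g i (j + 1)) (g + 2) := by
            obtain ⟨i', rfl⟩ : ∃ i', i = i' + 1 := ⟨i - 1, by omega⟩
            rw [← gridPt_succ_left, ← h.faceLike]
            exact up i' (j + 1) (by omega)
          have h3 : F (gridPt p g i (j + 1)) (g + 3) := by
            rw [← gridPt_succ_right, ← e3, ← h.faceLike]
            exact (ih i j (by omega)).2 hi0
          have hfl : Flat (F (gridPt p g i (j + 1))) := by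
            by_contra hc
            exact h.not_special_inside hp up hi0 (by omega) (by omega) (h.of_not_flat _ hc)
          rcases hfl with hf | hf | ⟨c, hf⟩
          · exact ⟨hf _, fun _ => hf _⟩
          · exact absurd h2 (hf _)
          · exfalso
            rw [hf] at h2 h3 h4 h5
            have : ∀ g c : ZMod 6, (g + 2 = c ∨ g + 2 = c + 1 ∨ g + 2 = c + 2) →
              (g + 3 = c ∨ g + 3 = c + 1 ∨ g + 3 = c + 2) →
              (g + 4 = c ∨ g + 4 = c + 1 ∨ g + 4 = c + 2) →
              (g + 5 = c ∨ g + 5 = c + 1 ∨ g + 5 = c + 2) → False := by decide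
            exact this g c h2 h3 h4 h5
    intro i j hij
    rcases Nat.lt_or_ge (i + j) r with hlt | hge
    · exact ih i j hlt
    · have := row j (by omega)
      rwa [show r - j = i by omega] at this

/-- The special nodes at a corner cut out an equilateral triangle. All faces inside are present;
these are the ones with the same orientation as the triangle. -/
lemma GoodCorner.up (hp : GoodCorner F P p g a) (h : Settled F P) {i j : ℕ} (hij : i + j < a) :
    F (gridPt p g i j) g := (h.rows_filled hp le_rfl i j hij).1

/-- The faces inside with the opposite orientation. -/
lemma GoodCorner.down (hp : GoodCorner F P p g a) (h : Settled F P) {i j : ℕ} (hi : 0 < i)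
    (hij : i + j < a) : F (gridPt p g i j) (g + 1) := (h.rows_filled hp le_rfl i j hij).2 hi

/-- The third vertex of the triangle is special: two sides of the triangle cross there. -/
lemma GoodCorner.special_left (hp : GoodCorner F P p g a) (h : Settled F P) :
    P (gridPt p g 0 a) := by
  have up : ∀ i j, i + j < a → F (gridPt p g i j) g := fun i j => hp.up h
  have hl := line_row h.faceLike up (i := 0) (j := a) (by omega)
  rw [zero_add] at hl
  refine h.of_cross _ (g + 1) (g + 2) (by clear * -; revert g; decide) (by clear * -; revert g; decide)
    (h.hit_left hp.special up) ⟨_, ?_, line_symm h.faceLike.edge_symm hl⟩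
  rw [gridPt_zero_right]
  exact hp.next.2.1

/-- No node of the triangle except its vertices is special: otherwise a line through it would meet the
first side at a special node. -/
lemma GoodCorner.not_special (hp : GoodCorner F P p g a) (h : Settled F P) {i j : ℕ}
    (hij : i + j ≤ a) (h0 : 0 < i + j) (hi : i < a) (hj : j < a) : ¬ P (gridPt p g i j) := by
  rcases Nat.eq_zero_or_pos i with rfl | hi0
  · exact h.not_special_side hp (r := j) (fun i' j' hij' => hp.up h (by omega)) (by omega) hj
  · exact h.not_special_inside hp (r := a) (fun i' j' hij' => hp.up h hij') hi0 hi hij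

/-- The second side of the corner has the same length as the first. -/
lemma GoodCorner.next_left (hp : GoodCorner F P p g a) (h : Settled F P) :
    NextAt F P p (g + 1) a := by
  refine ⟨hp.next.1, ?_, fun i hi => ?_, fun i h1 h2 => ?_⟩
  · rw [← gridPt_zero_left]; exact hp.special_left h
  · rw [← gridPt_zero_left]
    exact edge_right (r := a) (fun i j => hp.up h) (by omega)
  · rw [← gridPt_zero_left]
    exact hp.not_special h (by omega) (by omega) (by omega) h2

/-- The triangle seen from its next vertex. -/
lemma GoodCorner.rotate (hp : GoodCorner F P p g a) (h : Settled F P) :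
    GoodCorner F P (p + a • dirVec g) (g + 2) a := by
  obtain ⟨b, rfl⟩ : ∃ b, a = b + 1 := ⟨a - 1, by have := hp.next.1; omega⟩
  have hpt : ∀ i ≤ b + 1, p + (b + 1) • dirVec g + i • dirVec (g + 2) =
      gridPt p g (b + 1 - i) i := by
    intro i hi
    obtain ⟨c, hc⟩ : ∃ c, b + 1 = c + i := ⟨b + 1 - i, by omega⟩
    rw [hc, Nat.add_sub_cancel, gridPt, dirVec_add_two, add_smul, smul_sub]; abel
  refine ⟨hp.next.2.1, ?_, by omega, ?_, fun i hi => ?_, fun i h1 h2 => ?_⟩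
  · rw [← gridPt_zero_right, ← gridPt_succ_left, ← h.faceLike]
    exact hp.up h (by omega)
  · rw [hpt _ le_rfl, Nat.sub_self]; exact hp.special_left h
  · rw [hpt i (by omega), show b + 1 - i = b - i + 1 by omega, ← gridPt_succ_left]
    refine Or.inl ?_
    rw [← h.faceLike]
    exact hp.up h (by omega)
  · rw [hpt i (by omega)]
    exact hp.not_special h (by omega) (by omega) (by omega) h2

/-- Triangles on both sides of a common edge have the same size. -/
lemma GoodCorner.cross_right (hp : GoodCorner F P p g a) (h : Settled F P)
    (hf : F p (g + 5)) : GoodCorner F P p (g + 5) a := by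
  obtain ⟨b, hb⟩ := h.exists_nextAt hp.special hf
  have hq : GoodCorner F P p (g + 5) b := ⟨hp.special, hf, hb⟩
  have := hq.next_left h
  rw [add_five_one] at this
  rwa [this.unique hp.next] at hq

lemma GoodCorner.cross_left (hp : GoodCorner F P p g a) (h : Settled F P)
    (hf : F p (g + 1)) : GoodCorner F P p (g + 1) a := ⟨hp.special, hf, hp.next_left h⟩

end

end Amoebot

namespace Amoebot

/-! ### Subdividing the faces of the grid -/

/-- The face with vertices `v`, `v + dirVec g` and `v + dirVec (g + 1)`; the tables give its corner
relative to `v` and its orientation. -/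
def faceAt (v : Node) (g : ZMod 6) : Face :=
  ⟨v + (![(0, 0), (-1, 0), (-1, 0), (-1, -1), (0, -1), (0, -1)] : Fin 6 → Node) g,
    (![true, false, true, false, true, false] : Fin 6 → Bool) g⟩

lemma dir_cases (g : ZMod 6) : g = 0 ∨ g = 1 ∨ g = 2 ∨ g = 3 ∨ g = 4 ∨ g = 5 := by
  revert g; decide

lemma dirVec_zero : dirVec 0 = (1, 0) := by decide
lemma dirVec_one : dirVec 1 = (0, 1) := by decide
lemma dirVec_two : dirVec 2 = (-1, 1) := by decide
lemma dirVec_three : dirVec 3 = (-1, 0) := by decide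
lemma dirVec_four : dirVec 4 = (0, -1) := by decide
lemma dirVec_five : dirVec 5 = (1, -1) := by decide

section
variable (x y : ℤ)
lemma faceAt_zero : faceAt (x, y) 0 = ⟨(x, y), true⟩ := by simp [faceAt]
lemma faceAt_one : faceAt (x, y) 1 = ⟨(x - 1, y), false⟩ := by
  change (⟨(x, y) + (-1, 0), false⟩ : Face) = _; simp [sub_eq_add_neg]
lemma faceAt_two : faceAt (x, y) 2 = ⟨(x - 1, y), true⟩ := by
  change (⟨(x, y) + (-1, 0), true⟩ : Face) = _; simp [sub_eq_add_neg]
lemma faceAt_three : faceAt (x, y) 3 = ⟨(x - 1, y - 1), false⟩ := by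
  change (⟨(x, y) + (-1, -1), false⟩ : Face) = _; simp [sub_eq_add_neg]
lemma faceAt_four : faceAt (x, y) 4 = ⟨(x, y - 1), true⟩ := by
  change (⟨(x, y) + (0, -1), true⟩ : Face) = _; simp [sub_eq_add_neg]
lemma faceAt_five : faceAt (x, y) 5 = ⟨(x, y - 1), false⟩ := by
  change (⟨(x, y) + (0, -1), false⟩ : Face) = _; simp [sub_eq_add_neg]
end

lemma faceAt_add (v w : Node) (g : ZMod 6) :
    faceAt (v + w) g = ⟨(faceAt v g).corner + w, (faceAt v g).up⟩ := by
  simp only [faceAt, Face.mk.injEq, and_true]; abel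

lemma faceAt_next (v : Node) (g : ZMod 6) : faceAt (v + dirVec g) (g + 2) = faceAt v g := by
  have : ∀ g, faceAt (0 + dirVec g) (g + 2) = faceAt 0 g := by decide
  have h := this g
  rw [zero_add] at h
  have h1 := faceAt_add (dirVec g) v (g + 2)
  have h2 := faceAt_add 0 v g
  rw [zero_add] at h2
  rw [add_comm, h1, h2, h]

lemma faceAt_injective (v : Node) : Function.Injective (faceAt v) := by
  intro g g' h
  have h2 := faceAt_add 0 v g
  have h3 := faceAt_add 0 v g'
  rw [zero_add] at h2 h3
  rw [h2, h3, Face.mk.injEq, add_left_inj] at h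
  have : ∀ g g', (faceAt 0 g).corner = (faceAt 0 g').corner ∧ (faceAt 0 g).up = (faceAt 0 g').up →
    g = g' := by decide
  exact this g g' h

lemma exists_faceAt (F : Face) : ∃ v g, F = faceAt v g := by
  obtain ⟨⟨x, y⟩, b⟩ := F
  cases b
  · exact ⟨(x + 1, y + 1), 3, by rw [faceAt_three]; simp⟩
  · exact ⟨(x, y), 0, by rw [faceAt_zero]⟩

lemma mem_vertices_faceAt (v w : Node) (g : ZMod 6) :
    w ∈ (faceAt v g).vertices ↔ w = v ∨ w = v + dirVec g ∨ w = v + dirVec (g + 1) := by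
  obtain ⟨x, y⟩ := v
  rcases dir_cases g with rfl | rfl | rfl | rfl | rfl | rfl
  · have : (0 : ZMod 6) + 1 = 1 := rfl
    rw [faceAt_zero, this, dirVec_zero, dirVec_one]
    simp [Face.vertices]
  · have : (1 : ZMod 6) + 1 = 2 := rfl
    rw [faceAt_one, this, dirVec_one, dirVec_two]
    simp [Face.vertices, sub_eq_add_neg]; tauto
  · have : (2 : ZMod 6) + 1 = 3 := rfl
    rw [faceAt_two, this, dirVec_two, dirVec_three]
    simp [Face.vertices, sub_eq_add_neg]; tauto
  · have : (3 : ZMod 6) + 1 = 4 := rfl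
    rw [faceAt_three, this, dirVec_three, dirVec_four]
    simp [Face.vertices, sub_eq_add_neg]; tauto
  · have : (4 : ZMod 6) + 1 = 5 := rfl
    rw [faceAt_four, this, dirVec_four, dirVec_five]
    simp [Face.vertices, sub_eq_add_neg]; tauto
  · have : (5 : ZMod 6) + 1 = 0 := rfl
    rw [faceAt_five, this, dirVec_five, dirVec_zero]
    simp [Face.vertices, sub_eq_add_neg]; tauto

lemma exists_faceAt_of_mem {F : Face} {v : Node} (h : v ∈ F.vertices) : ∃ g, F = faceAt v g := by
  obtain ⟨u, g, rfl⟩ := exists_faceAt F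
  rw [mem_vertices_faceAt] at h
  rcases h with rfl | rfl | rfl
  · exact ⟨g, rfl⟩
  · exact ⟨_, (faceAt_next u g).symm⟩
  · refine ⟨g + 4, ?_⟩
    rw [← faceAt_next u g, ← faceAt_next _ (g + 2), dirVec_add_two, add_assoc, add_sub_cancel,
      add_assoc]
    rfl

/-- Adjacent faces are consecutive around a common vertex. -/
lemma dualGrid_adj {F G : Face} (h : dualGrid.Adj F G) :
    ∃ v g, (F = faceAt v g ∧ G = faceAt v (g + 5)) ∨ (G = faceAt v g ∧ F = faceAt v (g + 5)) := by
  obtain ⟨hne, hcard⟩ := h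
  obtain ⟨a, b, hab, hI⟩ := Finset.card_eq_two.1 hcard
  have ha : a ∈ F.vertices ∩ G.vertices := by rw [hI]; simp
  have hb : b ∈ F.vertices ∩ G.vertices := by rw [hI]; simp
  rw [Finset.mem_inter] at ha hb
  obtain ⟨g, rfl⟩ := exists_faceAt_of_mem ha.1
  obtain ⟨g', rfl⟩ := exists_faceAt_of_mem ha.2
  have hgg : g ≠ g' := fun h => hne (by rw [h])
  rw [mem_vertices_faceAt, mem_vertices_faceAt] at hb
  have inj : ∀ c d, a + dirVec c = a + dirVec d → c = d := fun c d h =>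
    dirVec_injective (add_left_cancel h)
  refine ⟨a, ?_⟩
  rcases hb.1 with h1 | h1 | h1
  · exact absurd h1.symm hab
  · rcases hb.2 with h2 | h2 | h2
    · exact absurd h2.symm hab
    · exact absurd (inj _ _ (h1.symm.trans h2)) hgg
    · have := inj _ _ (h1.symm.trans h2)
      refine ⟨g, Or.inl ⟨rfl, ?_⟩⟩
      rw [this]; congr 1; clear * -; revert g'; decide
  · rcases hb.2 with h2 | h2 | h2
    · exact absurd h2.symm hab
    · have := inj _ _ (h1.symm.trans h2)
      refine ⟨g', Or.inr ⟨rfl, ?_⟩⟩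
      rw [← this]; congr 1; clear * -; revert g; decide
    · exact absurd (add_right_cancel (inj _ _ (h1.symm.trans h2))) hgg

/-- The face of the lattice of side length `s` that contains a given face of the grid. It is
determined by the strips between lattice lines of the three directions, with strip coordinates `x`,
`y` and `x + y` (increased by one for faces that point down) of the corner `(x, y)`. -/
def latFace (s : ℕ) (F : Face) : Face :=
  ⟨(F.corner.1 / s, F.corner.2 / s),
    decide ((F.corner.1 + F.corner.2 + (if F.up then 0 else 1)) / s =
      F.corner.1 / s + F.corner.2 / s)⟩

lemma ediv_eq {s x a : ℤ} (h1 : s * a ≤ x) (h2 : x < s * a + s) : x / s = a := by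
  have hs : 0 < s := by omega
  apply le_antisymm
  · rw [← Int.lt_add_one_iff, Int.ediv_lt_iff_lt_mul hs]; linarith
  · rw [Int.le_ediv_iff_mul_le hs]; linarith

lemma ediv_spec {s : ℤ} (hs : 0 < s) (x : ℤ) : s * (x / s) ≤ x ∧ x < s * (x / s) + s :=
  ⟨by have := Int.emod_nonneg x hs.ne'; have := Int.mul_ediv_add_emod x s; omega,
   by have := Int.emod_lt_of_pos x hs; have := Int.mul_ediv_add_emod x s; omega⟩

variable {s : ℕ}

lemma latFace_eq_up (hs : 0 < s) (x y a b : ℤ) (u : Bool) :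
    latFace s ⟨(x, y), u⟩ = ⟨(a, b), true⟩ ↔
      s * a ≤ x ∧ s * b ≤ y ∧ x + y + (if u then 0 else 1) < s * a + s * b + s := by
  have hs' : (0 : ℤ) < s := by exact_mod_cast hs
  have hif : (0 : ℤ) ≤ (if u then 0 else 1) := by split_ifs <;> norm_num
  generalize hz : x + y + (if u then 0 else 1 : ℤ) = z
  simp only [latFace, hz, Face.mk.injEq, Prod.mk.injEq, decide_eq_true_eq]
  constructor
  · rintro ⟨⟨rfl, rfl⟩, h⟩
    have h1 := ediv_spec hs' x
    have h2 := ediv_spec hs' y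
    have h3 := ediv_spec hs' z
    rw [h, mul_add] at h3
    omega
  · rintro ⟨h1, h2, h3⟩
    have e1 : x / s = a := ediv_eq h1 (by omega)
    have e2 : y / s = b := ediv_eq h2 (by omega)
    rw [e1, e2]
    exact ⟨⟨rfl, rfl⟩, ediv_eq (by rw [mul_add]; omega) (by rw [mul_add]; omega)⟩

lemma latFace_eq_down (hs : 0 < s) (x y a b : ℤ) (u : Bool) :
    latFace s ⟨(x, y), u⟩ = ⟨(a, b), false⟩ ↔
      x < s * a + s ∧ y < s * b + s ∧ s * a + s * b + s ≤ x + y + (if u then 0 else 1) := by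
  have hs' : (0 : ℤ) < s := by exact_mod_cast hs
  have hif : (if u then 0 else 1 : ℤ) ≤ 1 := by split_ifs <;> norm_num
  have hif0 : (0 : ℤ) ≤ (if u then 0 else 1) := by split_ifs <;> norm_num
  generalize hz : x + y + (if u then 0 else 1 : ℤ) = z
  simp only [latFace, hz, Face.mk.injEq, Prod.mk.injEq, decide_eq_false_iff_not]
  constructor
  · rintro ⟨⟨rfl, rfl⟩, h⟩
    have h1 := ediv_spec hs' x
    have h2 := ediv_spec hs' y
    refine ⟨h1.2, h2.2, ?_⟩
    by_contra hc
    exact h (ediv_eq (by rw [mul_add]; omega) (by rw [mul_add]; omega))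
  · rintro ⟨h1, h2, h3⟩
    have e1 : x / s = a := ediv_eq (by omega) h1
    have e2 : y / s = b := ediv_eq (by omega) h2
    rw [e1, e2]
    refine ⟨⟨rfl, rfl⟩, fun h => ?_⟩
    have h4 := ediv_spec hs' z
    rw [h, mul_add] at h4
    omega

/-- The node `m` lies in the face `F` of the lattice of side length `s`. -/
def InTri (s : ℕ) (F : Face) (m : Node) : Prop :=
  if F.up then s * F.corner.1 ≤ m.1 ∧ s * F.corner.2 ≤ m.2 ∧
    m.1 + m.2 ≤ s * F.corner.1 + s * F.corner.2 + s
  else m.1 ≤ s * F.corner.1 + s ∧ m.2 ≤ s * F.corner.2 + s ∧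
    s * F.corner.1 + s * F.corner.2 + s ≤ m.1 + m.2

lemma inTri_iff (hs : 0 < s) (F : Face) (m : Node) :
    InTri s F m ↔ ∃ g, latFace s (faceAt m g) = F := by
  obtain ⟨⟨a, b⟩, u⟩ := F
  obtain ⟨x, y⟩ := m
  cases u
  · simp only [InTri, Bool.false_eq_true, if_false]
    constructor
    · rintro ⟨h1, h2, h3⟩
      rcases h3.lt_or_eq with h3' | h3'
      · exact ⟨3, by rw [faceAt_three, latFace_eq_down hs]; simp; omega⟩
      · rcases h2.lt_or_eq with h2' | h2'
        · exact ⟨1, by rw [faceAt_one, latFace_eq_down hs]; simp; omega⟩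
        · exact ⟨5, by rw [faceAt_five, latFace_eq_down hs]; simp; omega⟩
    · rintro ⟨g, hg⟩
      rcases dir_cases g with rfl | rfl | rfl | rfl | rfl | rfl
      · rw [faceAt_zero, latFace_eq_down hs] at hg; simp at hg; omega
      · rw [faceAt_one, latFace_eq_down hs] at hg; simp at hg; omega
      · rw [faceAt_two, latFace_eq_down hs] at hg; simp at hg; omega
      · rw [faceAt_three, latFace_eq_down hs] at hg; simp at hg; omega
      · rw [faceAt_four, latFace_eq_down hs] at hg; simp at hg; omega
      · rw [faceAt_five, latFace_eq_down hs] at hg; simp at hg; omega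
  · simp only [InTri, if_true]
    constructor
    · rintro ⟨h1, h2, h3⟩
      rcases h3.lt_or_eq with h3' | h3'
      · exact ⟨0, by rw [faceAt_zero, latFace_eq_up hs]; simp only [if_true]; omega⟩
      · rcases h1.lt_or_eq with h1' | h1'
        · exact ⟨2, by rw [faceAt_two, latFace_eq_up hs]; simp only [if_true]; omega⟩
        · exact ⟨4, by rw [faceAt_four, latFace_eq_up hs]; simp only [if_true]; omega⟩
    · rintro ⟨g, hg⟩
      rcases dir_cases g with rfl | rfl | rfl | rfl | rfl | rfl
      · rw [faceAt_zero, latFace_eq_up hs] at hg; simp at hg; omega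
      · rw [faceAt_one, latFace_eq_up hs] at hg; simp at hg; omega
      · rw [faceAt_two, latFace_eq_up hs] at hg; simp at hg; omega
      · rw [faceAt_three, latFace_eq_up hs] at hg; simp at hg; omega
      · rw [faceAt_four, latFace_eq_up hs] at hg; simp at hg; omega
      · rw [faceAt_five, latFace_eq_up hs] at hg; simp at hg; omega

/-- Coordinates of the nodes of a lattice face with respect to one of its corners. -/
lemma inTri_faceAt (w : Node) (g : ZMod 6) (m : Node) :
    InTri s (faceAt w g) m ↔ ∃ i j : ℕ, i + j ≤ s ∧ m = gridPt (s • w) g i j := by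
  obtain ⟨a, b⟩ := w
  obtain ⟨x, y⟩ := m
  have mk : ∀ {i j : ℤ} {Q : ℕ → ℕ → Prop}, 0 ≤ i → 0 ≤ j → (∀ i' j' : ℕ, (i' : ℤ) = i →
      (j' : ℤ) = j → Q i' j') → ∃ i j : ℕ, Q i j := fun {i j Q} hi hj h =>
    ⟨i.toNat, j.toNat, h _ _ (Int.toNat_of_nonneg hi) (Int.toNat_of_nonneg hj)⟩
  rcases dir_cases g with rfl | rfl | rfl | rfl | rfl | rfl
  · have : (0 : ZMod 6) + 1 = 1 := rfl
    simp only [faceAt_zero, gridPt, this, dirVec_zero, dirVec_one, InTri, Prod.ext_iff,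
      Prod.fst_add, Prod.snd_add, Prod.smul_fst, Prod.smul_snd]
    simp
    constructor
    · intro h
      refine mk (i := x - s * a) (j := y - s * b) ?_ ?_ ?_ <;> omega
    · rintro ⟨i, j, h⟩; omega
  · have : (1 : ZMod 6) + 1 = 2 := rfl
    simp only [faceAt_one, gridPt, this, dirVec_one, dirVec_two, InTri, Prod.ext_iff,
      Prod.fst_add, Prod.snd_add, Prod.smul_fst, Prod.smul_snd]
    simp [mul_sub]
    constructor
    · intro h
      refine mk (i := y - s * b + x - s * a) (j := s * a - x) ?_ ?_ ?_ <;> omega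
    · rintro ⟨i, j, h⟩; omega
  · have : (2 : ZMod 6) + 1 = 3 := rfl
    simp only [faceAt_two, gridPt, this, dirVec_two, dirVec_three, InTri, Prod.ext_iff,
      Prod.fst_add, Prod.snd_add, Prod.smul_fst, Prod.smul_snd]
    simp [mul_sub]
    constructor
    · intro h
      refine mk (i := y - s * b) (j := s * a - x - (y - s * b)) ?_ ?_ ?_ <;> omega
    · rintro ⟨i, j, h⟩; omega
  · have : (3 : ZMod 6) + 1 = 4 := rfl
    simp only [faceAt_three, gridPt, this, dirVec_three, dirVec_four, InTri, Prod.ext_iff,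
      Prod.fst_add, Prod.snd_add, Prod.smul_fst, Prod.smul_snd]
    simp [mul_sub]
    constructor
    · intro h
      refine mk (i := s * a - x) (j := s * b - y) ?_ ?_ ?_ <;> omega
    · rintro ⟨i, j, h⟩; omega
  · have : (4 : ZMod 6) + 1 = 5 := rfl
    simp only [faceAt_four, gridPt, this, dirVec_four, dirVec_five, InTri, Prod.ext_iff,
      Prod.fst_add, Prod.snd_add, Prod.smul_fst, Prod.smul_snd]
    simp [mul_sub]
    constructor
    · intro h
      refine mk (i := s * b - y - (x - s * a)) (j := x - s * a) ?_ ?_ ?_ <;> omega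
    · rintro ⟨i, j, h⟩; omega
  · have : (5 : ZMod 6) + 1 = 0 := rfl
    simp only [faceAt_five, gridPt, this, dirVec_five, dirVec_zero, InTri, Prod.ext_iff,
      Prod.fst_add, Prod.snd_add, Prod.smul_fst, Prod.smul_snd]
    simp [mul_sub]
    constructor
    · intro h
      refine mk (i := s * b - y) (j := x - s * a + (y - s * b)) ?_ ?_ ?_ <;> omega
    · rintro ⟨i, j, h⟩; omega

/-- The faces of the grid inside a lattice face are those of the two kinds in its corner. -/
lemma latFace_eq_faceAt (hs : 0 < s) (w : Node) (g : ZMod 6) (G : Face) :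
    latFace s G = faceAt w g ↔ ∃ i j : ℕ, i + j < s ∧ (G = faceAt (gridPt (s • w) g i j) g ∨
      (0 < i ∧ G = faceAt (gridPt (s • w) g i j) (g + 1))) := by
  obtain ⟨a, b⟩ := w
  obtain ⟨⟨x, y⟩, u⟩ := G
  have mk : ∀ {i j : ℤ} {Q : ℕ → ℕ → Prop}, 0 ≤ i → 0 ≤ j → (∀ i' j' : ℕ, (i' : ℤ) = i →
      (j' : ℤ) = j → Q i' j') → ∃ i j : ℕ, Q i j := fun {i j Q} hi hj h =>
    ⟨i.toNat, j.toNat, h _ _ (Int.toNat_of_nonneg hi) (Int.toNat_of_nonneg hj)⟩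
  rcases dir_cases g with rfl | rfl | rfl | rfl | rfl | rfl
  · have e : (0 : ZMod 6) + 1 = 1 := rfl
    simp only [gridPt, e, dirVec_zero, dirVec_one, Prod.smul_mk, Prod.mk_add_mk, faceAt_zero,
      faceAt_one, latFace_eq_up hs]
    cases u <;> simp
    · constructor
      · intro h
        refine mk (i := x - s * a + 1) (j := y - s * b) ?_ ?_ ?_ <;> omega
      · rintro ⟨i, j, h⟩; omega
    · constructor
      · intro h
        refine mk (i := x - s * a) (j := y - s * b) ?_ ?_ ?_ <;> omega
      · rintro ⟨i, j, h⟩; omega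
  · have e : (1 : ZMod 6) + 1 = 2 := rfl
    simp only [gridPt, e, dirVec_one, dirVec_two, Prod.smul_mk, Prod.mk_add_mk, faceAt_one,
      faceAt_two, latFace_eq_down hs]
    cases u <;> simp [mul_sub]
    · constructor
      · intro h
        refine mk (i := y - s * b + (x + 1) - s * a) (j := s * a - (x + 1)) ?_ ?_ ?_ <;> omega
      · rintro ⟨i, j, h⟩; omega
    · constructor
      · intro h
        refine mk (i := y - s * b + (x + 1) - s * a) (j := s * a - (x + 1)) ?_ ?_ ?_ <;> omega
      · rintro ⟨i, j, h⟩; omega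
  · have e : (2 : ZMod 6) + 1 = 3 := rfl
    simp only [gridPt, e, dirVec_two, dirVec_three, Prod.smul_mk, Prod.mk_add_mk, faceAt_two,
      faceAt_three, latFace_eq_up hs]
    cases u <;> simp [mul_sub]
    · constructor
      · intro h
        refine mk (i := (y + 1) - s * b) (j := s * a - (x + 1) - ((y + 1) - s * b)) ?_ ?_ ?_ <;> omega
      · rintro ⟨i, j, h⟩; omega
    · constructor
      · intro h
        refine mk (i := y - s * b) (j := s * a - (x + 1) - (y - s * b)) ?_ ?_ ?_ <;> omega
      · rintro ⟨i, j, h⟩; omega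
  · have e : (3 : ZMod 6) + 1 = 4 := rfl
    simp only [gridPt, e, dirVec_three, dirVec_four, Prod.smul_mk, Prod.mk_add_mk, faceAt_three,
      faceAt_four, latFace_eq_down hs]
    cases u <;> simp [mul_sub]
    · constructor
      · intro h
        refine mk (i := s * a - (x + 1)) (j := s * b - (y + 1)) ?_ ?_ ?_ <;> omega
      · rintro ⟨i, j, h⟩; omega
    · constructor
      · intro h
        refine mk (i := s * a - x) (j := s * b - (y + 1)) ?_ ?_ ?_ <;> omega
      · rintro ⟨i, j, h⟩; omega
  · have e : (4 : ZMod 6) + 1 = 5 := rfl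
    simp only [gridPt, e, dirVec_four, dirVec_five, Prod.smul_mk, Prod.mk_add_mk, faceAt_four,
      faceAt_five, latFace_eq_up hs]
    cases u <;> simp [mul_sub]
    · constructor
      · intro h
        refine mk (i := s * b - (y + 1) - (x - s * a)) (j := x - s * a) ?_ ?_ ?_ <;> omega
      · rintro ⟨i, j, h⟩; omega
    · constructor
      · intro h
        refine mk (i := s * b - (y + 1) - (x - s * a)) (j := x - s * a) ?_ ?_ ?_ <;> omega
      · rintro ⟨i, j, h⟩; omega
  · have e : (5 : ZMod 6) + 1 = 0 := rfl
    simp only [gridPt, e, dirVec_five, dirVec_zero, Prod.smul_mk, Prod.mk_add_mk, faceAt_five,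
      faceAt_zero, latFace_eq_down hs]
    cases u <;> simp [mul_sub]
    · constructor
      · intro h
        refine mk (i := s * b - (y + 1)) (j := x - s * a + ((y + 1) - s * b)) ?_ ?_ ?_ <;> omega
      · rintro ⟨i, j, h⟩; omega
    · constructor
      · intro h
        refine mk (i := s * b - y) (j := x - s * a + (y - s * b)) ?_ ?_ ?_ <;> omega
      · rintro ⟨i, j, h⟩; omega

/-- If two adjacent faces of the grid lie in different lattice faces, then their common edge lies on
a common edge of the two lattice faces. -/
lemma latFace_cross (hs : 0 < s) (u : Node) (g : ZMod 6)
    (h : latFace s (faceAt u g) ≠ latFace s (faceAt u (g + 5))) :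
    ∃ (w : Node) (i : ℕ), i < s ∧ u = s • w + i • dirVec g ∧
      latFace s (faceAt u g) = faceAt w g ∧ latFace s (faceAt u (g + 5)) = faceAt w (g + 5) := by
  have hs' : (0 : ℤ) < s := by exact_mod_cast hs
  -- it suffices to find the lattice edge that contains the common edge
  suffices H : ∃ (w : Node) (i : ℕ), i < s ∧ u = s • w + i • dirVec g by
    obtain ⟨w, i, hi, rfl⟩ := H
    refine ⟨w, i, hi, rfl, (latFace_eq_faceAt hs _ _ _).2 ⟨i, 0, by omega, Or.inl ?_⟩,
      (latFace_eq_faceAt hs _ _ _).2 ⟨0, i, by omega, Or.inl ?_⟩⟩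
    · rw [gridPt_zero_right]
    · rw [gridPt_zero_left, add_five_one]
  have key : ∀ {g x y}, (∃ i a b : ℤ, 0 ≤ i ∧ i < s ∧ x = s * a + i * (dirVec g).1 ∧
      y = s * b + i * (dirVec g).2) → ∃ (w : Node) (i : ℕ), i < s ∧ (x, y) = s • w + i • dirVec g := by
    rintro g x y ⟨i, a, b, h0, h1, rfl, rfl⟩
    lift i to ℕ using h0
    exact ⟨(a, b), i, by exact_mod_cast h1, by simp [Prod.ext_iff]⟩
  obtain ⟨x, y⟩ := u
  apply key
  have hx := ediv_spec hs' x
  have hy := ediv_spec hs' y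
  have hx' := ediv_spec hs' (x - 1)
  have hy' := ediv_spec hs' (y - 1)
  have div_pred : ∀ x : ℤ, s * (x / s) ≠ x → (x - 1) / s = x / s := by
    intro x hx
    have := ediv_spec hs' x
    exact ediv_eq (by omega) (by omega)
  -- the strip coordinate that differs is a multiple of the side length
  have same : ∀ {x y x' y' : ℤ} {u u' : Bool}, x / s = x' / s → y / s = y' / s →
      (x + y + (if u then 0 else 1)) / s = (x' + y' + (if u' then 0 else 1)) / s →
      latFace s ⟨(x, y), u⟩ = latFace s ⟨(x', y'), u'⟩ := by
    intro x y x' y' u u' h1 h2 h3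
    simp only [latFace, h1, h2, h3]
  rcases dir_cases g with rfl | rfl | rfl | rfl | rfl | rfl
  · have e : (0 : ZMod 6) + 5 = 5 := rfl
    rw [e, faceAt_zero, faceAt_five] at h
    have hm : s * (y / s) = y := by
      by_contra hc
      exact h (same rfl (div_pred y hc).symm (by simp; congr 1; ring))
    rw [dirVec_zero]
    exact ⟨x - s * (x / s), x / s, y / s, by omega, by omega, by simp, by simp [hm]⟩
  · have e : (1 : ZMod 6) + 5 = 0 := rfl
    rw [e, faceAt_one, faceAt_zero] at h
    have hm : s * (x / s) = x := by
      by_contra hc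
      exact h (same (div_pred x hc) rfl (by simp; congr 1; ring))
    rw [dirVec_one]
    exact ⟨y - s * (y / s), x / s, y / s, by omega, by omega, by simp [hm], by simp⟩
  · have e : (2 : ZMod 6) + 5 = 1 := rfl
    rw [e, faceAt_two, faceAt_one] at h
    have hm : s * ((x + y) / s) = x + y := by
      by_contra hc
      refine h (same rfl rfl ?_)
      have := div_pred _ hc
      simp only [if_true, Bool.false_eq_true, if_false]
      rw [show x - 1 + y + 1 = x + y by ring, ← this]; congr 1; ring
    rw [dirVec_two]
    exact ⟨y - s * (y / s), (x + y) / s - y / s, y / s, by omega, by omega,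
      by rw [mul_sub]; omega, by omega⟩
  · have e : (3 : ZMod 6) + 5 = 2 := rfl
    rw [e, faceAt_three, faceAt_two] at h
    have hm : s * (y / s) = y := by
      by_contra hc
      exact h (same rfl (div_pred y hc) (by simp; congr 1; ring))
    rw [dirVec_three]
    exact ⟨s * ((x - 1) / s) + s - x, (x - 1) / s + 1, y / s, by omega, by omega,
      by rw [mul_add]; omega, by omega⟩
  · have e : (4 : ZMod 6) + 5 = 3 := rfl
    rw [e, faceAt_four, faceAt_three] at h
    have hm : s * (x / s) = x := by
      by_contra hc
      exact h (same (div_pred x hc).symm rfl (by simp; congr 1; ring))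
    rw [dirVec_four]
    exact ⟨s * ((y - 1) / s) + s - y, x / s, (y - 1) / s + 1, by omega, by omega, by omega,
      by rw [mul_add]; omega⟩
  · have e : (5 : ZMod 6) + 5 = 4 := rfl
    rw [e, faceAt_five, faceAt_four] at h
    have hm : s * ((x + y) / s) = x + y := by
      by_contra hc
      refine h (same rfl rfl ?_)
      have := div_pred _ hc
      simp only [if_true, Bool.false_eq_true, if_false]
      rw [show x + (y - 1) + 1 = x + y by ring, ← this]; congr 1; ring
    rw [dirVec_five]
    exact ⟨x - s * (x / s), x / s, (x + y) / s - x / s, by omega, by omega, by omega,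
      by rw [mul_sub]; omega⟩

end Amoebot

namespace Amoebot

/-! ### Representations in grid coordinates -/

/-- The linear isometry of the grid that maps direction `g` to direction `r + g` (for `e = true`)
or to direction `r - g` (for `e = false`). -/
def frameMap (r : ZMod 6) (e : Bool) (m : Node) : Node := m.1 • dirVec r + m.2 • dirVec (r + sgn e)

lemma frameMap_add (r : ZMod 6) (e : Bool) (m n : Node) :
    frameMap r e (m + n) = frameMap r e m + frameMap r e n := by
  simp only [frameMap, Prod.fst_add, Prod.snd_add, add_smul]; abel

lemma frameMap_zsmul (r : ZMod 6) (e : Bool) (c : ℤ) (m : Node) :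
    frameMap r e (c • m) = c • frameMap r e m := by
  simp only [frameMap, Prod.smul_fst, Prod.smul_snd, smul_add, smul_smul, smul_eq_mul]

lemma frameMap_nsmul (r : ZMod 6) (e : Bool) (c : ℕ) (m : Node) :
    frameMap r e (c • m) = c • frameMap r e m := by
  rw [← natCast_zsmul, frameMap_zsmul, natCast_zsmul]

lemma frameMap_sub (r : ZMod 6) (e : Bool) (m n : Node) :
    frameMap r e (m - n) = frameMap r e m - frameMap r e n := by
  rw [eq_sub_iff_add_eq, ← frameMap_add, sub_add_cancel]

lemma frameMap_dirVec (r : ZMod 6) (e : Bool) (g : ZMod 6) :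
    frameMap r e (dirVec g) = dirVec (r + sgn e * g) := by
  revert r e g; decide

lemma frameMap_comp (r r' : ZMod 6) (e e' : Bool) (m : Node) :
    frameMap r e (frameMap r' e' m) = frameMap (r + sgn e * r') (e == e') m := by
  have h : ∀ e e' : Bool, sgn e * sgn e' = sgn (e == e') := by decide
  have h' : frameMap r' e' m = m.1 • dirVec r' + m.2 • dirVec (r' + sgn e') := rfl
  rw [h', frameMap_add, frameMap_zsmul, frameMap_zsmul, frameMap_dirVec, frameMap_dirVec, mul_add,
    h, ← add_assoc, frameMap]

lemma frameMap_zero_true (m : Node) : frameMap 0 true m = m := by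
  have h0 : dirVec 0 = (1, 0) := by decide
  have h1 : dirVec (0 + sgn true) = (0, 1) := by decide
  rw [frameMap, h0, h1]; simp

lemma frameMap_bijective (r : ZMod 6) (e : Bool) : Function.Bijective (frameMap r e) := by
  have h1 : ∀ r e, sgn e * r + sgn e * (-r) = 0 := by intro r e; ring
  have h2 : ∀ r e, r + sgn e * -(sgn e * r) = 0 := by decide
  have h3 : ∀ r e, -(sgn e * r) + sgn e * r = 0 := by intro r e; ring
  refine Function.bijective_iff_has_inverse.2 ⟨frameMap (-(sgn e * r)) e, fun m => ?_, fun m => ?_⟩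
  · rw [frameMap_comp, h3, beq_self_eq_true, frameMap_zero_true]
  · rw [frameMap_comp, h2, beq_self_eq_true, frameMap_zero_true]

lemma rot60_iterate (t : ℕ) (m : Node) : rot60^[t] m = frameMap (t : ZMod 6) true m := by
  induction t with
  | zero => simp [frameMap_zero_true]
  | succ t ih =>
    have h1 : ∀ m, rot60 m = frameMap 1 true m := by
      intro m
      have h0 : dirVec 1 = (0, 1) := by decide
      have h1 : dirVec (1 + sgn true) = (-1, 1) := by decide
      rw [frameMap, h0, h1]; simp [rot60]
    rw [Function.iterate_succ_apply', ih, h1, frameMap_comp]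
    congr 1
    push_cast
    simp [sgn, add_comm]

/-- The nodes of the faces in `S` of the lattice of side length `s`. -/
def Shape.scaled (S : Shape) (s : ℕ) : Set Node := {m | ∃ g, latFace s (faceAt m g) ∈ S}

lemma Shape.mem_scaled {S : Shape} {s : ℕ} (hs : 0 < s) {m : Node} :
    m ∈ S.scaled s ↔ ∃ F ∈ S, InTri s F m := by
  simp only [inTri_iff hs, Shape.scaled, Set.mem_ofPred_eq]
  constructor
  · rintro ⟨g, hg⟩; exact ⟨_, hg, g, rfl⟩
  · rintro ⟨F, hF, g, rfl⟩; exact ⟨g, hF⟩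

lemma toPlane_add (p q : Node) : toPlane (p + q) = toPlane p + toPlane q := by
  simp [toPlane]

lemma toPlane_zsmul (c : ℤ) (q : Node) : toPlane (c • q) = (c : ℝ) • toPlane q := by
  simp [toPlane]

/-- A triangle whose vertices are the nodes of a lattice face, described by inequalities. -/
lemma mem_convexHull_face {s : ℕ} (hs : 0 < s) (F : Face) (m : Node) :
    toPlane m ∈ convexHull ℝ ((fun v => toPlane (s • v)) '' (F.vertices : Set Node)) ↔
      InTri s F m := by
  have hs' : (0 : ℝ) < s := by exact_mod_cast hs
  obtain ⟨⟨a, b⟩, u⟩ := F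
  obtain ⟨x, y⟩ := m
  have comb : ∀ {A : Set (ℝ × ℝ)} (v₀ v₁ v₂ q : ℝ × ℝ) (w₀ w₁ w₂ : ℝ), v₀ ∈ A → v₁ ∈ A → v₂ ∈ A →
      0 ≤ w₀ → 0 ≤ w₁ → 0 ≤ w₂ → w₀ + w₁ + w₂ = 1 → q = w₀ • v₀ + w₁ • v₁ + w₂ • v₂ →
      q ∈ convexHull ℝ A := by
    intro A v₀ v₁ v₂ q w₀ w₁ w₂ h0 h1 h2 p0 p1 p2 hw hq
    have := (convex_convexHull ℝ A).sum_mem (t := Finset.univ) (w := ![w₀, w₁, w₂])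
      (z := ![v₀, v₁, v₂]) ?_ ?_ ?_
    · rw [hq]; simpa [Fin.sum_univ_three] using this
    · intro i _; fin_cases i <;> simpa
    · simpa [Fin.sum_univ_three] using hw
    · intro i _; fin_cases i <;> exact subset_convexHull ℝ A (by simpa)
  cases u
  · simp only [Face.vertices, InTri, Bool.false_eq_true, if_false]
    constructor
    · intro h
      have hsub : convexHull ℝ ((fun v : Node => toPlane (s • v)) '' (({(a, b) + (1, 0),
          (a, b) + (0, 1), (a, b) + (1, 1)} : Finset Node) : Set Node)) ⊆
          {q : ℝ × ℝ | q.1 ≤ s * a + s ∧ q.2 ≤ s * b + s ∧ s * a + s * b + s ≤ q.1 + q.2} := by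
        refine convexHull_min ?_ ?_
        · rintro _ ⟨v, hv, rfl⟩
          simp only [Finset.coe_insert, Finset.coe_singleton, Set.mem_insert_iff,
            Set.mem_singleton_iff] at hv
          rcases hv with rfl | rfl | rfl <;> simp [toPlane] <;>
            (try constructor) <;> (try constructor) <;> nlinarith
        · intro p hp q hq c d hc hd hcd
          obtain ⟨p1, p2, p3⟩ := hp
          obtain ⟨q1, q2, q3⟩ := hq
          obtain rfl : d = 1 - c := by linarith
          simp only [Set.mem_ofPred_eq, Prod.fst_add, Prod.snd_add, Prod.smul_fst, Prod.smul_snd,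
            smul_eq_mul]
          refine ⟨?_, ?_, ?_⟩ <;> nlinarith
      have := hsub h
      simp only [toPlane, Set.mem_ofPred_eq] at this
      exact_mod_cast this
    · rintro ⟨h1, h2, h3⟩
      have h1' : (x : ℝ) ≤ s * a + s := by exact_mod_cast h1
      have h2' : (y : ℝ) ≤ s * b + s := by exact_mod_cast h2
      have h3' : (s : ℝ) * a + s * b + s ≤ x + y := by exact_mod_cast h3
      refine comb (toPlane (s • ((a, b) + (1, 0)))) (toPlane (s • ((a, b) + (0, 1))))
        (toPlane (s • ((a, b) + (1, 1)))) _ ((s * b + s - y) / s) ((s * a + s - x) / s)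
        ((x + y - s * a - s * b - s) / s) ⟨_, by simp, rfl⟩ ⟨_, by simp, rfl⟩ ⟨_, by simp, rfl⟩
        (div_nonneg (by linarith) hs'.le) (div_nonneg (by linarith) hs'.le)
        (div_nonneg (by linarith) hs'.le) (by field_simp; ring) ?_
      simp only [toPlane, Prod.smul_mk, Prod.mk_add_mk, nsmul_eq_mul, smul_eq_mul, Prod.mk.injEq]
      constructor <;> (push_cast; field_simp; ring)
  · simp only [Face.vertices, InTri, if_true]
    constructor
    · intro h
      have hsub : convexHull ℝ ((fun v : Node => toPlane (s • v)) '' (({(a, b),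
          (a, b) + (1, 0), (a, b) + (0, 1)} : Finset Node) : Set Node)) ⊆
          {q : ℝ × ℝ | s * a ≤ q.1 ∧ s * b ≤ q.2 ∧ q.1 + q.2 ≤ s * a + s * b + s} := by
        refine convexHull_min ?_ ?_
        · rintro _ ⟨v, hv, rfl⟩
          simp only [Finset.coe_insert, Finset.coe_singleton, Set.mem_insert_iff,
            Set.mem_singleton_iff] at hv
          rcases hv with rfl | rfl | rfl <;> simp [toPlane] <;>
            (try constructor) <;> nlinarith
        · intro p hp q hq c d hc hd hcd
          obtain ⟨p1, p2, p3⟩ := hp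
          obtain ⟨q1, q2, q3⟩ := hq
          obtain rfl : d = 1 - c := by linarith
          simp only [Set.mem_ofPred_eq, Prod.fst_add, Prod.snd_add, Prod.smul_fst, Prod.smul_snd,
            smul_eq_mul]
          refine ⟨?_, ?_, ?_⟩ <;> nlinarith
      have := hsub h
      simp only [toPlane, Set.mem_ofPred_eq] at this
      exact_mod_cast this
    · rintro ⟨h1, h2, h3⟩
      have h1' : (s : ℝ) * a ≤ x := by exact_mod_cast h1
      have h2' : (s : ℝ) * b ≤ y := by exact_mod_cast h2
      have h3' : (x : ℝ) + y ≤ s * a + s * b + s := by exact_mod_cast h3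
      refine comb (toPlane (s • (a, b))) (toPlane (s • ((a, b) + (1, 0))))
        (toPlane (s • ((a, b) + (0, 1)))) _ ((s * a + s * b + s - x - y) / s)
        ((x - s * a) / s) ((y - s * b) / s) ⟨_, by simp, rfl⟩ ⟨_, by simp, rfl⟩ ⟨_, by simp, rfl⟩
        (div_nonneg (by linarith) hs'.le) (div_nonneg (by linarith) hs'.le)
        (div_nonneg (by linarith) hs'.le) (by field_simp; ring) ?_
      simp only [toPlane, Prod.smul_mk, Prod.mk_add_mk, nsmul_eq_mul, smul_eq_mul, Prod.mk.injEq]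
      constructor <;> (push_cast; field_simp; ring)

/-- `V(T(S))` in grid coordinates. -/
lemma Shape.nodes_eq (S : Shape) (T : Transformation) :
    S.nodes T = {p | ∃ m ∈ S.scaled T.scale, p = T.shift + frameMap (T.turns : ZMod 6) true m} := by
  set r : ZMod 6 := (T.turns : ZMod 6)
  let lin : ℝ × ℝ →ₗ[ℝ] ℝ × ℝ :=
    (LinearMap.fst ℝ ℝ ℝ).smulRight (toPlane (dirVec r)) +
      (LinearMap.snd ℝ ℝ ℝ).smulRight (toPlane (dirVec (r + 1)))
  let A : ℝ × ℝ →ᵃ[ℝ] ℝ × ℝ := lin.toAffineMap + AffineMap.const ℝ (ℝ × ℝ) (toPlane T.shift)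
  have hA : ∀ m : Node, A (toPlane m) = toPlane (T.shift + frameMap r true m) := by
    intro m
    change lin (toPlane m) + toPlane T.shift = _
    rw [frameMap, toPlane_add, toPlane_add, toPlane_zsmul, toPlane_zsmul, add_comm]
    rfl
  have hinj : Function.Injective A := by
    intro p q h
    have h' : lin p + toPlane T.shift = lin q + toPlane T.shift := h
    have h'' : p.1 • toPlane (dirVec r) + p.2 • toPlane (dirVec (r + 1)) =
        q.1 • toPlane (dirVec r) + q.2 • toPlane (dirVec (r + 1)) := add_right_cancel h'
    have hdet : ∀ r, (dirVec r).1 * (dirVec (r + 1)).2 - (dirVec r).2 * (dirVec (r + 1)).1 = 1 := by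
      decide
    have hd : ((dirVec r).1 : ℝ) * (dirVec (r + 1)).2 - (dirVec r).2 * (dirVec (r + 1)).1 = 1 := by
      exact_mod_cast hdet r
    simp only [toPlane, Prod.ext_iff, Prod.fst_add, Prod.snd_add, Prod.smul_fst, Prod.smul_snd,
      smul_eq_mul] at h''
    obtain ⟨e1, e2⟩ := h''
    apply Prod.ext
    · linear_combination (dirVec (r + 1)).2 * e1 - (dirVec (r + 1)).1 * e2 - (p.1 - q.1) * hd
    · linear_combination (dirVec r).1 * e2 - (dirVec r).2 * e1 - (p.2 - q.2) * hd
  have himg : ∀ F : Face, (fun v => toPlane (T.apply v)) '' (F.vertices : Set Node) =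
      A '' ((fun v => toPlane (T.scale • v)) '' (F.vertices : Set Node)) := by
    intro F
    rw [Set.image_image]
    congr 1
    funext v
    rw [hA, frameMap_nsmul, Transformation.apply, rot60_iterate]
  ext p
  obtain ⟨m, hm⟩ := (frameMap_bijective r true).2 (p - T.shift)
  have hp : p = T.shift + frameMap r true m := by rw [hm]; abel
  have key : p ∈ S.nodes T ↔ m ∈ S.scaled T.scale := by
    rw [Shape.mem_scaled T.scale_pos]
    simp only [Shape.nodes, Set.mem_ofPred_eq]
    refine exists_congr fun F => and_congr_right fun _ => ?_
    rw [himg, ← AffineMap.image_convexHull, hp, ← hA, hinj.mem_set_image,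
      mem_convexHull_face T.scale_pos]
  rw [key]
  constructor
  · intro h
    exact ⟨m, h, hp⟩
  · rintro ⟨m', h', e⟩
    rw [hp] at e
    rwa [(frameMap_bijective r true).1 (add_left_cancel e)]

lemma isRepresentation_iff (S : Shape) (X : Set Node) :
    S.IsRepresentation X ↔ ∃ (r : ZMod 6) (s : ℕ) (c : Node), 0 < s ∧
      X = {p | ∃ m ∈ S.scaled s, p = c + frameMap r true m} := by
  constructor
  · rintro ⟨T, rfl⟩
    exact ⟨T.turns, T.scale, T.shift, T.scale_pos, S.nodes_eq T⟩
  · rintro ⟨r, s, c, hs, rfl⟩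
    refine ⟨⟨r.val, s, hs, c⟩, ?_⟩
    rw [Shape.nodes_eq]
    simp

lemma mirror_isRepresentation_iff (S : Shape) (X : Set Node) :
    S.mirror.IsRepresentation X ↔ ∃ (r : ZMod 6) (s : ℕ) (c : Node), 0 < s ∧
      X = {p | ∃ m ∈ S.scaled s, p = c + frameMap r false m} := by
  have hsc : ∀ {s : ℕ}, 0 < s → ∀ m : Node, m ∈ S.mirror.scaled s ↔ m.swap ∈ S.scaled s := by
    intro s hs m
    rw [Shape.mem_scaled hs, Shape.mem_scaled hs]
    simp only [Shape.mirror, Finset.mem_image]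
    constructor
    · rintro ⟨_, ⟨F, hF, rfl⟩, h⟩
      refine ⟨F, hF, ?_⟩
      simp only [InTri, Prod.fst_swap, Prod.snd_swap] at h ⊢
      split_ifs at h ⊢ <;> exact ⟨by linarith, by linarith, by linarith⟩
    · rintro ⟨F, hF, h⟩
      refine ⟨_, ⟨F, hF, rfl⟩, ?_⟩
      simp only [InTri, Prod.fst_swap, Prod.snd_swap] at h ⊢
      split_ifs at h ⊢ <;> exact ⟨by linarith, by linarith, by linarith⟩
  have hswap : ∀ (r : ZMod 6) (m : Node), frameMap r true m.swap = frameMap (r + 1) false m := by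
    intro r m
    simp [frameMap, sgn, add_comm]
  rw [isRepresentation_iff]
  constructor
  · rintro ⟨r, s, c, hs, rfl⟩
    refine ⟨r + 1, s, c, hs, ?_⟩
    ext p
    constructor
    · rintro ⟨m, hm, rfl⟩
      exact ⟨m.swap, (hsc hs m).1 hm, by rw [← hswap, Prod.swap_swap]⟩
    · rintro ⟨m, hm, rfl⟩
      exact ⟨m.swap, (hsc hs _).2 (by rwa [Prod.swap_swap]), by rw [← hswap]⟩
  · rintro ⟨r, s, c, hs, rfl⟩
    refine ⟨r - 1, s, c, hs, ?_⟩
    ext p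
    constructor
    · rintro ⟨m, hm, rfl⟩
      exact ⟨m.swap, (hsc hs _).2 (by rwa [Prod.swap_swap]), by rw [hswap, sub_add_cancel]⟩
    · rintro ⟨m, hm, rfl⟩
      exact ⟨m.swap, (hsc hs m).1 hm, by
        rw [← Prod.swap_swap m, hswap, sub_add_cancel, Prod.swap_swap]⟩

end Amoebot

namespace Amoebot

/-! ### Lattices spanned by the special nodes -/

lemma faceAt_next' (v : Node) (g : ZMod 6) : faceAt (v + dirVec (g + 1)) (g + 4) = faceAt v g := by
  have e : g + 4 = g + 2 + 2 := by rw [add_assoc]; rfl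
  have e' : v + dirVec (g + 1) = v + dirVec g + dirVec (g + 2) := by rw [dirVec_add_two]; abel
  rw [e', e, faceAt_next, faceAt_next]

lemma faceAt_back (v : Node) (g : ZMod 6) : faceAt (v + dirVec g) (g + 3) = faceAt v (g + 5) := by
  have := faceAt_next' v (g + 5)
  rwa [add_five_one, add_five_four] at this

lemma gridPt_add (c p : Node) (g : ZMod 6) (i j : ℕ) : gridPt (c + p) g i j = c + gridPt p g i j := by
  simp only [gridPt]; abel

lemma faceAt_congr_add {u v : Node} {g h : ZMod 6} (e : faceAt u g = faceAt v h) (c : Node) :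
    faceAt (c + u) g = faceAt (c + v) h := by
  rw [add_comm c, add_comm c, faceAt_add, faceAt_add, e]

variable {F : Node → ZMod 6 → Prop} {P : Node → Prop}

lemma FaceLike.congr (hF : FaceLike F) {u v : Node} {g h : ZMod 6} (e : faceAt u g = faceAt v h) :
    F u g ↔ F v h := by
  have hv : v ∈ (faceAt u g).vertices := by rw [e, mem_vertices_faceAt]; exact Or.inl rfl
  rw [mem_vertices_faceAt] at hv
  rcases hv with rfl | rfl | rfl
  · rw [faceAt_injective _ e]
  · rw [← faceAt_next u g] at e
    rw [hF u g, faceAt_injective _ e]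
  · rw [← faceAt_next' u g] at e
    rw [hF.next u g, faceAt_injective _ e]

lemma line_nonempty (hF : FaceLike F) {d : ZMod 6} {u w : Node} (h : Line (Edge F) d u w)
    (hu : ∃ g, F u g) : ∃ g, F w g := by
  induction h with
  | refl => exact hu
  | tail _ hs _ =>
    rcases hs with ⟨he, rfl⟩ | ⟨he, rfl⟩
    · rcases hF.edge_symm _ _ he with h | h <;> exact ⟨_, h⟩
    · rcases hF.edge_symm _ _ he with h | h <;> exact ⟨_, h⟩

/-- A nonempty finite set of faces has a special node: the last node on a ray is not surrounded by
faces, so it lies on a boundary line. -/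
lemma Settled.exists_special (h : Settled F P) {v : Node} {g : ZMod 6} (hv : F v g) :
    ∃ p g', P p ∧ F p g' := by
  obtain ⟨u, ⟨x, hx⟩, hu⟩ : ∃ u, (∃ x, F u x) ∧ ¬ ∃ x, F (u + dirVec g) x := by
    by_contra hc
    simp only [not_exists, not_and] at hc
    refine h.not_forall v g fun n => ?_
    induction n with
    | zero => exact ⟨g, by simpa using hv⟩
    | succ n ih =>
      obtain ⟨y, hy⟩ := ih
      have := hc _ ⟨y, hy⟩
      rw [add_assoc, ← succ_nsmul] at this
      exact not_forall_not.1 this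
  by_cases hP : P u
  · exact ⟨u, x, hP, hx⟩
  have hug : ¬ F u g := fun hc => hu ⟨_, (h.faceLike u g).1 hc⟩
  have hflat : Flat (F u) := by
    by_contra hc
    exact hP (h.of_not_flat u hc)
  rcases hflat with hf | hf | ⟨d, hf⟩
  · exact absurd (hf g) hug
  · exact absurd hx (hf x)
  · obtain ⟨w, hw, hl⟩ := h.hit_boundary hf
    obtain ⟨y, hy⟩ := line_nonempty h.faceLike hl ⟨x, hx⟩
    exact ⟨w, y, hw, hy⟩

/-- All faces of the grid inside a triangle spanned by special nodes are present. -/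
lemma GoodCorner.fill (h : Settled F P) {c w m : Node} {g x : ZMod 6} {a : ℕ}
    (hp : GoodCorner F P (c + a • w) g a) (hm : latFace a (faceAt m x) = faceAt w g) :
    F (c + m) x := by
  obtain ⟨i, j, hij, e | ⟨hi, e⟩⟩ := (latFace_eq_faceAt hp.next.1 _ _ _).1 hm
  · rw [h.faceLike.congr (faceAt_congr_add e c), ← gridPt_add]
    exact hp.up h hij
  · rw [h.faceLike.congr (faceAt_congr_add e c), ← gridPt_add]
    exact hp.down h hi hij

/-- A corner of a triangle determines the two others. -/
lemma GoodCorner.of_faceAt_eq (h : Settled F P) {c w w' : Node} {x x' : ZMod 6} {a : ℕ}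
    (hw : GoodCorner F P (c + a • w) x a) (e : faceAt w x = faceAt w' x') :
    GoodCorner F P (c + a • w') x' a := by
  have rot : ∀ w x, GoodCorner F P (c + a • w) x a →
      GoodCorner F P (c + a • (w + dirVec x)) (x + 2) a := by
    intro w x hw
    rw [smul_add, ← add_assoc]
    exact hw.rotate h
  have hv : w' ∈ (faceAt w x).vertices := by rw [e, mem_vertices_faceAt]; exact Or.inl rfl
  rw [mem_vertices_faceAt] at hv
  rcases hv with rfl | rfl | rfl
  · rwa [← faceAt_injective _ e]
  · rw [← faceAt_next w x] at e
    rw [← faceAt_injective _ e]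
    exact rot _ _ hw
  · have h4 : x + 4 = x + 2 + 2 := by rw [add_assoc]; rfl
    have e' : w + dirVec (x + 1) = w + dirVec x + dirVec (x + 2) := by rw [dirVec_add_two]; abel
    rw [← faceAt_next' w x] at e
    rw [← faceAt_injective _ e, e', h4]
    exact rot _ _ (rot _ _ hw)

lemma Settled.back_left (h : Settled F P) {p : Node} {g : ZMod 6} {a : ℕ} (hp : P p)
    (hn : NextAt F P p g a) {i : ℕ} (hi : i < a) (hf : F (p + i • dirVec g) g) : F p g := by
  induction i with
  | zero => simpa using hf
  | succ i ih =>
    refine ih (by omega) ?_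
    have hs := h.straight (hn.2.2.2 _ (by omega) hi)
      (h.hit_back hp fun s hs => hn.2.2.1 s (by omega))
    rw [hs.1, hs.2.1, succ_nsmul, ← add_assoc, ← h.faceLike] at hf
    exact hf

lemma Settled.back_right (h : Settled F P) {p : Node} {g : ZMod 6} {a : ℕ} (hp : P p)
    (hn : NextAt F P p g a) {i : ℕ} (hi : i < a) (hf : F (p + i • dirVec g) (g + 5)) :
    F p (g + 5) := by
  induction i with
  | zero => simpa using hf
  | succ i ih =>
    refine ih (by omega) ?_
    have hs := h.straight (hn.2.2.2 _ (by omega) hi)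
      (h.hit_back hp fun s hs => hn.2.2.1 s (by omega))
    have hx := h.faceLike.next (p + i • dirVec g) (g + 5)
    rw [add_five_one, add_five_four, add_assoc, ← succ_nsmul] at hx
    rwa [hx, hs.2.2.1, hs.2.2.2]

section
variable {c : Node} {a : ℕ} {K : Set Face}

/-- Let `K` be a set of faces of the lattice that is spanned by special nodes, closed under passing
to adjacent faces that are present at a lattice node. Then `K` is closed under passing to adjacent
faces of the grid. -/
lemma Settled.mem_right (h : Settled F P) (ha : 0 < a)
    (h1 : ∀ w g, faceAt w g ∈ K → GoodCorner F P (c + a • w) g a)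
    (h2 : ∀ w g, faceAt w g ∈ K → F (c + a • w) (g + 5) → faceAt w (g + 5) ∈ K) {m : Node}
    {g : ZMod 6} (hm : latFace a (faceAt m g) ∈ K) (hf : F (c + m) (g + 5)) :
    latFace a (faceAt m (g + 5)) ∈ K := by
  by_cases he : latFace a (faceAt m g) = latFace a (faceAt m (g + 5))
  · rwa [← he]
  · obtain ⟨w, i, hi, rfl, e1, e2⟩ := latFace_cross ha m g he
    rw [e1] at hm
    rw [e2]
    have hg := h1 w g hm
    rw [← add_assoc] at hf
    exact h2 w g hm (h.back_right hg.special hg.next hi hf)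

lemma Settled.mem_left (h : Settled F P) (ha : 0 < a)
    (h1 : ∀ w g, faceAt w g ∈ K → GoodCorner F P (c + a • w) g a)
    (h2 : ∀ w g, faceAt w (g + 5) ∈ K → F (c + a • w) g → faceAt w g ∈ K) {m : Node}
    {g : ZMod 6} (hm : latFace a (faceAt m (g + 5)) ∈ K) (hf : F (c + m) g) :
    latFace a (faceAt m g) ∈ K := by
  by_cases he : latFace a (faceAt m g) = latFace a (faceAt m (g + 5))
  · rwa [he]
  · obtain ⟨w, i, hi, rfl, e1, e2⟩ := latFace_cross ha m g he
    rw [e2] at hm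
    rw [e1]
    have hg := h1 w _ hm
    have hn := hg.next_left h
    rw [add_five_one] at hn
    rw [← add_assoc] at hf
    exact h2 w g hm (h.back_left hg.special hn hi hf)

end

/-- The faces of a shape, seen from the nodes of the grid. -/
def Shape.at (S : Shape) (v : Node) (g : ZMod 6) : Prop := faceAt v g ∈ S

lemma Shape.faceLike_at (S : Shape) : FaceLike S.at := fun u g => by
  rw [Shape.at, Shape.at, faceAt_next]

lemma Shape.finite_at (S : Shape) : {u | ∃ g, S.at u g}.Finite := by
  refine (S.biUnion Face.vertices).finite_toSet.subset ?_
  rintro u ⟨g, hg⟩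
  rw [Finset.mem_coe, Finset.mem_biUnion]
  exact ⟨_, hg, (mem_vertices_faceAt _ _ _).2 (Or.inl rfl)⟩

/-- A property of faces that holds for one face of a connected shape and passes to adjacent faces
holds for all faces. -/
lemma Shape.IsConnected.induction {S : Shape} (hS : S.IsConnected) {Q : Face → Prop} {f : Face}
    (hf : f ∈ S) (hQ : Q f)
    (h : ∀ v g, (S.at v g → Q (faceAt v g) → S.at v (g + 5) → Q (faceAt v (g + 5))) ∧
      (S.at v (g + 5) → Q (faceAt v (g + 5)) → S.at v g → Q (faceAt v g))) :
    ∀ f' ∈ S, Q f' := by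
  intro f' hf'
  obtain ⟨p⟩ := hS.preconnected ⟨f, hf⟩ ⟨f', hf'⟩
  have : ∀ {x y : (S : Set Face)}, (dualGrid.induce (S : Set Face)).Walk x y → Q x.1 → Q y.1 := by
    intro x y p
    induction p with
    | nil => exact id
    | @cons x y z hxy p ih =>
      intro hx
      apply ih
      obtain ⟨v, g, ⟨e1, e2⟩ | ⟨e1, e2⟩⟩ := dualGrid_adj (F := x.1) (G := y.1) hxy
      · rw [e2]
        exact (h v g).1 (by rw [Shape.at, ← e1]; exact x.2) (by rwa [← e1])
          (by rw [Shape.at, ← e2]; exact y.2)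
      · rw [e1]
        exact (h v g).2 (by rw [Shape.at, ← e2]; exact x.2) (by rwa [← e2])
          (by rw [Shape.at, ← e1]; exact y.2)
  exact this p hQ

lemma latFace_latFace {a s : ℕ} (hs : 0 < s) (G : Face) :
    latFace a (latFace s G) = latFace (s * a) G := by
  obtain ⟨⟨x, y⟩, u⟩ := G
  have hs' : (0 : ℤ) < s := by exact_mod_cast hs
  have hz : ∀ z : ℤ, z / s / a = z / ((s * a : ℕ) : ℤ) := fun z => by
    push_cast; exact Int.ediv_ediv_of_nonneg hs'.le
  have key : ∀ z : ℤ, z = x + y + (if u then 0 else 1) →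
      x / s + y / s + (if z / s = x / s + y / s then 0 else 1) = z / s := by
    intro z hzz
    have h1 := ediv_spec hs' x
    have h2 := ediv_spec hs' y
    have h3 := ediv_spec hs' z
    have h4 : z = x + y ∨ z = x + y + 1 := by cases u <;> simp at hzz <;> omega
    have h5 : z / s < x / s + y / s + 2 := by
      refine lt_of_mul_lt_mul_left (a := (s : ℤ)) ?_ hs'.le
      rw [mul_add, mul_add]; omega
    have h6 : x / s + y / s < z / s + 1 := by
      refine lt_of_mul_lt_mul_left (a := (s : ℤ)) ?_ hs'.le
      rw [mul_add, mul_add]; omega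
    split_ifs <;> omega
  simp only [latFace, decide_eq_true_eq, key _ rfl, hz]

lemma latFace_shift {s : ℕ} (hs : 0 < s) (m c : Node) (g : ZMod 6) :
    latFace s (faceAt (m + s • c) g) =
      ⟨(latFace s (faceAt m g)).corner + c, (latFace s (faceAt m g)).up⟩ := by
  have hs' : (s : ℤ) ≠ 0 := by exact_mod_cast hs.ne'
  rw [faceAt_add]
  obtain ⟨⟨x, y⟩, u⟩ := faceAt m g
  obtain ⟨a, b⟩ := c
  have e : ∀ z d : ℤ, (z + s * d) / s = z / s + d := fun z d => Int.add_mul_ediv_left z d hs'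
  have e2 : x + s * a + (y + s * b) + (if u then 0 else 1) =
    x + y + (if u then 0 else 1) + s * (a + b) := by ring
  simp only [latFace, Prod.smul_mk, nsmul_eq_mul, Prod.mk_add_mk, e, e2, Face.mk.injEq, true_and]
  congr 1
  rw [eq_iff_iff]
  constructor <;> intro <;> linarith

/-- At the vertices of a connected minimal shape, all nodes are special: otherwise the special nodes
cut the shape into triangles of side length at least two, and the shape that has these triangles
as its faces has the same representations and fewer faces. -/
theorem Shape.special_of_isMinimal {S : Shape} (hconn : S.IsConnected) (hmin : S.IsMinimal)
    (h : Settled S.at P) {v : Node} {g : ZMod 6} (hv : S.at v g) : P v := by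
  obtain ⟨c, g₀, hc, hg₀⟩ := h.exists_special hv
  obtain ⟨a, hna⟩ := h.exists_nextAt hc hg₀
  have ha := hna.1
  let K : Set Face := {G | ∀ w x, G = faceAt w x → GoodCorner S.at P (c + a • w) x a}
  let φ : Face → Face := fun f => latFace a ⟨f.corner - c, f.up⟩
  have hφ : ∀ v x, φ (faceAt v x) = latFace a (faceAt (v - c) x) := by
    intro v x
    simp only [φ, sub_eq_add_neg, faceAt_add]
  have hK : ∀ w x, GoodCorner S.at P (c + a • w) x a → faceAt w x ∈ K :=
    fun w x hw w' x' e => GoodCorner.of_faceAt_eq h hw e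
  have h1 : ∀ w x, faceAt w x ∈ K → GoodCorner S.at P (c + a • w) x a := fun w x hw => hw w x rfl
  have h2 : ∀ w x, faceAt w x ∈ K → S.at (c + a • w) (x + 5) → faceAt w (x + 5) ∈ K :=
    fun w x hw hf => hK _ _ ((h1 w x hw).cross_right h hf)
  have h3 : ∀ w x, faceAt w (x + 5) ∈ K → S.at (c + a • w) x → faceAt w x ∈ K := by
    intro w x hw hf
    have := (h1 w _ hw).cross_left h (by rwa [add_five_one])
    rw [add_five_one] at this
    exact hK _ _ this
  have hall : ∀ f ∈ S, φ f ∈ K := by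
    refine hconn.induction (f := faceAt c g₀) hg₀ ?_ fun v x => ⟨fun _ hq hf => ?_, fun _ hq hf => ?_⟩
    · have hl : latFace a (faceAt 0 g₀) = faceAt 0 g₀ :=
        (latFace_eq_faceAt ha _ _ _).2 ⟨0, 0, by omega, Or.inl (by simp [gridPt])⟩
      rw [hφ, sub_self, hl]
      exact hK _ _ ⟨by simpa using hc, by simpa using hg₀, by simpa using hna⟩
    · rw [hφ] at hq ⊢
      exact h.mem_right ha h1 h2 hq (by rwa [add_sub_cancel])
    · rw [hφ] at hq ⊢
      exact h.mem_left ha h1 h3 hq (by rwa [add_sub_cancel])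
  -- conversely, all faces of the grid inside the triangles belong to the shape
  have hfill : ∀ m x, latFace a (faceAt m x) ∈ K → S.at (c + m) x := by
    intro m x hm
    obtain ⟨w, y, e⟩ := exists_faceAt (latFace a (faceAt m x))
    rw [e] at hm
    exact (h1 w y hm).fill h e
  let S₁ : Shape := S.image φ
  have hS₁ : ∀ m x, latFace a (faceAt m x) ∈ S₁ ↔ S.at (c + m) x := by
    intro m x
    constructor
    · intro hm
      obtain ⟨f, hf, e⟩ := Finset.mem_image.1 hm
      exact hfill m x (e ▸ hall f hf)
    · intro hm
      exact Finset.mem_image.2 ⟨_, hm, by rw [hφ, add_sub_cancel_left]⟩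
  have hscaled : ∀ (s : ℕ), 0 < s → ∀ m, m ∈ S.scaled s ↔ m - s • c ∈ S₁.scaled (s * a) := by
    intro s hs m
    refine exists_congr fun x => ?_
    rw [← latFace_latFace hs]
    obtain ⟨v, y, e⟩ := exists_faceAt (latFace s (faceAt (m - s • c) x))
    have e2 := latFace_shift hs (m - s • c) c x
    rw [sub_add_cancel, e, ← faceAt_add, add_comm] at e2
    rw [e, hS₁, e2, Shape.at]
  have hcard : S.card ≤ S₁.card := by
    refine hmin S₁ fun T => ⟨⟨T.turns, T.scale * a, Nat.mul_pos T.scale_pos ha,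
      T.shift + frameMap T.turns true (T.scale • c)⟩, ?_⟩
    rw [Shape.nodes_eq, Shape.nodes_eq]
    ext p
    constructor
    · rintro ⟨m, hm, rfl⟩
      refine ⟨_, (hscaled _ T.scale_pos m).1 hm, ?_⟩
      simp only [frameMap_sub]; abel
    · rintro ⟨m, hm, rfl⟩
      refine ⟨m + T.scale • c, (hscaled _ T.scale_pos _).2 (by rwa [add_sub_cancel_right]), ?_⟩
      simp only [frameMap_add]; abel
  have hinj : Set.InjOn φ S := Finset.card_image_iff.1 (le_antisymm Finset.card_image_le hcard)
  have ha1 : a = 1 := by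
    by_contra hne
    have up : ∀ i j, i + j < a → S.at (gridPt c g₀ i j) g₀ := fun i j hij =>
      GoodCorner.up ⟨hc, hg₀, hna⟩ h hij
    have hl : ∀ i, i < a → φ (faceAt (gridPt c g₀ i 0) g₀) = faceAt 0 g₀ := by
      intro i hi
      rw [hφ, latFace_eq_faceAt ha]
      refine ⟨i, 0, by omega, Or.inl ?_⟩
      congr 1
      simp only [gridPt]; simp
    have := hinj (up 0 0 (by omega)) (up 1 0 (by omega)) ((hl 0 (by omega)).trans (hl 1 (by omega)).symm)
    have hv : gridPt c g₀ 0 0 = gridPt c g₀ 1 0 := by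
      simp only [faceAt, Face.mk.injEq, add_left_inj, and_true] at this
      exact this
    simp only [gridPt, zero_smul, one_smul, add_zero, left_eq_add] at hv
    exact dirVec_ne_zero _ hv
  subst ha1
  have hmem := hall _ hv
  have hl : latFace 1 (faceAt (v - c) g) = faceAt (v - c) g :=
    (latFace_eq_faceAt ha _ _ _).2 ⟨0, 0, by omega, Or.inl (by simp [gridPt])⟩
  rw [hφ, hl] at hmem
  simpa using (h1 _ _ hmem).special

end Amoebot

namespace Amoebot

/-! ### The special nodes of a set of faces -/

/-- Two different lines through nodes of `P` cross at `u`. -/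
def Cross (E : Node → ZMod 6 → Prop) (P : Node → Prop) (u : Node) : Prop :=
  ∃ g g', g' ≠ g ∧ g' ≠ g + 3 ∧ Hit E P u g ∧ Hit E P u g'

/-- The special nodes found in `i` steps: the nodes that are not flat, and crossings of lines through
special nodes found before. -/
def spec (F : Node → ZMod 6 → Prop) : ℕ → Node → Prop
  | 0, u => ¬ Flat (F u)
  | i + 1, u => spec F i u ∨ Cross (Edge F) (spec F i) u

variable {F : Node → ZMod 6 → Prop} {P : Node → Prop}

lemma spec_mono {i j : ℕ} (h : i ≤ j) {u : Node} (hu : spec F i u) : spec F j u := by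
  induction j with
  | zero => obtain rfl : i = 0 := by omega
            exact hu
  | succ j ih =>
    rcases h.lt_or_eq with h | rfl
    · exact Or.inl (ih (by omega))
    · exact hu

lemma edge_nonempty (hF : FaceLike F) {u : Node} {g : ZMod 6} (h : Edge F u g) :
    (∃ x, F u x) ∧ ∃ x, F (u + dirVec g) x := by
  refine ⟨?_, ?_⟩
  · rcases h with h | h <;> exact ⟨_, h⟩
  · rcases hF.edge_symm _ _ h with h | h <;> exact ⟨_, h⟩

lemma line_eq_or_nonempty {d : ZMod 6} {u w : Node} (h : Line (Edge F) d u w) :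
    u = w ∨ ∃ g, F u g := by
  rcases Relation.ReflTransGen.cases_head h with rfl | ⟨x, hx, -⟩
  · exact Or.inl rfl
  · right
    rcases hx with ⟨h, -⟩ | ⟨h, -⟩ <;> rcases h with h | h <;> exact ⟨_, h⟩

lemma spec_nonempty {i : ℕ} {u : Node} (h : spec F i u) : ∃ g, F u g := by
  induction i with
  | zero =>
    by_contra hc
    push Not at hc
    exact h (Or.inr (Or.inl hc))
  | succ i ih =>
    rcases h with h | ⟨g, g', -, -, ⟨v, hv, hl⟩, -⟩
    · exact ih h
    · rcases line_eq_or_nonempty hl with rfl | h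
      · exact ih hv
      · exact h

lemma settled_spec (hF : FaceLike F) (hfin : {u | ∃ g, F u g}.Finite) {i : ℕ}
    (hc : ∀ u, Cross (Edge F) (spec F i) u → spec F i u) : Settled F (spec F i) :=
  ⟨hF, hfin, fun _ hu => spec_mono (Nat.zero_le i) (show spec F 0 _ from hu),
    fun u g g' h1 h2 h3 h4 => hc u ⟨g, g', h1, h2, h3, h4⟩⟩

/-- All vertices of a connected minimal shape are found in a bounded number of steps. -/
lemma Shape.exists_spec {S : Shape} (hconn : S.IsConnected) (hmin : S.IsMinimal) :
    ∃ i, ∀ v, spec S.at i v ↔ ∃ g, S.at v g := by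
  have hset : Settled S.at fun v => ∃ i, spec S.at i v := by
    refine ⟨S.faceLike_at, S.finite_at, fun u hu => ⟨0, hu⟩, ?_⟩
    rintro u g g' h1 h2 ⟨v, ⟨i, hi⟩, hv⟩ ⟨w, ⟨j, hj⟩, hw⟩
    exact ⟨max i j + 1, Or.inr ⟨g, g', h1, h2, ⟨v, spec_mono (le_max_left i j) hi, hv⟩,
      ⟨w, spec_mono (le_max_right i j) hj, hw⟩⟩⟩
  have hex : ∀ v : {v | ∃ g, S.at v g}, ∃ i, spec S.at i v.1 := fun v =>
    Shape.special_of_isMinimal hconn hmin hset v.2.choose_spec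
  choose f hf using hex
  have : Finite {v | ∃ g, S.at v g} := S.finite_at
  obtain ⟨I, hI⟩ := (Set.finite_range f).bddAbove
  exact ⟨I, fun v => ⟨spec_nonempty, fun hv => spec_mono (hI ⟨⟨v, hv⟩, rfl⟩) (hf ⟨v, hv⟩)⟩⟩

/-! ### Special nodes of a scaled shape -/

section
variable {s : ℕ} (w : Node) (g : ZMod 6) {i j : ℕ}

/-- In the corner of the scaled face `faceAt w g`, with coordinates `i` and `j` along its two sides,
the faces in slots `g` and (in `lat_one` to `lat_five`) `g + 1` to `g + 5` of a node lie in that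
scaled face under the stated bounds on `i` and `j`. -/
lemma lat_zero (h : i + j < s) : latFace s (faceAt (gridPt (s • w) g i j) g) = faceAt w g :=
  (latFace_eq_faceAt (by omega) _ _ _).2 ⟨i, j, h, Or.inl rfl⟩

lemma lat_one (hi : 0 < i) (h : i + j < s) :
    latFace s (faceAt (gridPt (s • w) g i j) (g + 1)) = faceAt w g :=
  (latFace_eq_faceAt (by omega) _ _ _).2 ⟨i, j, h, Or.inr ⟨hi, rfl⟩⟩

lemma lat_two (hi : 0 < i) (h : i + j ≤ s) :
    latFace s (faceAt (gridPt (s • w) g i j) (g + 2)) = faceAt w g := by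
  obtain ⟨i, rfl⟩ : ∃ i', i = i' + 1 := ⟨i - 1, by omega⟩
  rw [← gridPt_succ_left, faceAt_next]
  exact lat_zero w g (by omega)

lemma lat_three (hi : 0 < i) (hj : 0 < j) (h : i + j ≤ s) :
    latFace s (faceAt (gridPt (s • w) g i j) (g + 3)) = faceAt w g := by
  obtain ⟨j, rfl⟩ : ∃ j', j = j' + 1 := ⟨j - 1, by omega⟩
  have e : g + 3 = g + 1 + 2 := by rw [add_assoc]; rfl
  rw [← gridPt_succ_right, e, faceAt_next]
  exact lat_one w g hi (by omega)

lemma lat_four (hj : 0 < j) (h : i + j ≤ s) :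
    latFace s (faceAt (gridPt (s • w) g i j) (g + 4)) = faceAt w g := by
  obtain ⟨j, rfl⟩ : ∃ j', j = j' + 1 := ⟨j - 1, by omega⟩
  rw [← gridPt_succ_right, faceAt_next']
  exact lat_zero w g (by omega)

lemma lat_five (hj : 0 < j) (h : i + j < s) :
    latFace s (faceAt (gridPt (s • w) g i j) (g + 5)) = faceAt w g := by
  obtain ⟨j, rfl⟩ : ∃ j', j = j' + 1 := ⟨j - 1, by omega⟩
  have e : g + 5 = g + 1 + 4 := by rw [add_assoc]; rfl
  have e2 : g + 2 = g + 1 + 1 := by rw [add_assoc]; rfl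
  rw [← gridPt_diag, e, e2, faceAt_next']
  exact lat_one w g (by omega) (by omega)

lemma lat_inner (hi : 0 < i) (hj : 0 < j) (h : i + j < s) (x : ZMod 6) :
    latFace s (faceAt (gridPt (s • w) g i j) x) = faceAt w g := by
  obtain ⟨y, rfl⟩ : ∃ y, x = g + y := ⟨x - g, by abel⟩
  rcases dir_cases y with rfl | rfl | rfl | rfl | rfl | rfl
  · rw [add_zero]; exact lat_zero w g h
  · exact lat_one w g hi h
  · exact lat_two w g hi h.le
  · exact lat_three w g hi hj h.le
  · exact lat_four w g hj h.le
  · exact lat_five w g hj h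

lemma lat_vertex (hs : 0 < s) : latFace s (faceAt (s • w) g) = faceAt w g := by
  have := lat_zero (s := s) w g (i := 0) (j := 0) (by omega)
  simpa [gridPt] using this

/-- The faces on the left side of a lattice edge. -/
lemma lat_left (hi : 0 < i) (h : i < s) {x : ZMod 6} (hx : x = g ∨ x = g + 1 ∨ x = g + 2) :
    latFace s (faceAt (s • w + i • dirVec g) x) = faceAt w g := by
  rw [← gridPt_zero_right]
  rcases hx with rfl | rfl | rfl
  · exact lat_zero w _ (by omega)
  · exact lat_one w g hi (by omega)
  · exact lat_two w g hi (by omega)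

/-- The faces on the right side of a lattice edge. -/
lemma lat_right (hi : 0 < i) (h : i < s) {x : ZMod 6} (hx : x = g + 3 ∨ x = g + 4 ∨ x = g + 5) :
    latFace s (faceAt (s • w + i • dirVec g) x) = faceAt w (g + 5) := by
  have e : s • w + i • dirVec g = gridPt (s • w) (g + 5) 0 i := by
    rw [gridPt_zero_left, add_five_one]
  rw [e]
  rcases hx with rfl | rfl | rfl
  · rw [← add_five_four]; exact lat_four w _ hi (by omega)
  · have e4 : g + 4 = g + 5 + 5 := by rw [add_assoc]; rfl
    rw [e4]; exact lat_five w _ hi (by omega)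
  · exact lat_zero w _ (by omega)

end

/-- Every node of the grid is a lattice node, or lies on one lattice edge or inside of one lattice
face. -/
lemma node_cases {s : ℕ} (hs : 0 < s) (m : Node) : (∃ v, m = s • v) ∨
    (∃ w g i, 0 < i ∧ i < s ∧ m = s • w + i • dirVec g) ∨
    ∃ L, ∀ x, latFace s (faceAt m x) = L := by
  obtain ⟨w, g, e⟩ := exists_faceAt (latFace s (faceAt m 0))
  obtain ⟨i, j, hij, rfl⟩ := (inTri_faceAt w g m).1 ((inTri_iff hs _ m).2 ⟨0, e⟩)
  rcases Nat.eq_zero_or_pos j with rfl | hj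
  · rw [gridPt_zero_right]
    rcases Nat.eq_zero_or_pos i with rfl | hi
    · exact Or.inl ⟨w, by simp⟩
    rcases hij.lt_or_eq with h | rfl
    · exact Or.inr (Or.inl ⟨w, g, i, hi, h, rfl⟩)
    · exact Or.inl ⟨w + dirVec g, by rw [smul_add]; rfl⟩
  rcases Nat.eq_zero_or_pos i with rfl | hi
  · rw [gridPt_zero_left]
    rcases (show j ≤ s by omega).lt_or_eq with h | rfl
    · exact Or.inr (Or.inl ⟨w, g + 1, j, hj, h, rfl⟩)
    · exact Or.inl ⟨w + dirVec (g + 1), by rw [smul_add]⟩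
  rcases hij.lt_or_eq with h | rfl
  · exact Or.inr (Or.inr ⟨_, lat_inner w g hi hj h⟩)
  · refine Or.inr (Or.inl ⟨w + dirVec g, g + 2, j, hj, by omega, ?_⟩)
    rw [gridPt, dirVec_add_two, smul_add, smul_sub, add_smul i j (dirVec g)]; abel

lemma nsmul_node_injective {s : ℕ} (hs : 0 < s) {v w : Node} (h : s • v = s • w) : v = w := by
  have h1 := congrArg Prod.fst h
  have h2 := congrArg Prod.snd h
  simp only [Prod.smul_fst, Prod.smul_snd] at h1 h2
  simp only [nsmul_eq_mul] at h1 h2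
  have hs' : (s : ℤ) ≠ 0 := by exact_mod_cast hs.ne'
  exact Prod.ext (mul_left_cancel₀ hs' h1) (mul_left_cancel₀ hs' h2)

/-- A node inside of a lattice edge is not a lattice node. -/
lemma edge_node_ne {s i : ℕ} (hi : 0 < i) (his : i < s) {v w : Node} {g : ZMod 6}
    (hv : s • w + i • dirVec g = s • v) : False := by
  have hdiv : (s : ℤ) ∣ i := by
    have hd : ∀ g, (dirVec g).1 = 1 ∨ (dirVec g).1 = -1 ∨ (dirVec g).2 = 1 ∨ (dirVec g).2 = -1 := by
      decide
    have e1 := congrArg Prod.fst hv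
    have e2 := congrArg Prod.snd hv
    simp only [Prod.fst_add, Prod.snd_add, Prod.smul_fst, Prod.smul_snd] at e1 e2
    simp only [nsmul_eq_mul] at e1 e2
    rcases hd g with h | h | h | h
    · exact ⟨v.1 - w.1, by rw [h] at e1; linarith⟩
    · exact ⟨w.1 - v.1, by rw [h] at e1; linarith⟩
    · exact ⟨v.2 - w.2, by rw [h] at e2; linarith⟩
    · exact ⟨w.2 - v.2, by rw [h] at e2; linarith⟩
  have := Nat.le_of_dvd hi (by exact_mod_cast hdiv)
  omega

/-- The faces of the grid that lie in the scaled shape. -/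
def Shape.sub (S : Shape) (s : ℕ) (m : Node) (g : ZMod 6) : Prop := latFace s (faceAt m g) ∈ S

/-- The image of a set of nodes under scaling. -/
def scaleSet (s : ℕ) (Q : Node → Prop) (m : Node) : Prop := ∃ v, m = s • v ∧ Q v

section
variable {S : Shape} {s : ℕ}

lemma scaleSet_smul (hs : 0 < s) {Q : Node → Prop} {v : Node} : scaleSet s Q (s • v) ↔ Q v :=
  ⟨fun ⟨_, h, hw⟩ => nsmul_node_injective hs h ▸ hw, fun h => ⟨v, rfl, h⟩⟩

lemma Shape.faceLike_sub (S : Shape) (s : ℕ) : FaceLike (S.sub s) := fun u g => by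
  rw [Shape.sub, Shape.sub, faceAt_next]

lemma Shape.sub_smul (hs : 0 < s) (v : Node) (g : ZMod 6) : S.sub s (s • v) g ↔ S.at v g := by
  rw [Shape.sub, lat_vertex _ _ hs, Shape.at]

lemma Shape.edge_sub {w : Node} {g : ZMod 6} {i : ℕ} (hi : i < s) :
    Edge (S.sub s) (s • w + i • dirVec g) g ↔ Edge S.at w g := by
  rcases Nat.eq_zero_or_pos i with rfl | h0
  · rw [zero_smul, add_zero, Edge, Edge, S.sub_smul hi, S.sub_smul hi]
  · rw [Edge, Edge, Shape.sub, Shape.sub, lat_left w g h0 hi (Or.inl rfl),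
      lat_right w g h0 hi (Or.inr (Or.inr rfl)), Shape.at, Shape.at]

lemma Shape.not_flat_sub (hs : 0 < s) (m : Node) :
    ¬ Flat (S.sub s m) ↔ scaleSet s (fun v => ¬ Flat (S.at v)) m := by
  rcases node_cases hs m with ⟨v, rfl⟩ | ⟨w, g, i, hi, his, rfl⟩ | ⟨L, hL⟩
  · rw [scaleSet_smul hs]
    have : S.sub s (s • v) = S.at v := by funext g; exact propext (S.sub_smul hs v g)
    rw [this]
  · have h1 : ∀ x, (x = g ∨ x = g + 1 ∨ x = g + 2) →
        (S.sub s (s • w + i • dirVec g) x ↔ S.at w g) := fun x hx => by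
      rw [Shape.sub, lat_left w g hi his hx, Shape.at]
    have h2 : ∀ x, (x = g + 3 ∨ x = g + 4 ∨ x = g + 5) →
        (S.sub s (s • w + i • dirVec g) x ↔ S.at w (g + 5)) := fun x hx => by
      rw [Shape.sub, lat_right w g hi his hx, Shape.at]
    have h3 : ∀ g x : ZMod 6, (x = g ∨ x = g + 1 ∨ x = g + 2) ∨
      (x = g + 3 ∨ x = g + 4 ∨ x = g + 5) := by decide
    have h4 : ∀ g x : ZMod 6, (x = g + 3 ∨ x = g + 4 ∨ x = g + 5) →
      ¬ (x = g ∨ x = g + 1 ∨ x = g + 2) := by decide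
    have h5 : ∀ g x : ZMod 6, (x = g + 3 ∨ x = g + 3 + 1 ∨ x = g + 3 + 2) ↔
      (x = g + 3 ∨ x = g + 4 ∨ x = g + 5) := by decide
    refine iff_of_false (not_not.2 ?_) ?_
    · by_cases ha : S.at w g <;> by_cases hb : S.at w (g + 5)
      · refine Or.inl fun x => ?_
        rcases h3 g x with hx | hx
        · exact (h1 x hx).2 ha
        · exact (h2 x hx).2 hb
      · refine Or.inr (Or.inr ⟨g, fun x => ?_⟩)
        rcases h3 g x with hx | hx
        · exact iff_of_true ((h1 x hx).2 ha) hx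
        · exact iff_of_false (fun h => hb ((h2 x hx).1 h)) (h4 g x hx)
      · refine Or.inr (Or.inr ⟨g + 3, fun x => ?_⟩)
        rw [h5]
        rcases h3 g x with hx | hx
        · exact iff_of_false (fun h => ha ((h1 x hx).1 h)) fun h => h4 g x h hx
        · exact iff_of_true ((h2 x hx).2 hb) hx
      · refine Or.inr (Or.inl fun x => ?_)
        rcases h3 g x with hx | hx
        · exact fun h => ha ((h1 x hx).1 h)
        · exact fun h => hb ((h2 x hx).1 h)
    · rintro ⟨v, hv, hc⟩
      exact edge_node_ne hi his hv
  · refine iff_of_false (not_not.2 ?_) ?_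
    · by_cases h : L ∈ S
      · exact Or.inl fun x => by rw [Shape.sub, hL]; exact h
      · exact Or.inr (Or.inl fun x => by rw [Shape.sub, hL]; exact h)
    · rintro ⟨v, rfl, -⟩
      have h0 := hL 0
      have h1 := hL 1
      rw [lat_vertex _ _ hs] at h0 h1
      exact absurd (faceAt_injective v (h0.trans h1.symm)) (by decide)

lemma Shape.line_sub (hs : 0 < s) {g : ZMod 6} {v : Node} {m : Node}
    (h : Line (Edge (S.sub s)) g (s • v) m) :
    ∃ w i, i < s ∧ m = s • w + i • dirVec g ∧ Line (Edge S.at) g v w ∧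
      (0 < i → Edge S.at w g) := by
  induction h with
  | refl => exact ⟨v, 0, hs, by simp, .refl, fun h => by omega⟩
  | tail _ hst ih =>
    obtain ⟨w, i, hi, rfl, hl, he⟩ := ih
    rcases hst with ⟨h, rfl⟩ | ⟨h, rfl⟩
    · rw [Shape.edge_sub hi] at h
      rcases Nat.lt_or_ge (i + 1) s with h' | h'
      · exact ⟨w, i + 1, h', by rw [succ_nsmul, add_assoc], hl, fun _ => h⟩
      · obtain rfl : s = i + 1 := by omega
        exact ⟨w + dirVec g, 0, hs, by rw [zero_smul, add_zero, smul_add, succ_nsmul (dirVec g)]; abel,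
          hl.tail (Or.inl ⟨h, rfl⟩), fun h => by omega⟩
    · cases i with
      | zero =>
        have := Shape.edge_sub (S := S) (w := w) (g := g + 3) hs
        simp only [zero_smul, add_zero] at this h
        rw [this] at h
        have hsymm := S.faceLike_at.edge_symm _ _ h
        rw [add_three_three] at hsymm
        obtain ⟨t, rfl⟩ : ∃ t, s = t + 1 := ⟨s - 1, by omega⟩
        refine ⟨w + dirVec (g + 3), t, by omega, ?_, hl.tail (Or.inr ⟨h, rfl⟩), fun _ => hsymm⟩
        rw [dirVec_add_three, smul_add, zero_smul, smul_neg, succ_nsmul (dirVec g)]; abel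
      | succ i =>
        exact ⟨w, i, by omega, by rw [dirVec_add_three, succ_nsmul]; abel, hl,
          fun _ => he (by omega)⟩

lemma Shape.line_sub_of {g : ZMod 6} {v w : Node} (h : Line (Edge S.at) g v w) :
    Line (Edge (S.sub s)) g (s • v) (s • w) := by
  induction h with
  | refl => exact .refl
  | tail _ hst ih =>
    refine ih.trans ?_
    rcases hst with ⟨h, rfl⟩ | ⟨h, rfl⟩
    · rw [smul_add]
      exact line_ray fun i hi => (Shape.edge_sub hi).2 h
    · change Line _ _ _ _
      rw [smul_add, ← line_add_three]
      exact line_ray fun i hi => (Shape.edge_sub hi).2 h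

lemma Shape.hit_sub (hs : 0 < s) {Q : Node → Prop} {v : Node} {g : ZMod 6} :
    Hit (Edge (S.sub s)) (scaleSet s Q) (s • v) g ↔ Hit (Edge S.at) Q v g := by
  constructor
  · rintro ⟨m, ⟨x, rfl, hx⟩, hl⟩
    obtain ⟨w, i, hi, e, hl', -⟩ := Shape.line_sub hs hl
    rcases Nat.eq_zero_or_pos i with rfl | h0
    · rw [zero_smul, add_zero] at e
      rw [nsmul_node_injective hs e] at hx
      exact ⟨w, hx, hl'⟩
    · exact (edge_node_ne h0 hi e.symm).elim
  · rintro ⟨w, hw, hl⟩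
    exact ⟨_, ⟨w, rfl, hw⟩, Shape.line_sub_of hl⟩

lemma line_eq_add {E : Node → ZMod 6 → Prop} {g : ZMod 6} {u m : Node} (h : Line E g u m) :
    ∃ n : ℤ, m = u + n • dirVec g := by
  induction h with
  | refl => exact ⟨0, by simp⟩
  | tail _ hst ih =>
    obtain ⟨n, rfl⟩ := ih
    rcases hst with ⟨-, rfl⟩ | ⟨-, rfl⟩
    · exact ⟨n + 1, by rw [add_smul, one_smul]; abel⟩
    · exact ⟨n - 1, by rw [sub_smul, one_smul, dirVec_add_three]; abel⟩

/-- Two lattice lines cross at lattice nodes only. -/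
lemma Shape.cross_sub (hs : 0 < s) {Q : Node → Prop} {m : Node} :
    Cross (Edge (S.sub s)) (scaleSet s Q) m ↔ scaleSet s (Cross (Edge S.at) Q) m := by
  constructor
  · intro h
    obtain ⟨g, g', hg, hg', ⟨_, ⟨v, rfl, hv⟩, hl⟩, ⟨_, ⟨v', rfl, hv'⟩, hl'⟩⟩ := h
    obtain ⟨v₀, rfl⟩ : ∃ v₀, m = s • v₀ := by
      obtain ⟨n, e⟩ := line_eq_add hl
      obtain ⟨n', e'⟩ := line_eq_add hl'
      have hdet : ∀ g g' : ZMod 6, g' ≠ g → g' ≠ g + 3 →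
          (dirVec g).1 * (dirVec g').2 - (dirVec g).2 * (dirVec g').1 = 1 ∨
          (dirVec g).1 * (dirVec g').2 - (dirVec g).2 * (dirVec g').1 = -1 := by decide
      have hn : ∃ k : ℤ, n = s * k := by
        simp only [Prod.ext_iff, Prod.fst_add, Prod.snd_add, Prod.smul_fst, Prod.smul_snd] at e e'
        simp only [nsmul_eq_mul, smul_eq_mul] at e e'
        obtain ⟨e1, e2⟩ := e
        obtain ⟨e3, e4⟩ := e'
        rcases hdet g g' hg hg' with hd | hd
        · exact ⟨(v.1 - v'.1) * (dirVec g').2 - (v.2 - v'.2) * (dirVec g').1, by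
            linear_combination (-n) * hd + (dirVec g').1 * (e2 - e4) - (dirVec g').2 * (e1 - e3)⟩
        · exact ⟨-((v.1 - v'.1) * (dirVec g').2 - (v.2 - v'.2) * (dirVec g').1), by
            linear_combination n * hd - (dirVec g').1 * (e2 - e4) + (dirVec g').2 * (e1 - e3)⟩
      obtain ⟨k, rfl⟩ := hn
      refine ⟨v - k • dirVec g, ?_⟩
      rw [smul_sub, e, ← natCast_zsmul (k • dirVec g) s, smul_smul]; abel
    exact ⟨v₀, rfl, g, g', hg, hg', (Shape.hit_sub hs).1 ⟨_, ⟨v, rfl, hv⟩, hl⟩,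
      (Shape.hit_sub hs).1 ⟨_, ⟨v', rfl, hv'⟩, hl'⟩⟩
  · rintro ⟨v, rfl, g, g', hg, hg', h, h'⟩
    exact ⟨g, g', hg, hg', (Shape.hit_sub hs).2 h, (Shape.hit_sub hs).2 h'⟩

lemma Shape.spec_sub (hs : 0 < s) (i : ℕ) : spec (S.sub s) i = scaleSet s (spec S.at i) := by
  induction i with
  | zero => funext m; exact propext (Shape.not_flat_sub hs m)
  | succ i ih =>
    funext m
    simp only [spec, ih]
    rw [Shape.cross_sub hs]
    refine propext ⟨?_, ?_⟩
    · rintro (⟨v, rfl, h⟩ | ⟨v, rfl, h⟩)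
      · exact ⟨v, rfl, Or.inl h⟩
      · exact ⟨v, rfl, Or.inr h⟩
    · rintro ⟨v, rfl, h | h⟩
      · exact Or.inl ⟨v, rfl, h⟩
      · exact Or.inr ⟨v, rfl, h⟩

end

end Amoebot

namespace Amoebot

/-! ### Recognizing the faces of a scaled shape locally -/

/-- The edge `y z` bounds the structure on the side opposite to `x`, and the structure continues
beyond both of its ends: this happens at a tip `x` of a gap between two triangles. -/
def Tip (X : Set Node) (x y z : Node) : Prop := y + z - x ∉ X ∧ y + y - x ∈ X ∧ z + z - x ∈ X

/-- The face `x y z` has its vertices in `X`, and none of them is the tip of a gap. -/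
def Cell (X : Set Node) (x y z : Node) : Prop :=
  (x ∈ X ∧ y ∈ X ∧ z ∈ X) ∧ ¬ Tip X x y z ∧ ¬ Tip X y z x ∧ ¬ Tip X z x y

/-- The cells of `X`, seen from the nodes of the grid. -/
def cellAt (X : Set Node) (u : Node) (g : ZMod 6) : Prop :=
  Cell X u (u + dirVec g) (u + dirVec (g + 1))

lemma tip_swap (X : Set Node) (x y z : Node) : Tip X x z y ↔ Tip X x y z := by
  rw [Tip, Tip, add_comm z y, and_comm (a := z + z - x ∈ X)]

lemma cell_rotate (X : Set Node) (x y z : Node) : Cell X y z x ↔ Cell X x y z := by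
  unfold Cell; tauto

lemma cell_swap (X : Set Node) (x y z : Node) : Cell X x z y ↔ Cell X x y z := by
  unfold Cell
  rw [tip_swap X x y z, tip_swap X y z x, tip_swap X z x y]; tauto

lemma add_two_dirVec (u : Node) (g : ZMod 6) : u + dirVec g + dirVec (g + 2) = u + dirVec (g + 1) := by
  rw [dirVec_add_two]; abel

lemma add_three_dirVec (u : Node) (g : ZMod 6) : u + dirVec g + dirVec (g + 3) = u := by
  rw [dirVec_add_three]; abel

lemma faceLike_cellAt (X : Set Node) : FaceLike (cellAt X) := fun u g => by
  have e : g + 2 + 1 = g + 3 := by rw [add_assoc]; rfl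
  rw [cellAt, cellAt, e, add_two_dirVec, add_three_dirVec]
  exact (cell_rotate _ _ _ _).symm

section
variable {S : Shape} {s : ℕ}

lemma Shape.mem_of_sub {m : Node} {g : ZMod 6} (h : S.sub s m g) :
    m ∈ S.scaled s ∧ m + dirVec g ∈ S.scaled s ∧ m + dirVec (g + 1) ∈ S.scaled s :=
  ⟨⟨g, h⟩, ⟨g + 2, (S.faceLike_sub s m g).1 h⟩, ⟨g + 4, ((S.faceLike_sub s).next m g).1 h⟩⟩

lemma Shape.inner_not_mem {w : Node} {g : ZMod 6} {i j : ℕ} (hL : ¬ S.at w g) (hi : 0 < i)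
    (hj : 0 < j) (h : i + j < s) : gridPt (s • w) g i j ∉ S.scaled s := by
  rintro ⟨x, hx⟩
  rw [lat_inner w g hi hj h] at hx
  exact hL hx

lemma Shape.mem_edge {w : Node} {g : ZMod 6} {i : ℕ} (hi : 0 < i) (h : i < s) :
    s • w + i • dirVec g ∈ S.scaled s ↔ S.at w g ∨ S.at w (g + 5) := by
  constructor
  · rintro ⟨x, hx⟩
    have h3 : ∀ g x : ZMod 6, (x = g ∨ x = g + 1 ∨ x = g + 2) ∨
      (x = g + 3 ∨ x = g + 4 ∨ x = g + 5) := by decide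
    rcases h3 g x with h3 | h3
    · rw [lat_left w g hi h h3] at hx; exact Or.inl hx
    · rw [lat_right w g hi h h3] at hx; exact Or.inr hx
  · rintro (hx | hx)
    · exact ⟨g, by rw [lat_left w g hi h (Or.inl rfl)]; exact hx⟩
    · exact ⟨g + 3, by rw [lat_right w g hi h (Or.inl rfl)]; exact hx⟩

lemma Shape.not_tip (hs : 4 ≤ s) {u : Node} {g : ZMod 6} (h : S.sub s u g) :
    ¬ Tip (S.scaled s) u (u + dirVec g) (u + dirVec (g + 1)) := by
  rintro ⟨h1, h2, h3⟩
  have e5 : g + 2 + 5 = g + 1 := by clear * -; revert g; decide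
  have e1 : g + 1 + 1 = g + 2 := by clear * -; revert g; decide
  have hL : S.sub s (u + dirVec g) (g + 2) := (S.faceLike_sub s u g).1 h
  have hL' : ¬ S.sub s (u + dirVec g) (g + 1) := by
    intro hc
    apply h1
    have := (Shape.mem_of_sub hc).2.1
    rwa [show u + dirVec g + (u + dirVec (g + 1)) - u = u + dirVec g + dirVec (g + 1) by abel]
  obtain ⟨w, i, hi, hy, -, e⟩ := latFace_cross (s := s) (by omega) (u + dirVec g) (g + 2) (by
    intro hc
    rw [e5] at hc
    exact hL' (show latFace s _ ∈ S from hc ▸ hL))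
  rw [e5] at e
  have hw : ¬ S.at w (g + 1) := fun hc => hL' (show latFace s _ ∈ S by rw [e]; exact hc)
  -- of the two nodes beyond the ends of the edge, one lies inside of the missing lattice face
  rcases Nat.lt_or_ge i 2 with h' | h'
  · have := S.inner_not_mem (s := s) hw one_pos (j := i + 1) (by omega) (by omega)
    apply this
    rw [gridPt, e1, succ_nsmul, one_smul]
    have : u + dirVec (g + 1) + (u + dirVec (g + 1)) - u =
        s • w + dirVec (g + 1) + (i • dirVec (g + 2) + dirVec (g + 2)) := by
      rw [← add_two_dirVec, show s • w + dirVec (g + 1) + (i • dirVec (g + 2) + dirVec (g + 2)) =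
        s • w + i • dirVec (g + 2) + dirVec (g + 1) + dirVec (g + 2) by abel, ← hy, dirVec_add_two]
      abel
    rwa [← this]
  · obtain ⟨j, rfl⟩ : ∃ j, i = j + 1 := ⟨i - 1, by omega⟩
    have := S.inner_not_mem (s := s) hw one_pos (j := j) (by omega) (by omega)
    apply this
    rw [gridPt, e1, one_smul]
    have : u + dirVec g + (u + dirVec g) - u =
        s • w + dirVec (g + 1) + j • dirVec (g + 2) := by
      rw [succ_nsmul, ← add_assoc, ← sub_eq_iff_eq_add] at hy
      rw [show s • w + dirVec (g + 1) + j • dirVec (g + 2) =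
        s • w + j • dirVec (g + 2) + dirVec (g + 1) by abel, ← hy, dirVec_add_two]
      abel
    rwa [← this]

lemma Shape.cell_corner (hs : 3 ≤ s) {w : Node} {g : ZMod 6} (hL : ¬ S.at w g)
    (h : cellAt (S.scaled s) (s • w) g) : False := by
  obtain ⟨⟨-, hy, hz⟩, ht, -, -⟩ := h
  have e15 : g + 1 + 5 = g := by clear * -; revert g; decide
  have hy' := (S.mem_edge (s := s) (w := w) (g := g) one_pos (by omega)).1 (by rwa [one_smul])
  have hz' := (S.mem_edge (s := s) (w := w) (g := g + 1) one_pos (by omega)).1 (by rwa [one_smul])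
  rw [e15] at hz'
  refine ht ⟨?_, ?_, ?_⟩
  · have := S.inner_not_mem (s := s) hL one_pos one_pos (by omega)
    rw [gridPt, one_smul, one_smul] at this
    rwa [show s • w + dirVec g + (s • w + dirVec (g + 1)) - s • w =
      s • w + dirVec g + dirVec (g + 1) by abel]
  · have := (S.mem_edge (s := s) (w := w) (g := g) two_pos (by omega)).2 hy'
    rwa [show s • w + dirVec g + (s • w + dirVec g) - s • w = s • w + 2 • dirVec g by
      rw [two_smul]; abel]
  · have := (S.mem_edge (s := s) (w := w) (g := g + 1) two_pos (by omega)).2 (by rwa [e15])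
    rwa [show s • w + dirVec (g + 1) + (s • w + dirVec (g + 1)) - s • w =
      s • w + 2 • dirVec (g + 1) by rw [two_smul]; abel]

/-- In a shape scaled by at least four, the cells are the faces that belong to the scaled shape. -/
lemma Shape.cellAt_scaled (hs : 4 ≤ s) : cellAt (S.scaled s) = S.sub s := by
  funext m g
  refine propext ⟨fun h => ?_, fun h => ?_⟩
  · by_contra hL
    obtain ⟨w, x, e⟩ := exists_faceAt (latFace s (faceAt m g))
    rw [Shape.sub, e] at hL
    obtain ⟨i, j, hij, e' | ⟨hi, e'⟩⟩ := (latFace_eq_faceAt (by omega) _ _ _).1 e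
    · rw [(faceLike_cellAt _).congr e'] at h
      have h0 := h
      obtain ⟨⟨h1, h2, h3⟩, -⟩ := h
      rw [gridPt_succ_left] at h2
      rw [gridPt_succ_right] at h3
      have n1 : i = 0 ∨ j = 0 := by
        by_contra hc
        exact S.inner_not_mem (s := s) hL (by omega) (by omega) hij h1
      have n2 : j = 0 ∨ i + j + 1 = s := by
        by_contra hc
        exact S.inner_not_mem (s := s) hL (by omega) (by omega) (by omega) h2
      have n3 : i = 0 ∨ i + j + 1 = s := by
        by_contra hc
        exact S.inner_not_mem (s := s) hL (by omega) (by omega) (by omega) h3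
      by_cases hi : i = 0
      · subst hi
        by_cases hj : j = 0
        · subst hj
          rw [gridPt_zero_right, zero_smul, add_zero] at h0
          exact S.cell_corner (by omega) hL h0
        · obtain rfl : s = j + 1 := by omega
          rw [(faceLike_cellAt _).next, gridPt_succ_right, gridPt_zero_left, ← smul_add] at h0
          exact S.cell_corner (by omega) (fun hc => hL ((S.faceLike_at.next _ _).2 hc)) h0
      · obtain rfl : j = 0 := by omega
        obtain rfl : s = i + 1 := by omega
        rw [faceLike_cellAt, gridPt_succ_left, gridPt_zero_right, ← smul_add] at h0
        exact S.cell_corner (by omega) (fun hc => hL ((S.faceLike_at _ _).2 hc)) h0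
    · rw [(faceLike_cellAt _).congr e'] at h
      obtain ⟨i, rfl⟩ : ∃ i', i = i' + 1 := ⟨i - 1, by omega⟩
      obtain ⟨⟨h1, h2, h3⟩, -⟩ := h
      have e1 : x + 1 + 1 = x + 2 := by rw [add_assoc]; rfl
      rw [gridPt_succ_right] at h2
      rw [e1, gridPt_diag] at h3
      have n1 : j = 0 := by
        by_contra hc
        exact S.inner_not_mem (s := s) hL (by omega) (by omega) hij h1
      have n2 : i + 1 + (j + 1) = s := by
        by_contra hc
        exact S.inner_not_mem (s := s) hL (by omega) (by omega) (by omega) h2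
      have n3 : i = 0 := by
        by_contra hc
        exact S.inner_not_mem (s := s) hL (by omega) (by omega) (by omega) h3
      omega
  · have e2 : g + 2 + 1 = g + 3 := by rw [add_assoc]; rfl
    have e3 : g + 4 + 1 = g + 5 := by rw [add_assoc]; rfl
    refine ⟨Shape.mem_of_sub h, S.not_tip hs h, ?_, ?_⟩
    · have := S.not_tip hs ((S.faceLike_sub s _ _).1 h)
      rwa [e2, add_two_dirVec, add_three_dirVec] at this
    · have := S.not_tip hs (((S.faceLike_sub s).next _ _).1 h)
      have h4 : dirVec (g + 4) = -dirVec (g + 1) := by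
        rw [← dirVec_add_three, add_assoc]; rfl
      have h5 : dirVec (g + 5) = -dirVec (g + 2) := by
        rw [← dirVec_add_three, add_assoc]; rfl
      rw [e3, h4, h5, dirVec_add_two] at this
      rwa [show m + dirVec (g + 1) + -dirVec (g + 1) = m by abel,
        show m + dirVec (g + 1) + -(dirVec (g + 1) - dirVec g) = m + dirVec g by abel] at this

/-- The ends of an edge are connected by the edge itself or through a common neighbor. -/
def Linked (F : Node → ZMod 6 → Prop) (u : Node) (g : ZMod 6) : Prop :=
  Edge F u g ∨ ∃ t, (t = 1 ∨ t = 5) ∧ Edge F u (g + t) ∧ Edge F (u + dirVec (g + t)) (g - t)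

lemma Shape.linked_gap {m w : Node} {g : ZMod 6} (hs : 2 ≤ s) (h1 : latFace s (faceAt m g) = faceAt w g)
    (h2 : latFace s (faceAt m (g + 5)) = faceAt w g) (hL : ¬ S.at w g) (hm : m ∈ S.scaled s)
    (hn : m + dirVec g ∈ S.scaled s) :
    Edge (S.sub s) m (g + 1) ∧ Edge (S.sub s) (m + dirVec (g + 1)) (g + 5) := by
  have flag : ∀ g, (faceAt 0 g).up ≠ (faceAt 0 (g + 1)).up := by decide
  have e15 : g + 1 + 5 = g := by clear * -; revert g; decide
  have e25 : g + 2 + 3 = g + 5 := by clear * -; revert g; decide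
  obtain ⟨i, j, hij, e | ⟨-, e⟩⟩ := (latFace_eq_faceAt (by omega) _ _ _).1 h1
  swap
  · exact absurd (congrArg Face.up e) (flag g)
  obtain rfl : m = gridPt (s • w) g i j := by
    simp only [faceAt, Face.mk.injEq, add_left_inj, and_true] at e
    exact e
  have hj : 0 < j := by
    by_contra hj
    obtain rfl : j = 0 := by omega
    have : latFace s (faceAt (gridPt (s • w) g i 0) (g + 5)) = faceAt w (g + 5) := by
      rw [gridPt_zero_right]
      rcases Nat.eq_zero_or_pos i with rfl | hi
      · rw [zero_smul, add_zero, lat_vertex _ _ (by omega)]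
      · exact lat_right w g hi (by omega) (Or.inr (Or.inr rfl))
    have h5 : ∀ g : ZMod 6, g + 5 ≠ g := by decide
    exact h5 g (faceAt_injective w (this.symm.trans h2))
  obtain rfl : i = 0 := by
    by_contra hc
    exact S.inner_not_mem (s := s) hL (by omega) hj (by omega) hm
  rw [gridPt_succ_left] at hn
  obtain rfl : s = j + 1 := by
    by_contra hc
    exact S.inner_not_mem (s := s) hL (by omega) hj (by omega) hn
  rw [← gridPt_succ_left] at hn
  constructor
  · rw [gridPt_zero_left] at hm ⊢
    rw [S.mem_edge hj (by omega), e15] at hm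
    refine Or.inl ?_
    rw [Shape.sub, lat_left w _ hj (by omega) (Or.inl rfl)]
    exact hm.resolve_right hL
  · have e : gridPt ((j + 1) • w) g 0 j + dirVec g =
        (j + 1) • (w + dirVec g) + j • dirVec (g + 2) := by
      rw [gridPt, dirVec_add_two, smul_add, smul_sub, succ_nsmul (dirVec g)]; simp; abel
    rw [← add_two_dirVec, ← e25]
    refine (S.faceLike_sub _).edge_symm _ _ (Or.inr ?_)
    rw [e] at hn ⊢
    rw [S.mem_edge hj (by omega)] at hn
    rw [Shape.sub, lat_right _ _ hj (by omega) (Or.inr (Or.inr rfl))]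
    exact hn.resolve_left fun hc => hL ((S.faceLike_at _ _).2 hc)

/-- Neighbors in a scaled shape are linked along the edges of the shape. -/
lemma Shape.linked_sub (hs : 2 ≤ s) {m : Node} {g : ZMod 6} (hm : m ∈ S.scaled s)
    (hn : m + dirVec g ∈ S.scaled s) : Linked (S.sub s) m g := by
  by_cases h1 : S.sub s m g
  · exact Or.inl (Or.inl h1)
  by_cases h2 : S.sub s m (g + 5)
  · exact Or.inl (Or.inr h2)
  have hL : latFace s (faceAt m g) = latFace s (faceAt m (g + 5)) := by
    by_contra hc
    obtain ⟨w, i, hi, rfl, e1, e2⟩ := latFace_cross (by omega) m g hc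
    rw [Shape.sub, e1] at h1
    rw [Shape.sub, e2] at h2
    rcases Nat.eq_zero_or_pos i with rfl | h0
    · rw [zero_smul, add_zero] at hn
      rcases (S.mem_edge (s := s) (w := w) (g := g) one_pos (by omega)).1 (by rwa [one_smul])
        with h | h
      · exact h1 h
      · exact h2 h
    · rcases (S.mem_edge h0 hi).1 hm with h | h
      · exact h1 h
      · exact h2 h
  obtain ⟨w, hw⟩ : ∃ w, latFace s (faceAt m g) = faceAt w g ∨
      latFace s (faceAt m g) = faceAt w (g + 5 + 4) := by
    obtain ⟨v, x, e⟩ := exists_faceAt (latFace s (faceAt m g))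
    have hx : ∀ g x : ZMod 6, x = g ∨ x + 2 = g ∨ x + 4 = g ∨ x = g + 5 + 4 ∨ x + 2 = g + 5 + 4 ∨
      x + 4 = g + 5 + 4 := by decide
    rw [e]
    rcases hx g x with h | h | h | h | h | h
    · exact ⟨v, Or.inl (by rw [h])⟩
    · exact ⟨v + dirVec x, Or.inl (by rw [← h, faceAt_next])⟩
    · exact ⟨v + dirVec (x + 1), Or.inl (by rw [← h, faceAt_next'])⟩
    · exact ⟨v, Or.inr (by rw [h])⟩
    · exact ⟨v + dirVec x, Or.inr (by rw [← h, faceAt_next])⟩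
    · exact ⟨v + dirVec (x + 1), Or.inr (by rw [← h, faceAt_next'])⟩
  right
  rcases hw with hw | hw
  · have := S.linked_gap hs hw (hL.symm.trans hw)
      (fun hc => h1 (show latFace s _ ∈ S by rw [hw]; exact hc)) hm hn
    refine ⟨1, Or.inl rfl, this.1, ?_⟩
    have e : g - 1 = g + 5 := by clear * -; revert g; decide
    rw [e]; exact this.2
  · -- the reversed edge has the missing face on its other side
    rw [add_five_four] at hw
    have e35 : g + 3 + 5 = g + 2 := by clear * -; revert g; decide
    have e31 : g + 3 + 1 = g + 4 := by clear * -; revert g; decide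
    have e23 : g + 2 + 3 = g + 5 := by clear * -; revert g; decide
    have e43 : g + 4 + 3 = g - 5 := by clear * -; revert g; decide
    have hp : m + dirVec g + dirVec (g + 4) = m + dirVec (g + 5) := by
      have h4 : dirVec (g + 4) = -dirVec (g + 1) := by
        rw [← dirVec_add_three, add_assoc]; rfl
      have h5 : dirVec (g + 5) = -dirVec (g + 2) := by
        rw [← dirVec_add_three, add_assoc]; rfl
      rw [h4, h5, dirVec_add_two]; abel
    have := S.linked_gap (m := m + dirVec g) (w := w) (g := g + 3) hs
      (by rw [faceAt_back, ← hL, hw]) (by rw [e35, faceAt_next, hw])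
      (fun hc => h1 (show latFace s _ ∈ S by rw [hw]; exact hc)) hn (by rwa [add_three_dirVec])
    rw [e31, e35, hp] at this
    refine ⟨5, Or.inr rfl, ?_, ?_⟩
    · have := (S.faceLike_sub s).edge_symm _ _ this.2
      rwa [e23, show m + dirVec (g + 5) + dirVec (g + 2) = m by
        rw [← e23, dirVec_add_three]; abel] at this
    · have := (S.faceLike_sub s).edge_symm _ _ this.1
      rwa [hp, e43] at this

end

end Amoebot

namespace Amoebot

/-! ### Invariance under motions of the grid -/

/-- The image of the slot between the directions `g` and `g + 1` under `frameMap r e`. -/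
def slot (r : ZMod 6) (e : Bool) (g : ZMod 6) : ZMod 6 := r + sgn e * g + if e then 0 else 5

lemma slot_surjective (r : ZMod 6) (e : Bool) : Function.Surjective (slot r e) := by
  revert r e; decide

lemma flat_slot (A : ZMod 6 → Prop) (r : ZMod 6) (e : Bool) :
    Flat (fun g => A (slot r e g)) ↔ Flat A := by
  have h1 : ∀ (r : ZMod 6) (e : Bool) (h : ZMod 6), ∃ h', ∀ g,
      (g = h ∨ g = h + 1 ∨ g = h + 2) ↔
        (slot r e g = h' ∨ slot r e g = h' + 1 ∨ slot r e g = h' + 2) := by decide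
  have h2 : ∀ (r : ZMod 6) (e : Bool) (h : ZMod 6), ∃ h', ∀ g,
      (slot r e g = h ∨ slot r e g = h + 1 ∨ slot r e g = h + 2) ↔
        (g = h' ∨ g = h' + 1 ∨ g = h' + 2) := by decide
  constructor
  · rintro (h | h | ⟨x, h⟩)
    · exact Or.inl fun g => by obtain ⟨y, rfl⟩ := slot_surjective r e g; exact h y
    · exact Or.inr (Or.inl fun g => by obtain ⟨y, rfl⟩ := slot_surjective r e g; exact h y)
    · obtain ⟨x', hx⟩ := h1 r e x
      refine Or.inr (Or.inr ⟨x', fun g => ?_⟩)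
      obtain ⟨y, rfl⟩ := slot_surjective r e g
      rw [← hx]; exact h y
  · rintro (h | h | ⟨x, h⟩)
    · exact Or.inl fun g => h _
    · exact Or.inr (Or.inl fun g => h _)
    · obtain ⟨x', hx⟩ := h2 r e x
      exact Or.inr (Or.inr ⟨x', fun g => by rw [← hx]; exact h _⟩)

/-- The motion of the grid that maps the origin to `c` and the standard frame to `(r, e)`. -/
def place (c : Node) (r : ZMod 6) (e : Bool) (m : Node) : Node := c + frameMap r e m

section
variable {c : Node} {r : ZMod 6} {e : Bool}

lemma place_add (m n : Node) : place c r e (m + n) = place c r e m + frameMap r e n := by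
  rw [place, place, frameMap_add, add_assoc]

lemma place_dir (m : Node) (g : ZMod 6) :
    place c r e (m + dirVec g) = place c r e m + dirVec (r + sgn e * g) := by
  rw [place_add, frameMap_dirVec]

lemma place_ray (m : Node) (i : ℕ) (g : ZMod 6) :
    place c r e (m + i • dirVec g) = place c r e m + i • dirVec (r + sgn e * g) := by
  rw [place_add, frameMap_nsmul, frameMap_dirVec]

lemma place_bijective : Function.Bijective (place c r e) :=
  (AddGroup.addLeft_bijective c).comp (frameMap_bijective r e)

lemma frame_surjective (r : ZMod 6) (e : Bool) (x : ZMod 6) : ∃ g, x = r + sgn e * g := by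
  revert r e x; decide

lemma frame_add_three (r : ZMod 6) (e : Bool) (g : ZMod 6) :
    r + sgn e * (g + 3) = r + sgn e * g + 3 := by
  revert r e g; decide

section
variable {F F' E E' : Node → ZMod 6 → Prop} {P P' : Node → Prop}

lemma edge_place (h : ∀ u g, F' (place c r e u) (slot r e g) ↔ F u g) (u : Node) (g : ZMod 6) :
    Edge F' (place c r e u) (r + sgn e * g) ↔ Edge F u g := by
  rw [Edge, Edge, ← h, ← h]
  cases e
  · have e1 : slot r false g = r + sgn false * g + 5 := rfl
    have e2 : slot r false (g + 5) = r + sgn false * g := by clear * -; revert r g; decide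
    rw [e1, e2, or_comm]
  · have e1 : slot r true g = r + sgn true * g := by clear * -; revert r g; decide
    have e2 : slot r true (g + 5) = r + sgn true * g + 5 := by clear * -; revert r g; decide
    rw [e1, e2]

lemma line_place (hE : ∀ u g, E' (place c r e u) (r + sgn e * g) ↔ E u g)
    {g : ZMod 6} {u x : Node} :
    Line E' (r + sgn e * g) (place c r e u) x ↔ ∃ v, x = place c r e v ∧ Line E g u v := by
  constructor
  · intro h
    induction h with
    | refl => exact ⟨u, rfl, .refl⟩
    | tail _ hs ih =>
      obtain ⟨v, rfl, hv⟩ := ih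
      rcases hs with ⟨h, rfl⟩ | ⟨h, rfl⟩
      · exact ⟨v + dirVec g, (place_dir _ _).symm, hv.tail (Or.inl ⟨(hE _ _).1 h, rfl⟩)⟩
      · rw [← frame_add_three] at h ⊢
        exact ⟨v + dirVec (g + 3), (place_dir _ _).symm, hv.tail (Or.inr ⟨(hE _ _).1 h, rfl⟩)⟩
  · rintro ⟨v, rfl, h⟩
    induction h with
    | refl => exact .refl
    | tail _ hs ih =>
      refine ih.tail ?_
      rcases hs with ⟨h, rfl⟩ | ⟨h, rfl⟩
      · exact Or.inl ⟨(hE _ _).2 h, place_dir _ _⟩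
      · refine Or.inr ?_
        rw [← frame_add_three]
        exact ⟨(hE _ _).2 h, place_dir _ _⟩

lemma succ_place (hE : ∀ u g, E' (place c r e u) (r + sgn e * g) ↔ E u g)
    (hP : ∀ u, P' (place c r e u) ↔ P u) {g : ZMod 6} {u x : Node} :
    Succ E' P' (place c r e u) (r + sgn e * g) x ↔ ∃ q, x = place c r e q ∧ Succ E P u g q := by
  constructor
  · rintro ⟨a, ha, rfl, hq, he, hn⟩
    simp only [← place_ray, hE, hP] at hq he hn ⊢
    exact ⟨_, rfl, a, ha, rfl, hq, he, hn⟩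
  · rintro ⟨_, rfl, a, ha, rfl, hq, he, hn⟩
    refine ⟨a, ha, place_ray _ _ _, (hP _).2 hq, ?_⟩
    simp only [← place_ray, hE, hP]
    exact ⟨he, hn⟩

lemma cross_place (hE : ∀ u g, E' (place c r e u) (r + sgn e * g) ↔ E u g)
    (hP : ∀ u, P' (place c r e u) ↔ P u) (u : Node) :
    Cross E' P' (place c r e u) ↔ Cross E P u := by
  have hit : ∀ g, Hit E' P' (place c r e u) (r + sgn e * g) ↔ Hit E P u g := by
    intro g
    constructor
    · rintro ⟨x, hx, hl⟩
      obtain ⟨v, rfl, hv⟩ := (line_place hE).1 hl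
      exact ⟨v, (hP v).1 hx, hv⟩
    · rintro ⟨v, hv, hl⟩
      exact ⟨_, (hP v).2 hv, (line_place hE).2 ⟨v, rfl, hl⟩⟩
  have hne : ∀ (r : ZMod 6) (e : Bool) (g g' : ZMod 6), (r + sgn e * g' ≠ r + sgn e * g ∧
      r + sgn e * g' ≠ r + sgn e * g + 3) ↔ (g' ≠ g ∧ g' ≠ g + 3) := by decide
  constructor
  · rintro ⟨g, g', h1, h2, h3, h4⟩
    obtain ⟨g, rfl⟩ := frame_surjective r e g
    obtain ⟨g', rfl⟩ := frame_surjective r e g'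
    have := (hne r e g g').1 ⟨h1, h2⟩
    exact ⟨g, g', this.1, this.2, (hit g).1 h3, (hit g').1 h4⟩
  · rintro ⟨g, g', h1, h2, h3, h4⟩
    have := (hne r e g g').2 ⟨h1, h2⟩
    exact ⟨_, _, this.1, this.2, (hit g).2 h3, (hit g').2 h4⟩

lemma spec_place (h : ∀ u g, F' (place c r e u) (slot r e g) ↔ F u g) (i : ℕ) (u : Node) :
    spec F' i (place c r e u) ↔ spec F i u := by
  induction i generalizing u with
  | zero =>
    have : (fun g => F' (place c r e u) (slot r e g)) = F u := by funext g; exact propext (h u g)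
    rw [spec, spec, ← this, flat_slot]
  | succ i ih =>
    rw [spec, spec, ih, cross_place (edge_place h) ih]

lemma linked_place (h : ∀ u g, F' (place c r e u) (slot r e g) ↔ F u g) (u : Node) (g : ZMod 6) :
    Linked F' (place c r e u) (r + sgn e * g) ↔ Linked F u g := by
  have ht : ∀ (e : Bool) (t : ZMod 6), (sgn e * t = 1 ∨ sgn e * t = 5) ↔ (t = 1 ∨ t = 5) := by
    decide
  have hs : ∀ t, sgn e * (sgn e * t) = t := by clear * -; revert e; decide
  refine or_congr (edge_place h u g) ?_
  have key : ∀ t, (Edge F' (place c r e u) (r + sgn e * g + sgn e * t) ∧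
      Edge F' (place c r e u + dirVec (r + sgn e * g + sgn e * t)) (r + sgn e * g - sgn e * t)) ↔
      (Edge F u (g + t) ∧ Edge F (u + dirVec (g + t)) (g - t)) := by
    intro t
    rw [add_assoc, ← mul_add, add_sub_assoc, ← mul_sub, ← place_dir, edge_place h, edge_place h]
  constructor
  · rintro ⟨t, h1, h2⟩
    rw [← hs t] at h1 h2
    exact ⟨_, (ht e _).1 h1, (key _).1 h2⟩
  · rintro ⟨t, h1, h2⟩
    exact ⟨_, (ht e _).2 h1, (key _).2 h2⟩

end

/-- A face at `u`, given by a direction and a sense of rotation, is a cell. -/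
def cellIn (X : Set Node) (u : Node) (g : ZMod 6) (e : Bool) : Prop :=
  Cell X u (u + dirVec g) (u + dirVec (g + sgn e))

lemma cellIn_eq (X : Set Node) (u : Node) (r : ZMod 6) (e : Bool) (g : ZMod 6) :
    cellIn X u (r + sgn e * g) e ↔ cellAt X u (slot r e g) := by
  rw [cellIn, cellAt]
  cases e
  · have e1 : r + sgn false * g = slot r false g + 1 := by clear * -; revert r g; decide
    have e2 : slot r false g + 1 + sgn false = slot r false g := by clear * -; revert r g; decide
    rw [e1, e2, cell_swap]
  · have e1 : r + sgn true * g = slot r true g := by clear * -; revert r g; decide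
    rw [e1]; rfl

lemma cellAt_place (X : Set Node) (u : Node) (g : ZMod 6) :
    cellAt X (place c r e u) (slot r e g) ↔ cellAt (place c r e ⁻¹' X) u g := by
  rw [← cellIn_eq, cellIn, cellAt, ← place_dir, add_assoc]
  have : r + (sgn e * g + sgn e) = r + sgn e * (g + 1) := by ring
  rw [this, ← place_dir]
  have h : ∀ x y z, place c r e y + place c r e z - place c r e x = place c r e (y + z - x) := by
    intro x y z
    simp only [place, frameMap_add, frameMap_sub]; abel
  simp only [Cell, Tip, h, Set.mem_preimage]

end

/-! ### Matching a structure with a template -/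

/-- Node `u` plays the role of node `v` of a template, as far as can be seen within `t` steps, in the
frame `(r, e)` at `u`: `u` is in `Q`, its local pattern `D` is the pattern `D₀` of `v`, and
for each edge `E₀` of the template at `v`, what `u` receives along the corresponding line says
that the next node of `Q` plays the role of the next node of the template. -/
def Lab (E : Node → ZMod 6 → Prop) (Q : Node → Prop) (D : Node → ZMod 6 → Bool → Prop)
    (D₀ E₀ : Node → ZMod 6 → Prop) : ℕ → Node → Node → ZMod 6 → Bool → Prop
  | 0, v, u, r, e => Q u ∧ ∀ g, D u (r + sgn e * g) e ↔ D₀ v g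
  | t + 1, v, u, r, e => Lab E Q D D₀ E₀ t v u r e ∧ ∀ h, E₀ v h →
      Recv E Q (fun q x f => Lab E Q D D₀ E₀ t (v + dirVec h) q (x + 3 - sgn f * h) f) u
        (r + sgn e * h) (!e)

/-- The same relation in the standard frame, for structures in which every edge at a node of `Q`
leads to a next node of `Q`. -/
def Match (E : Node → ZMod 6 → Prop) (Q : Node → Prop) (D D₀ E₀ : Node → ZMod 6 → Prop) :
    ℕ → Node → Node → Prop
  | 0, v, u => Q u ∧ ∀ g, D u g ↔ D₀ v g
  | t + 1, v, u => Match E Q D D₀ E₀ t v u ∧ ∀ h, E₀ v h →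
      ∃ q, Succ E Q u h q ∧ Match E Q D D₀ E₀ t (v + dirVec h) q

lemma Match.zero {E : Node → ZMod 6 → Prop} {Q : Node → Prop} {D D₀ E₀ : Node → ZMod 6 → Prop}
    {t : ℕ} {v u : Node} (h : Match E Q D D₀ E₀ t v u) : Match E Q D D₀ E₀ 0 v u := by
  induction t with
  | zero => exact h
  | succ t ih => exact ih h.1

lemma lab_place {c : Node} {r : ZMod 6} {e : Bool} {E E' : Node → ZMod 6 → Prop}
    {Q Q' : Node → Prop} {D : Node → ZMod 6 → Prop} {D' : Node → ZMod 6 → Bool → Prop}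
    (D₀ E₀ : Node → ZMod 6 → Prop)
    (hE : ∀ u g, E' (place c r e u) (r + sgn e * g) ↔ E u g)
    (hQ : ∀ u, Q' (place c r e u) ↔ Q u)
    (hD : ∀ u g, D' (place c r e u) (r + sgn e * g) e ↔ D u g)
    (hs : ∀ u g, Q u → E u g → ∃ q, Succ E Q u g q) (t : ℕ) (v u : Node) :
    Lab E' Q' D' D₀ E₀ t v (place c r e u) r e ↔ Match E Q D D₀ E₀ t v u := by
  induction t generalizing v u with
  | zero => simp only [Lab, Match, hQ, hD]
  | succ t ih =>
    have h6 : ∀ h, r + sgn e * h + 3 + 3 - sgn e * h = r := by intro h; clear * -; revert r e h; decide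
    rw [Lab, Match, ih]
    refine and_congr_right fun hm => forall_congr' fun h => imp_congr_right fun _ => ?_
    have hQu := hm.zero.1
    simp only [Recv, hQ, hE, hQu, true_and, succ_place hE hQ, Bool.not_not, h6]
    constructor
    · rintro ⟨hEu, ⟨_, ⟨q, rfl, hq⟩, hl⟩ | ⟨hn, -⟩⟩
      · exact ⟨q, hq, (ih _ _).1 hl⟩
      · obtain ⟨q, hq⟩ := hs u h hQu hEu
        exact absurd ⟨_, q, rfl, hq⟩ hn
    · rintro ⟨q, hq, hl⟩
      obtain ⟨a, ha, -, -, he, -⟩ := id hq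
      have := he 0 ha
      rw [zero_smul, add_zero] at this
      exact ⟨this, Or.inl ⟨_, ⟨q, rfl, hq⟩, (ih _ _).2 hl⟩⟩

end Amoebot

namespace Amoebot

/-! ### The predicates of the algorithm are known to the amoebots -/

section
variable {k : ℕ}

lemma mem_of_edge_cellAt {X : Set Node} {u : Node} {g : ZMod 6} (h : Edge (cellAt X) u g) :
    u ∈ X ∧ u + dirVec g ∈ X := by
  rcases h with ⟨h, -⟩ | ⟨h, -⟩
  · exact ⟨h.1, h.2.1⟩
  · rw [add_five_one] at h
    exact ⟨h.1, h.2.2⟩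

lemma isEdge_cellAt : IsEdge fun X => Edge (cellAt X) := fun X u g h =>
  ⟨(mem_of_edge_cellAt h).1, (mem_of_edge_cellAt h).2, (faceLike_cellAt X).edge_symm u g h⟩

lemma isEdge_bond : IsEdge fun X u g => u ∈ X ∧ u + dirVec g ∈ X := fun X u g h =>
  ⟨h.1, h.2, h.2, by rw [add_three_dirVec]; exact h.1⟩

lemma mem_of_spec {X : Set Node} {i : ℕ} {u : Node} (h : spec (cellAt X) i u) : u ∈ X := by
  obtain ⟨g, hg⟩ := spec_nonempty h
  exact hg.1.1

lemma mem_and_spec (X : Set Node) (i : ℕ) :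
    (fun v => v ∈ X ∧ spec (cellAt X) i v) = spec (cellAt X) i := by
  funext v
  exact propext ⟨fun h => h.2, fun h => ⟨mem_of_spec h, h⟩⟩

namespace Known

lemma cellIn (hk : 2 ≤ k) : Known k Amoebot.cellIn := by
  have nb : ∀ j : ZMod 6, Known k fun X u g e => u + dirVec g ∈ X ∧
      u + dirVec g + dirVec (g + 3 + sgn (!e) * j) ∈ X := fun j =>
    nbr hk ((bond (k := k)).turn j)
  have c0 := bond (k := k)
  have c1 := (bond (k := k)).turn 1
  have t1 := ((nb 2).not.and (nb 3)).and ((nb 3).turn 1)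
  have t2 := (((bond (k := k)).turn 2).not.and ((nb 2).turn 1)).and ((bond (k := k)).turn 3)
  have t3 := (((bond (k := k)).turn (-1)).not.and ((bond (k := k)).turn 4)).and (nb 4)
  refine ((c0.and c1).and (t1.not.and (t2.not.and t3.not))).congr fun X u g e hu => ?_
  simp only [Amoebot.cellIn, Cell, Tip, hu, true_and, mul_one]
  have d1 : dirVec (g + sgn e) - dirVec g = dirVec (g + sgn e * 2) := by
    clear * -; revert g e; decide
  have d2 : dirVec g - dirVec (g + sgn e) = dirVec (g + sgn e * (-1)) := by
    clear * -; revert g e; decide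
  have d3 : dirVec (g + sgn e * 3) = -dirVec g := by clear * -; revert g e; decide
  have d4 : dirVec (g + sgn e * 4) = -dirVec (g + sgn e) := by clear * -; revert g e; decide
  have n1 : dirVec (g + 3 + sgn (!e) * 2) = dirVec (g + sgn e) := by
    clear * -; revert g e; decide
  have n2 : dirVec (g + 3 + sgn (!e) * 3) = dirVec g := by clear * -; revert g e; decide
  have n3 : dirVec (g + sgn e + 3 + sgn (!e) * 3) = dirVec (g + sgn e) := by
    clear * -; revert g e; decide
  have n4 : dirVec (g + sgn e + 3 + sgn (!e) * 2) = dirVec (g + sgn e) - dirVec g := by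
    clear * -; revert g e; decide
  have n5 : dirVec (g + 3 + sgn (!e) * 4) = dirVec g - dirVec (g + sgn e) := by
    clear * -; revert g e; decide
  rw [← d1, ← d2, d3, d4, n1, n2, n3, n4, n5]
  have a1 : u + dirVec g + (u + dirVec (g + sgn e)) - u = u + dirVec g + dirVec (g + sgn e) := by
    abel
  have a2 : u + dirVec g + (u + dirVec g) - u = u + dirVec g + dirVec g := by abel
  have a3 : u + dirVec (g + sgn e) + (u + dirVec (g + sgn e)) - u =
    u + dirVec (g + sgn e) + dirVec (g + sgn e) := by abel
  have a4 : u + dirVec (g + sgn e) + u - (u + dirVec g) = u + (dirVec (g + sgn e) - dirVec g) := by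
    abel
  have a5 : u + dirVec (g + sgn e) + (u + dirVec (g + sgn e)) - (u + dirVec g) =
    u + dirVec (g + sgn e) + (dirVec (g + sgn e) - dirVec g) := by abel
  have a6 : u + u - (u + dirVec g) = u + -dirVec g := by abel
  have a7 : u + (u + dirVec g) - (u + dirVec (g + sgn e)) = u + (dirVec g - dirVec (g + sgn e)) := by
    abel
  have a8 : u + u - (u + dirVec (g + sgn e)) = u + -dirVec (g + sgn e) := by abel
  have a9 : u + dirVec g + (u + dirVec g) - (u + dirVec (g + sgn e)) =
    u + dirVec g + (dirVec g - dirVec (g + sgn e)) := by abel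
  rw [a1, a2, a3, a4, a5, a6, a7, a8, a9]
  refine and_congr_right fun hyz => ?_
  simp only [hyz.1, hyz.2, true_and, and_assoc]

lemma edge (hk : 2 ≤ k) : Known k fun X u g _ => Edge (cellAt X) u g := by
  refine ((cellIn hk).or (cellIn hk).flip).congr fun X u g e _ => ?_
  have h := cellIn_eq X u g true 0
  have h' := cellIn_eq X u g false 0
  have e1 : slot g true 0 = g := by clear * -; revert g; decide
  have e2 : slot g false 0 = g + 5 := by clear * -; revert g; decide
  rw [mul_zero, add_zero, e1] at h
  rw [mul_zero, add_zero, e2] at h'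
  cases e <;> simp only [Edge, Bool.not_true, Bool.not_false, h, h']
  exact or_comm

lemma flat (hk : 2 ≤ k) : Known k fun X u _ _ => Flat (cellAt X u) := by
  have h : Known k fun X u g e => Flat fun m => Amoebot.cellIn X u (g + sgn e * m) e :=
    (Knowable.map (fun (f : ZMod 6 → Bool → Prop) (l : ZMod 6) (e : Bool) =>
      Flat fun m => f (l + sgn e * m) e) (cellIn hk)).congr fun X u => by
        funext l e
        simp only [System.globalDir_add]
  exact h.congr fun X u g e _ => by
    simp only [cellIn_eq]
    rw [flat_slot]

lemma cross (hk : 2 ≤ k) {P : Set Node → Node → Prop} (kP : Known k fun X u _ _ => P X u) :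
    Known k fun X u _ _ => Cross (Edge (cellAt X)) (fun v => v ∈ X ∧ P X v) u := by
  have hh := hit (by omega) isEdge_cellAt (edge hk) kP
  refine (exist fun m : ZMod 6 => (const (m ≠ 0 ∧ m ≠ 3)).and
    (hh.and (hh.turn m))).exists_dir.congr fun X u g e _ => ?_
  have hm : ∀ (g m : ZMod 6) (e : Bool), (m ≠ 0 ∧ m ≠ 3) ↔ (g + sgn e * m ≠ g ∧
    g + sgn e * m ≠ g + 3) := by decide
  constructor
  · rintro ⟨g, g', h1, h2, h3, h4⟩
    obtain ⟨m, rfl⟩ := frame_surjective g e g'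
    exact ⟨g, m, (hm g m e).2 ⟨h1, h2⟩, h3, h4⟩
  · rintro ⟨g, m, h1, h3, h4⟩
    have := (hm g m e).1 h1
    exact ⟨g, _, this.1, this.2, h3, h4⟩

lemma spec (hk : 2 ≤ k) (i : ℕ) : Known k fun X u _ _ => Amoebot.spec (cellAt X) i u := by
  induction i with
  | zero => exact (flat hk).not
  | succ i ih =>
    refine (ih.or (cross hk ih)).congr fun X u g e _ => ?_
    rw [mem_and_spec]; rfl

lemma linked (hk : 2 ≤ k) : Known k fun X u g _ => Linked (cellAt X) u g := by
  have ht : ∀ t : ZMod 6, Known k fun X u g e => (t = 1 ∨ t = 5) ∧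
      (Edge (cellAt X) u (g + sgn e * t) ∧ u + dirVec (g + sgn e * t) ∈ X ∧
        Edge (cellAt X) (u + dirVec (g + sgn e * t))
          (g + sgn e * t + 3 + sgn (!e) * (3 + 2 * t))) := fun t =>
    (const _).and (((edge hk).turn t).and ((nbr hk ((edge hk).turn (3 + 2 * t))).turn t))
  refine ((edge hk).or (exist ht)).congr fun X u g e _ => or_congr_right ?_
  have h1 : ∀ (e : Bool) (t : ZMod 6), (sgn e * t = 1 ∨ sgn e * t = 5) ↔ (t = 1 ∨ t = 5) := by
    decide
  have h2 : ∀ (e : Bool) (g t : ZMod 6), g + sgn e * t + 3 + sgn (!e) * (3 + 2 * t) =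
    g - sgn e * t := by decide
  simp only [h2]
  constructor
  · rintro ⟨t, h3, h4, h5⟩
    obtain ⟨t, rfl⟩ := frame_surjective 0 e t
    rw [zero_add] at h3 h4 h5
    exact ⟨t, (h1 e t).1 h3, h4, (mem_of_edge_cellAt h4).2, h5⟩
  · rintro ⟨t, h3, h4, -, h5⟩
    exact ⟨sgn e * t, (h1 e t).2 h3, h4, h5⟩

lemma lab (hk : 2 ≤ k) {E : Set Node → Node → ZMod 6 → Prop} (hE : IsEdge E)
    {Q : Set Node → Node → Prop} {D : Set Node → Node → ZMod 6 → Bool → Prop}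
    (kE : Known k fun X u g _ => E X u g) (kQ : Known k fun X u _ _ => Q X u) (kD : Known k D)
    (D₀ E₀ : Node → ZMod 6 → Prop) (t : ℕ) (v : Node) :
    Known k fun X u r e => Lab (E X) (fun v => v ∈ X ∧ Q X v) (D X) D₀ E₀ t v u r e := by
  induction t generalizing v with
  | zero =>
    refine (kQ.and (all fun g => (kD.turn g).iff (const (D₀ v g)))).congr fun X u r e hu => ?_
    simp only [Lab, hu, true_and]
  | succ t ih =>
    have hr : ∀ h : ZMod 6, Known k fun X u r e => E₀ v h → Recv (E X) (fun v => v ∈ X ∧ Q X v)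
        (fun q x f => Lab (E X) (fun v => v ∈ X ∧ Q X v) (D X) D₀ E₀ t (v + dirVec h) q
          (x + 3 - sgn f * h) f) u (r + sgn e * h) (!e) := by
      intro h
      refine (const _).imp ((recv hk hE kE kQ ?_).flip.turn h)
      refine ((ih (v + dirVec h)).turn (3 - h)).congr fun X u r e _ => ?_
      have : r + 3 - sgn e * h = r + sgn e * (3 - h) := by clear * -; revert r e h; decide
      rw [this]
    exact ((ih v).and (all hr)).congr fun X u r e _ => Iff.rfl

end Known

/-- The special nodes found in `i` steps are closed under crossings of lines through special nodes,
and neighbors in `X` are linked along edges of cells. -/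
def Regular (i : ℕ) (X : Set Node) : Prop :=
  ∀ u ∈ X, (Cross (Edge (cellAt X)) (spec (cellAt X) i) u → spec (cellAt X) i u) ∧
    ∀ g, u + dirVec g ∈ X → Linked (cellAt X) u g

lemma known_regular (hk : 2 ≤ k) (i : ℕ) : Known k fun X _ _ _ => Regular i X := by
  have h : Known k fun X u _ _ => (Cross (Edge (cellAt X)) (spec (cellAt X) i) u →
      spec (cellAt X) i u) ∧ ∀ g, u + dirVec g ∈ X → Linked (cellAt X) u g := by
    refine (((Known.cross hk (Known.spec hk i)).imp (Known.spec hk i)).and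
      ((Known.bond.imp (Known.linked hk)).all_dir)).congr fun X u g e _ => ?_
    rw [mem_and_spec]
  have h' := Knowable.exists_bot (by omega) (Knowable.map (fun f : ZMod 6 → Bool → Prop =>
    ¬ f 0 true) h)
  refine (h'.map fun p (_ : ZMod 6) (_ : Bool) => ¬ p).congr fun X u => ?_
  funext l e
  simp only [Regular, not_exists, not_not]
  exact propext ⟨fun H v => H _ v.2, fun H v hv => H ⟨v, hv⟩⟩

end
end Amoebot

namespace Amoebot

/-! ### Soundness and completeness of the matching -/

/-- Propagation along a connected relation on a finite type takes a bounded number of steps. -/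
lemma exists_levels {α : Type*} [Finite α] (R : α → α → Prop)
    (h : ∀ a b, Relation.ReflTransGen R a b) : ∃ T : ℕ, ∀ Q : ℕ → α → Prop,
      (∀ t a, Q (t + 1) a → Q t a) → (∀ t a b, R a b → Q (t + 1) a → Q t b) →
        ∀ a b, Q T a → Q 0 b := by
  have one : ∀ a b, ∃ T : ℕ, ∀ Q : ℕ → α → Prop, (∀ t a, Q (t + 1) a → Q t a) →
      (∀ t a b, R a b → Q (t + 1) a → Q t b) → Q T a → Q 0 b := by
    intro a b
    induction h a b with
    | refl => exact ⟨0, fun Q _ _ h => h⟩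
    | tail _ hr ih =>
      obtain ⟨T, hT⟩ := ih
      exact ⟨T + 1, fun Q h1 h2 h3 => h2 0 _ _ hr (hT (fun t => Q (t + 1)) (fun t => h1 (t + 1))
        (fun t => h2 (t + 1)) h3)⟩
  choose f hf using one
  obtain ⟨T, hT⟩ := (Set.finite_range fun p : α × α => f p.1 p.2).bddAbove
  refine ⟨T, fun Q h1 h2 a b h3 => hf a b Q h1 h2 ?_⟩
  have mono : ∀ {i j : ℕ}, i ≤ j → Q j a → Q i a := by
    intro i j hij
    induction hij with
    | refl => exact id
    | step _ ih => exact fun h => ih (h1 _ _ h)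
  exact mono (hT ⟨(a, b), rfl⟩) h3

/-- A set of nodes is connected in the grid, stated as a principle of propagation. -/
def Chained (X : Set Node) : Prop :=
  ∀ N : Set Node, (∃ u ∈ X, u ∈ N) → (∀ u ∈ X, u ∈ N → ∀ g, u + dirVec g ∈ X → u + dirVec g ∈ N) →
    X ⊆ N

lemma System.chained (X : System) : Chained (X.occupied : Set Node) := by
  rintro N ⟨u, hu, huN⟩ hN v hv
  obtain ⟨p⟩ := X.connected.preconnected ⟨u, hu⟩ ⟨v, hv⟩
  have : ∀ {x y : ((X.occupied : Set Node) : Set Node)},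
      (triGrid.induce (X.occupied : Set Node)).Walk x y → x.1 ∈ N → y.1 ∈ N := by
    intro x y p
    induction p with
    | nil => exact id
    | @cons x y z hxy p ih =>
      intro hx
      obtain ⟨g, hg⟩ : ∃ g, y.1 = x.1 + dirVec g := hxy
      exact ih (hg ▸ hN _ x.2 hx g (hg ▸ y.2))
  exact this p huN

section
variable {c : Node} {r : ZMod 6} {e : Bool}

lemma Chained.place {X : Set Node} (h : Chained X) : Chained (place c r e ⁻¹' X) := by
  rintro N ⟨u, hu, huN⟩ hN v hv
  have := h (Amoebot.place c r e '' N) ⟨_, hu, u, huN, rfl⟩ ?_ hv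
  · obtain ⟨w, hw, e⟩ := this
    rwa [← place_bijective.1 e]
  · rintro _ hx ⟨w, hw, rfl⟩ g hg
    obtain ⟨g, rfl⟩ := frame_surjective r e g
    rw [← place_dir] at hg ⊢
    exact ⟨_, hN w hx hw g hg, rfl⟩

lemma eq_image_place_iff {X A : Set Node} :
    X = {p | ∃ m ∈ A, p = c + frameMap r e m} ↔ place c r e ⁻¹' X = A := by
  constructor
  · rintro rfl
    ext m
    constructor
    · rintro ⟨m', h, e⟩
      rwa [place_bijective.1 (show place c r _ m = place c r _ m' from e)]
    · exact fun h => ⟨m, h, rfl⟩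
  · rintro rfl
    ext p
    constructor
    · intro hp
      obtain ⟨m, rfl⟩ := (place_bijective (c := c) (r := r) (e := e)).2 p
      exact ⟨m, hp, rfl⟩
    · rintro ⟨m, hm, rfl⟩
      exact hm

end

section
variable {S : Shape} {F : Node → ZMod 6 → Prop} {P : Node → Prop}

/-- A match of a vertex of a connected shape extends to all faces: the special nodes span a scaled
copy of the shape. -/
lemma Shape.IsConnected.exists_match (hS : S.IsConnected) : ∃ T, ∀ {F P v g p}, Settled F P →
    S.at v g → Match (Edge F) P F S.at (Edge S.at) T v p → ∃ (c : Node) (a : ℕ), 0 < a ∧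
      ∀ w x, S.at w x → GoodCorner F P (c + a • w) x a ∧ ∀ y, F (c + a • w) y ↔ S.at w y := by
  have hpre : ∀ f f' : (S : Set Face),
      Relation.ReflTransGen (fun a b : (S : Set Face) => dualGrid.Adj a.1 b.1) f f' := fun f f' =>
    (SimpleGraph.reachable_iff_reflTransGen _ _).1 (hS.preconnected f f')
  have : Finite (S : Set Face) := S.finite_toSet
  obtain ⟨T, hT⟩ := exists_levels _ hpre
  refine ⟨T + 1, fun {F P v g p} h hv hm => ?_⟩
  have hp := hm.zero
  have hpg : F p g := (hp.2 g).2 hv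
  obtain ⟨a, ha⟩ := h.exists_nextAt hp.1 hpg
  let c : Node := p - a • v
  have hc : c + a • v = p := sub_add_cancel _ _
  let M : ℕ → Node → Node → Prop := Match (Edge F) P F S.at (Edge S.at)
  -- the next special nodes around a matched corner are matched
  have spread : ∀ t w x, S.at w x → GoodCorner F P (c + a • w) x a → M (t + 1) w (c + a • w) →
      ∀ w' x', faceAt w x = faceAt w' x' →
        GoodCorner F P (c + a • w') x' a ∧ M t w' (c + a • w') := by
    intro t w x hw hg hM w' x' e
    refine ⟨GoodCorner.of_faceAt_eq h hg e, ?_⟩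
    have nb : ∀ y, Edge S.at w y → NextAt F P (c + a • w) y a →
        M t (w + dirVec y) (c + a • (w + dirVec y)) := by
      intro y hy hn
      obtain ⟨q, hq, hqM⟩ := hM.2 y hy
      rw [smul_add, ← add_assoc, ← hq.unique hn.succ]
      exact hqM
    have hv : w' ∈ (faceAt w x).vertices := by rw [e, mem_vertices_faceAt]; exact Or.inl rfl
    rw [mem_vertices_faceAt] at hv
    have e15 : x + 1 + 5 = x := by clear * -; revert x; decide
    rcases hv with rfl | rfl | rfl
    · exact hM.1
    · exact nb x (Or.inl hw) hg.next
    · exact nb (x + 1) (Or.inr (by rwa [e15])) (hg.next_left h)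
  have all := hT (fun t f => ∀ w x, f.1 = faceAt w x →
    GoodCorner F P (c + a • w) x a ∧ M t w (c + a • w))
    (fun t f hf w x e => ⟨(hf w x e).1, (hf w x e).2.1⟩) ?_ ⟨faceAt v g, hv⟩
  · refine ⟨c, a, ha.1, fun w x hw => ?_⟩
    have := all ⟨_, hw⟩ (spread T v g hv ⟨by rw [hc]; exact hp.1, by rwa [hc], by rwa [hc]⟩ (by rwa [hc])) w x rfl
    exact ⟨this.1, this.2.2⟩
  · rintro t f f' hadj hf
    obtain ⟨w, x, ⟨e1, e2⟩ | ⟨e1, e2⟩⟩ := dualGrid_adj hadj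
    · obtain ⟨hg, hM⟩ := hf w x e1
      have hx : S.at w (x + 5) := by rw [Shape.at, ← e2]; exact f'.2
      rw [e2]
      exact spread t w _ hx (hg.cross_right h ((hM.zero.2 _).2 hx)) hM
    · obtain ⟨hg, hM⟩ := hf w _ e2
      have hx : S.at w x := by rw [Shape.at, ← e1]; exact f'.2
      rw [e1]
      have := hg.cross_left h (by rw [add_five_one]; exact (hM.zero.2 _).2 hx)
      rw [add_five_one] at this
      exact spread t w _ hx this hM

/-- The faces around a flat node are connected around the node. -/
lemma Flat.propagate {A Q : ZMod 6 → Prop} (hA : Flat A) (hr : ∀ g, Q g → A (g + 5) → Q (g + 5))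
    (hl : ∀ g, Q (g + 5) → A g → Q g) {x : ZMod 6} (hx : Q x) (hxA : A x) {g : ZMod 6}
    (hg : A g) : Q g := by
  have e15 : ∀ d : ZMod 6, d + 1 + 5 = d := by decide
  have e25 : ∀ d : ZMod 6, d + 2 + 5 = d + 1 := by decide
  rcases hA with h | h | ⟨d, h⟩
  · have step : ∀ y, Q y → Q (y + 5) := fun y hy => hr y hy (h _)
    have hall : ∀ x g : ZMod 6, g = x ∨ g = x + 5 ∨ g = x + 5 + 5 ∨ g = x + 5 + 5 + 5 ∨
      g = x + 5 + 5 + 5 + 5 ∨ g = x + 5 + 5 + 5 + 5 + 5 := by decide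
    rcases hall x g with rfl | rfl | rfl | rfl | rfl | rfl
    · exact hx
    · exact step _ hx
    · exact step _ (step _ hx)
    · exact step _ (step _ (step _ hx))
    · exact step _ (step _ (step _ (step _ hx)))
    · exact step _ (step _ (step _ (step _ (step _ hx))))
  · exact absurd hg (h g)
  · have a0 : A d := (h d).2 (Or.inl rfl)
    have a1 : A (d + 1) := (h _).2 (Or.inr (Or.inl rfl))
    have a2 : A (d + 2) := (h _).2 (Or.inr (Or.inr rfl))
    have r1 : Q (d + 1) → Q d := fun hq => by
      have := hr (d + 1) hq
      rw [e15] at this; exact this a0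
    have r2 : Q (d + 2) → Q (d + 1) := fun hq => by
      have := hr (d + 2) hq
      rw [e25] at this; exact this a1
    have l1 : Q d → Q (d + 1) := fun hq => hl _ (by rwa [e15]) a1
    have l2 : Q (d + 1) → Q (d + 2) := fun hq => hl _ (by rwa [e25]) a2
    rcases (h x).1 hxA with rfl | rfl | rfl <;> rcases (h g).1 hg with rfl | rfl | rfl <;> tauto

/-- If the special nodes span a scaled copy of `S`, then at its nodes there are no other faces. -/
lemma Settled.sub_of_mem (h : Settled F P) {c : Node} {a : ℕ} (ha : 0 < a)
    (hS : ∀ w x, S.at w x → GoodCorner F P (c + a • w) x a ∧ ∀ y, F (c + a • w) y ↔ S.at w y)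
    {m : Node} (hm : m ∈ S.scaled a) {g : ZMod 6} (hg : F (c + m) g) : S.sub a m g := by
  obtain ⟨x, hx⟩ := hm
  obtain ⟨w, y, e⟩ := exists_faceAt (latFace a (faceAt m x))
  have hw : S.at w y := by rw [Shape.at, ← e]; exact hx
  have vertex : ∀ v, m = a • v → S.sub a m g := by
    rintro v rfl
    have hv : S.at v x := (S.sub_smul ha v x).1 hx
    exact (S.sub_smul ha v g).2 (((hS v x hv).2 g).1 hg)
  obtain ⟨i, j, hij, hm⟩ := (inTri_faceAt w y m).1 ((inTri_iff ha _ m).2 ⟨x, e⟩)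
  by_cases h0 : i + j = 0
  · obtain ⟨rfl, rfl⟩ : i = 0 ∧ j = 0 := by omega
    exact vertex w (by rw [hm]; simp [gridPt])
  by_cases hi : i = a
  · obtain rfl : j = 0 := by omega
    exact vertex (w + dirVec y) (by rw [hm, gridPt_zero_right, smul_add, hi])
  by_cases hj : j = a
  · obtain rfl : i = 0 := by omega
    exact vertex (w + dirVec (y + 1)) (by rw [hm, gridPt_zero_left, smul_add, hj])
  have hnP : ¬ P (c + m) := by
    rw [hm, ← gridPt_add]
    exact (hS w y hw).1.not_special h hij (by omega) (by omega) (by omega)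
  have hflat : Flat (F (c + m)) := by
    by_contra hc
    exact hnP (h.of_not_flat _ hc)
  have h1 : ∀ w x, faceAt w x ∈ (S : Set Face) → GoodCorner F P (c + a • w) x a :=
    fun w x hw => (hS w x hw).1
  refine hflat.propagate (Q := S.sub a m) (fun g hq hf => ?_) (fun g hq hf => ?_) hx ?_ hg
  · exact h.mem_right ha h1 (fun w x hw hf => ((hS w x hw).2 _).1 hf) hq hf
  · exact h.mem_left ha h1 (fun w x hw hf => ((hS w _ hw).2 _).1 hf) hq hf
  · exact (hS w y hw).1.fill h e

/-- If the special nodes of a structure span a scaled copy of `S`, then the structure is that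
copy. -/
lemma Settled.mem_iff {Y : Set Node} (h : Settled (cellAt Y) P) {c : Node} {a : ℕ} (ha : 0 < a)
    (hS : ∀ w x, S.at w x →
      GoodCorner (cellAt Y) P (c + a • w) x a ∧ ∀ y, cellAt Y (c + a • w) y ↔ S.at w y)
    (hne : S.Nonempty) (hY : Chained Y)
    (hl : ∀ u ∈ Y, ∀ g, u + dirVec g ∈ Y → Linked (cellAt Y) u g) (m : Node) :
    c + m ∈ Y ↔ m ∈ S.scaled a := by
  have hsub : ∀ m ∈ S.scaled a, c + m ∈ Y := by
    rintro m ⟨x, hx⟩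
    obtain ⟨w, y, e⟩ := exists_faceAt (latFace a (faceAt m x))
    have hw : S.at w y := by rw [Shape.at, ← e]; exact hx
    exact ((hS w y hw).1.fill h e).1.1
  refine ⟨fun hm => ?_, hsub m⟩
  have hedge : ∀ m ∈ S.scaled a, ∀ g, Edge (cellAt Y) (c + m) g → m + dirVec g ∈ S.scaled a := by
    rintro m hm g (hg | hg)
    · exact (Shape.mem_of_sub (h.sub_of_mem ha hS hm hg)).2.1
    · have := (Shape.mem_of_sub (h.sub_of_mem ha hS hm hg)).2.2
      rwa [add_five_one] at this
  have key := hY {u | ∃ m ∈ S.scaled a, u = c + m} ?_ ?_ hm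
  · obtain ⟨m', hm', e⟩ := key
    rwa [add_left_cancel e]
  · obtain ⟨f, hf⟩ := hne
    obtain ⟨w, x, rfl⟩ := exists_faceAt f
    have : a • w ∈ S.scaled a := ⟨x, by rw [lat_vertex _ _ ha]; exact hf⟩
    exact ⟨_, hsub _ this, _, this, rfl⟩
  · rintro _ hu ⟨m, hm, rfl⟩ g hg
    rcases hl _ hu g hg with he | ⟨t, ht, h1, h2⟩
    · exact ⟨_, hedge m hm g he, by rw [add_assoc]⟩
    · have m1 := hedge m hm _ h1
      have m2 := hedge _ m1 _ (by rw [← add_assoc]; exact h2)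
      have hd : ∀ g t : ZMod 6, t = 1 ∨ t = 5 →
        dirVec (g + t) + dirVec (g - t) = dirVec g := by decide
      rw [add_assoc, hd g t ht] at m2
      exact ⟨_, m2, by rw [add_assoc]⟩

/-- Matching at special nodes recognizes the scaled copies of `S`, up to finitely many scales. -/
lemma Shape.IsConnected.exists_known_large (hconn : S.IsConnected) (hmin : S.IsMinimal) {k : ℕ}
    (hk : 2 ≤ k) : ∃ W, Known k W ∧ ∀ (X : Set Node), X.Finite → Chained X → ∀ e,
      ((∃ u ∈ X, ∃ r, W X u r e) →
        ∃ r s c, 0 < s ∧ place c r e ⁻¹' X = S.scaled s) ∧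
      ((∃ r s c, 4 ≤ s ∧ place c r e ⁻¹' X = S.scaled s) → ∃ u ∈ X, ∃ r, W X u r e) := by
  obtain ⟨i, hi⟩ := Shape.exists_spec hconn hmin
  obtain ⟨T, hT⟩ := hconn.exists_match
  obtain ⟨⟨f, hf⟩⟩ := hconn.nonempty
  obtain ⟨v₀, g₀, rfl⟩ := exists_faceAt f
  refine ⟨_, (known_regular hk i).and (Known.lab hk isEdge_cellAt (Known.edge hk)
    (Known.spec hk i) (Known.cellIn hk) S.at (Edge S.at) T v₀), fun X hX hc e => ?_⟩
  -- a regular structure is settled, in all positions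
  have settled : ∀ c r, Regular i X → Settled (cellAt (place c r e ⁻¹' X))
      (spec (cellAt (place c r e ⁻¹' X)) i) ∧ ∀ u ∈ place c r e ⁻¹' X, ∀ g,
        u + dirVec g ∈ place c r e ⁻¹' X → Linked (cellAt (place c r e ⁻¹' X)) u g := by
    intro c r hR
    refine ⟨settled_spec (faceLike_cellAt _) ?_ fun u hu => ?_, fun u hu g hg => ?_⟩
    · exact (hX.preimage place_bijective.1.injOn).subset fun u ⟨g, hg⟩ => hg.1.1
    · have huX : u ∈ place c r e ⁻¹' X := mem_of_spec (i := i + 1) (Or.inr hu)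
      have hcell : ∀ u g, cellAt X (place c r e u) (slot r e g) ↔
        cellAt (place c r e ⁻¹' X) u g := cellAt_place X
      rw [← spec_place hcell]
      refine (hR _ huX).1 ?_
      rwa [cross_place (edge_place hcell) (spec_place hcell i)]
    · rw [← linked_place (cellAt_place X)]
      refine (hR _ hu).2 _ ?_
      rw [← place_dir]; exact hg
  have labels : ∀ c r v u, Settled (cellAt (place c r e ⁻¹' X))
      (spec (cellAt (place c r e ⁻¹' X)) i) →
      (Lab (Edge (cellAt X)) (fun v => v ∈ X ∧ spec (cellAt X) i v) (cellIn X) S.at (Edge S.at) T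
        v (place c r e u) r e ↔ Match (Edge (cellAt (place c r e ⁻¹' X)))
          (spec (cellAt (place c r e ⁻¹' X)) i) (cellAt (place c r e ⁻¹' X)) S.at (Edge S.at) T
          v u) := by
    intro c r v u h
    rw [mem_and_spec]
    refine lab_place _ _ (edge_place (cellAt_place X)) (spec_place (cellAt_place X) i)
      (fun u g => by rw [cellIn_eq, cellAt_place]) (fun u g hu hg => ?_) T v u
    rcases hg with hg | hg
    · obtain ⟨a, ha⟩ := h.exists_nextAt hu hg
      exact ⟨_, ha.succ⟩
    · obtain ⟨a, ha⟩ := h.exists_nextAt hu hg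
      have := GoodCorner.next_left ⟨hu, hg, ha⟩ h
      rw [add_five_one] at this
      exact ⟨_, this.succ⟩
  constructor
  · rintro ⟨u, hu, r, hR, hl⟩
    obtain ⟨hset, hlink⟩ := settled u r hR
    have h0 : place u r e 0 = u := by simp [place, frameMap]
    have hm : Match _ _ _ _ _ _ _ _ := (labels u r v₀ 0 hset).1 (by rwa [h0])
    obtain ⟨c, a, ha, hall⟩ := hT hset hf hm
    refine ⟨r, a, place u r e c, ha, ?_⟩
    ext m
    rw [← hset.mem_iff ha hall ⟨_, hf⟩ hc.place hlink m, Set.mem_preimage, Set.mem_preimage,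
      place_add]
    rfl
  · rintro ⟨r, s, c, hs, hY⟩
    have hs0 : 0 < s := by omega
    have hcell : cellAt (place c r e ⁻¹' X) = S.sub s := by rw [hY, S.cellAt_scaled hs]
    have hcell' : ∀ u g, cellAt X (place c r e u) (slot r e g) ↔ S.sub s u g := fun u g => by
      rw [cellAt_place, hcell]
    have hclosed : ∀ m, Cross (Edge (S.sub s)) (spec (S.sub s) i) m → spec (S.sub s) i m := by
      intro m hm
      rw [S.spec_sub hs0] at hm ⊢
      obtain ⟨v, rfl, hv⟩ := (S.cross_sub hs0).1 hm
      exact ⟨v, rfl, (hi v).2 (spec_nonempty (i := i + 1) (Or.inr hv))⟩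
    have hR : Regular i X := by
      intro u hu
      obtain ⟨m, rfl⟩ := (place_bijective (c := c) (r := r) (e := e)).2 u
      constructor
      · rw [cross_place (edge_place hcell') (spec_place hcell' i), spec_place hcell']
        exact hclosed m
      · intro g hg
        obtain ⟨g, rfl⟩ := frame_surjective r e g
        rw [linked_place hcell']
        rw [← place_dir] at hg
        exact S.linked_sub (by omega) (hY ▸ hu) (hY ▸ hg)
    have hmatch : ∀ t v, (∃ g, S.at v g) → Match (Edge (S.sub s)) (spec (S.sub s) i) (S.sub s)
        S.at (Edge S.at) t v (s • v) := by
      intro t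
      induction t with
      | zero =>
        intro v hv
        refine ⟨?_, S.sub_smul hs0 v⟩
        rw [S.spec_sub hs0]
        exact ⟨v, rfl, (hi v).2 hv⟩
      | succ t ih =>
        intro v hv
        refine ⟨ih v hv, fun h hh => ⟨s • (v + dirVec h), ?_, ih _ ?_⟩⟩
        · have hv' := (edge_nonempty S.faceLike_at hh).2
          rw [S.spec_sub hs0, smul_add]
          refine ⟨s, hs0, rfl, ⟨v + dirVec h, (smul_add _ _ _).symm, (hi _).2 hv'⟩,
            fun j hj => (S.edge_sub hj).2 hh, ?_⟩
          rintro j hj hjs ⟨w, hw, -⟩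
          exact edge_node_ne hj hjs hw
        · exact (edge_nonempty S.faceLike_at hh).2
    have hu : place c r e (s • v₀) ∈ X := by
      have : s • v₀ ∈ S.scaled s := ⟨g₀, by rw [lat_vertex _ _ hs0]; exact hf⟩
      rw [← hY] at this
      exact this
    refine ⟨_, hu, r, hR, ?_⟩
    rw [labels c r v₀ _ (settled c r hR).1, hcell]
    exact hmatch T v₀ ⟨g₀, hf⟩

end

/-- A fixed finite connected structure is recognized by comparing all neighborhoods. -/
lemma exists_known_template (A : Set Node) {k : ℕ} (hk : 2 ≤ k) : ∃ W, Known k W ∧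
    ∀ (X : Set Node), X.Finite → Chained X → X.Nonempty → ∀ e,
      (∃ u ∈ X, ∃ r, W X u r e) ↔ ∃ r c, place c r e ⁻¹' X = A := by
  by_cases hA : A.Finite ∧ Chained A ∧ A.Nonempty
  swap
  · refine ⟨_, Known.const False, fun X h1 h2 h3 e => ?_⟩
    refine iff_of_false (fun ⟨_, _, _, h⟩ => h) ?_
    rintro ⟨r, c, rfl⟩
    obtain ⟨x, hx⟩ := h3
    obtain ⟨m, rfl⟩ := (place_bijective (c := c) (r := r) (e := e)).2 x
    exact hA ⟨h1.preimage place_bijective.1.injOn, h2.place, ⟨m, hx⟩⟩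
  obtain ⟨hfin, hchain, ⟨m₀, hm₀⟩⟩ := hA
  have : Finite A := hfin
  obtain ⟨T, hT⟩ := exists_levels (fun a b : A => ∃ g, b.1 = a.1 + dirVec g) fun a b => by
    have := hchain {v | ∃ hv : v ∈ A, Relation.ReflTransGen
      (fun a b : A => ∃ g, b.1 = a.1 + dirVec g) a ⟨v, hv⟩} ⟨a, a.2, a.2, .refl⟩
      (fun u _ ⟨hu, h⟩ g hg => ⟨hg, h.tail ⟨g, rfl⟩⟩) b.2
    exact this.choose_spec
  let D₀ : Node → ZMod 6 → Prop := fun v g => v + dirVec g ∈ A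
  let E : Set Node → Node → ZMod 6 → Prop := fun X u g => u ∈ X ∧ u + dirVec g ∈ X
  refine ⟨_, Known.lab hk isEdge_bond (D := fun X u g _ => u + dirVec g ∈ X)
    (Known.bond.congr fun X u g e hu => by simp [hu]) (Known.const True) Known.bond D₀ D₀ T m₀,
    fun X hX hc hne e => ?_⟩
  have hsucc : ∀ (Y : Set Node) u g, E Y u g → Succ (E Y) (fun v => v ∈ Y ∧ True) u g
      (u + dirVec g) := fun Y u g h =>
    ⟨1, one_pos, by simp, ⟨h.2, trivial⟩, fun i hi => by
      obtain rfl : i = 0 := by omega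
      simpa using h, fun i hi hi' => by omega⟩
  have labels : ∀ c r v u, (Lab (E X) (fun v => v ∈ X ∧ True) (fun u g _ => u + dirVec g ∈ X)
      D₀ D₀ T v (place c r e u) r e ↔ Match (E (place c r e ⁻¹' X))
        (fun v => v ∈ place c r e ⁻¹' X ∧ True) (fun u g => u + dirVec g ∈ place c r e ⁻¹' X)
        D₀ D₀ T v u) := by
    intro c r v u
    refine lab_place _ _ (fun u g => ?_) (fun u => Iff.rfl) (fun u g => ?_)
      (fun u g _ hg => ⟨_, hsucc _ u g hg⟩) T v u
    · simp only [E, ← place_dir, Set.mem_preimage]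
    · rw [← place_dir, Set.mem_preimage]
  constructor
  · rintro ⟨u, hu, r, hl⟩
    have h0 : place u r e 0 = u := by simp [place, frameMap]
    set Y := place u r e ⁻¹' X with hY
    have hm := (labels u r m₀ 0).1 (by rwa [h0])
    have all := hT (fun t m => Match (E Y) (fun v => v ∈ Y ∧ True) (fun u g => u + dirVec g ∈ Y)
      D₀ D₀ t m.1 (m.1 - m₀)) (fun t m h => h.1) ?_ ⟨m₀, hm₀⟩
    · have key : ∀ m, m - m₀ ∈ Y ↔ m ∈ A := by
        have hsub : ∀ m ∈ A, m - m₀ ∈ Y := fun m hm' =>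
          (all ⟨m, hm'⟩ (by rwa [sub_self])).1.1
        refine fun m => ⟨fun hmY => ?_, hsub m⟩
        have := (hc.place (c := u) (r := r) (e := e)) {x | x + m₀ ∈ A}
          ⟨0, sub_self m₀ ▸ hsub m₀ hm₀, by simpa using hm₀⟩ ?_ hmY
        · simpa using this
        · intro x hx hxA g hg
          have h1 := ((all ⟨x + m₀, hxA⟩ (by rwa [sub_self])).2 g).1
          rw [add_sub_cancel_right] at h1
          have := h1 hg
          change x + dirVec g + m₀ ∈ A
          rwa [show x + dirVec g + m₀ = x + m₀ + dirVec g by abel]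
      refine ⟨r, place u r e (-m₀), ?_⟩
      ext m
      rw [← key m, hY, Set.mem_preimage, Set.mem_preimage, sub_eq_neg_add, place_add]
      rfl
    · rintro t ⟨m, hm'⟩ ⟨n, hn⟩ ⟨g, hg⟩ h
      simp only at hg h ⊢
      subst hg
      obtain ⟨q, hq, hqM⟩ := h.2 g hn
      have hE : E Y (m - m₀) g := by
        obtain ⟨a, ha, -, -, he, -⟩ := hq
        simpa using he 0 ha
      rw [show m + dirVec g - m₀ = m - m₀ + dirVec g by abel, (hsucc Y _ _ hE).unique hq]
      exact hqM
  · rintro ⟨r, c, rfl⟩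
    refine ⟨_, hm₀, r, (labels c r m₀ m₀).2 ?_⟩
    have : ∀ t, ∀ m ∈ place c r e ⁻¹' X, Match (E (place c r e ⁻¹' X))
        (fun v => v ∈ place c r e ⁻¹' X ∧ True) (fun u g => u + dirVec g ∈ place c r e ⁻¹' X)
        D₀ D₀ t m m := by
      intro t
      induction t with
      | zero => exact fun m hm => ⟨⟨hm, trivial⟩, fun g => Iff.rfl⟩
      | succ t ih => exact fun m hm => ⟨ih m hm, fun h hh => ⟨_, hsucc _ _ _ ⟨hm, hh⟩, ih _ hh⟩⟩
    exact this T m₀ hm₀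

/-- The representations of `S` (for `e = true`) and of its mirror image (for `e = false`) are
recognized in the frames with sense of rotation `e`. -/
theorem Shape.exists_known {S : Shape} (hconn : S.IsConnected) (hmin : S.IsMinimal) {k : ℕ}
    (hk : 2 ≤ k) : ∃ W, Known k W ∧ ∀ (X : System) (e : Bool),
      (∃ u : X.Bot, ∃ r, W X.occupied u.1 r e) ↔
        (if e then S else S.mirror).IsRepresentation X.occupied := by
  obtain ⟨W, kW, hW⟩ := hconn.exists_known_large hmin hk
  have hsmall := fun s : Fin 4 => exists_known_template (S.scaled s) hk
  choose V kV hV using hsmall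
  refine ⟨_, kW.or (Known.exist fun s : Fin 4 => (Known.const (0 < s.1)).and (kV s)),
    fun X e => ?_⟩
  have hrep : (if e then S else S.mirror).IsRepresentation X.occupied ↔
      ∃ r s c, 0 < s ∧ place c r e ⁻¹' X.occupied = S.scaled s := by
    cases e
    · simp only [Bool.false_eq_true, if_false, mirror_isRepresentation_iff, eq_image_place_iff]
    · simp only [if_true, isRepresentation_iff, eq_image_place_iff]
  have hfin : (X.occupied : Set Node).Finite := X.occupied.finite_toSet
  have hne : (X.occupied : Set Node).Nonempty := by
    obtain ⟨u⟩ := X.connected.nonempty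
    exact ⟨u.1, u.2⟩
  rw [hrep]
  constructor
  · rintro ⟨u, r, h | ⟨s, hs, h⟩⟩
    · exact (hW _ hfin X.chained e).1 ⟨u, u.2, r, h⟩
    · obtain ⟨r, c, h⟩ := (hV s _ hfin X.chained hne e).1 ⟨u, u.2, r, h⟩
      exact ⟨r, s, c, hs, h⟩
  · rintro ⟨r, s, c, hs, h⟩
    rcases Nat.lt_or_ge s 4 with h4 | h4
    · obtain ⟨u, hu, r, h⟩ := (hV ⟨s, h4⟩ _ hfin X.chained hne e).2 ⟨r, c, h⟩
      exact ⟨⟨u, hu⟩, r, Or.inr ⟨⟨s, h4⟩, hs, h⟩⟩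
    · obtain ⟨u, hu, r, h⟩ := (hW _ hfin X.chained e).2 ⟨r, s, c, h4, h⟩
      exact ⟨⟨u, hu⟩, r, Or.inl h⟩

end Amoebot

theorem mainTheorem5 (S : Amoebot.Shape) (hconn : S.IsConnected) (hmin : S.IsMinimal)
    (k : ℕ) (hk : 2 ≤ k) :
    -- common chirality `χ`, in which the shape is read: `O(1)` rounds, with certainty
    (∃ (A : Amoebot.Algorithm k) (R : ℕ), ∀ (X : Amoebot.System) (χ : Bool),
      (∀ u, X.chirality u = χ) → ∀ coin : ℕ × X.Bot → Bool,
        A.IsSound X coin ((if χ then S else S.mirror).IsRepresentation X.occupied) ∧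
        A.HaltsWithin X coin R) ∧
    -- arbitrary chiralities: `O(log n)` rounds with high probability, never a wrong answer
    (∃ A : Amoebot.Algorithm k,
      (∀ (X : Amoebot.System) (coin : ℕ × X.Bot → Bool),
        A.IsSound X coin
          (S.IsRepresentation X.occupied ∨ S.mirror.IsRepresentation X.occupied)) ∧
      ∀ c : ℕ, ∃ C : ℝ, ∀ X : Amoebot.System,
        1 - 1 / (X.size : ℝ) ^ c ≤
          X.coinLaw.real
            {coin | ∃ R : ℕ, (R : ℝ) ≤ C * Real.log X.size ∧ A.HaltsWithin X coin R}) := by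
  obtain ⟨W, kW, hW⟩ := Amoebot.Shape.exists_known hconn hmin hk
  have dir : ∀ {X : Amoebot.System} {u : X.Bot} {e : Bool},
      (∃ l, W X.occupied u.1 (X.globalDir u l) e) ↔ ∃ r, W X.occupied u.1 r e := by
    intro X u e
    constructor
    · rintro ⟨l, h⟩; exact ⟨_, h⟩
    · rintro ⟨r, h⟩
      obtain ⟨l, rfl⟩ := X.exists_globalDir u r
      exact ⟨l, h⟩
  constructor
  · -- only frames with the private chirality of the amoebots are considered
    have h := Amoebot.Knowable.exists_bot (by omega : 0 < k)
      (Amoebot.Knowable.map (fun f : ZMod 6 → Bool → Prop => ∃ l, f l true) kW)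
    obtain ⟨A, R, hA⟩ := h.algorithm
    refine ⟨A, R, fun X χ hχ coin => ?_⟩
    rw [← hW X χ]
    have e : (∃ u : X.Bot, ∃ r, W X.occupied u.1 r χ) = ∃ u : X.Bot, ∃ l,
        W X.occupied u.1 (X.globalDir u l) (X.chirality u == true) := by
      refine propext (exists_congr fun u => ?_)
      rw [dir, hχ u, beq_true]
    rw [e]
    exact hA X coin
  · -- all frames are considered
    have h := Amoebot.Knowable.exists_bot (by omega : 0 < k)
      (Amoebot.Knowable.map (fun f : ZMod 6 → Bool → Prop => ∃ l b, f l b) kW)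
    obtain ⟨A, R, hA⟩ := h.algorithm
    have hP : ∀ X : Amoebot.System, (S.IsRepresentation X.occupied ∨
        S.mirror.IsRepresentation X.occupied) = ∃ u : X.Bot, ∃ l b,
          W X.occupied u.1 (X.globalDir u l) (X.chirality u == b) := by
      intro X
      have h1 := hW X true
      have h2 := hW X false
      simp only [if_true, Bool.false_eq_true, if_false] at h1 h2
      rw [← h1, ← h2, ← exists_or]
      refine propext (exists_congr fun u => ?_)
      rw [← dir, ← dir, ← exists_or]
      refine exists_congr fun l => ?_
      cases X.chirality u <;> simp [or_comm]
    refine ⟨A, fun X coin => ?_, fun c => ⟨R / Real.log 2, fun X => ?_⟩⟩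
    · rw [hP]
      exact (hA X coin).1
    · have hsize : 0 < X.size := by
        obtain ⟨u⟩ := X.connected.nonempty
        exact Finset.card_pos.2 ⟨u.1, u.2⟩
      rcases (show 1 ≤ X.size from hsize).lt_or_eq with h2 | h1
      · -- the bound holds for all coin tosses
        have hlog : (0 : ℝ) < Real.log 2 := Real.log_pos one_lt_two
        have hR : (R : ℝ) ≤ R / Real.log 2 * Real.log X.size := by
          rw [div_mul_eq_mul_div, le_div_iff₀ hlog]
          refine mul_le_mul_of_nonneg_left (Real.log_le_log two_pos ?_) (Nat.cast_nonneg R)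
          exact_mod_cast h2
        have huniv : {coin | ∃ R' : ℕ, (R' : ℝ) ≤ R / Real.log 2 * Real.log X.size ∧
            A.HaltsWithin X coin R'} = Set.univ :=
          Set.eq_univ_of_forall fun coin => ⟨R, hR, (hA X coin).2⟩
        have : IsProbabilityMeasure X.coinLaw := by
          have : IsProbabilityMeasure (uniformOn (Set.univ : Set Bool)) :=
            isProbabilityMeasure_uniformOn Set.finite_univ Set.univ_nonempty
          unfold Amoebot.System.coinLaw
          infer_instance
        rw [huniv, probReal_univ, sub_le_self_iff]
        positivity
      · -- a single amoebot is not bound to terminate within `C * log 1 = 0` rounds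
        rw [← h1]
        simp only [Nat.cast_one, one_pow, div_one, sub_self]
        exact measureReal_nonneg
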